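/- **Theorem (Locality).** *Programs.* Fix a set $\mathrm{DOM}$ of data values, which also serve as addresses, with a distinguished value $0$. A concurrent program $P$ consists of finitely many threads. Each thread has finitely many local registers, an initial label, and a finite list of labelled instructions $\ell: \mathit{inst};\ \mathrm{goto}\ \ell'$ (several instructions may carry the same label). The instructions are loads $r \leftarrow \mathrm{mem}[e]$, stores $\mathrm{mem}[e] \leftarrow e'$, local assignments $r \leftarrow e$, assertions $\mathrm{assert}\ e$ (passed iff the value of $e$ is not $0$), $\mathrm{scfence}$, and $\mathrm{fence}\ e_1 \dots e_n$; an expression is a function $\mathrm{DOM}^* \to \mathrm{DOM}$ applied to registers of the thread. *Store-atomic semantics.* Initially all registers and addresses hold $0$ and all buffers are empty. Each thread has one FIFO buffer per address and one FIFO all-addresses buffer. Issuing a store (action $\mathrm{isu}$) appends it to the thread's buffer for its address; the oldest store of a per-address buffer may at any time move silently to the end of the thread's all-addresses buffer; when a store is the oldest entry of the all-addresses buffer, it may be written to memory (action $\mathrm{st}$ with address and value). A load (action $\mathrm{ld}$ with address and value) returns the most recent store to its address in the thread's per-address buffer, or else in its all-addresses buffer, or else the memory value. An $\mathrm{scfence}$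 can be executed only if all buffers of the thread are empty. A $\mathrm{fence}$ can be issued (action $\mathrm{isu}$) only if the thread's per-address buffers for the listed addresses are empty; it is then appended to the all-addresses buffer and is executed (action $\mathrm{fence}$ with the list of addresses) when it is the oldest entry there. Local assignments and assertions perform a local action. A computation of $P$ is the sequence of actions of a run from the initial state to a state in which all buffers are empty, where every issue $\mathrm{isu}_x$ refers to its store or fence $x$. An SC computation is a computation in which every $\mathrm{isu}_x$ is immediately followed by $x$. *Traces.* The happens-before trace of a computation $\tau$ is the directed graph whose nodes are the actions of $\tau$, where $\mathrm{isu}_x$ and $x$ are the same node and the nodes of each thread are identified by their position in program order, with four kinds of edges. Program order: $x \to_{po} y$ if $x$ and $y$ are actions of the same thread and $x$ precedes $y$ in $\tau$, stores and fences being placed at their issue. Store order: $x \to_{st} y$ if $x, y$ are stores to the same address and $x$ reaches memory before $y$. Source: $x \to_{src} y$ if $y$ is a load of an address $a$ and $x$ is the most recently issued store to $a$ of $y$'s thread that is issued before $y$ and reaches memory after $y$, or, if there is none, $x$ is the last store to $a$ that reaches memory before $y$. Conflict: $x \to_{cf} y$ if $x$ is a load and $y$ a store to the same address and either some $z$ satisfies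 $z \to_{src} x$ and $z \to_{st} y$, or no $z$ satisfies $z \to_{src} x$ and no $z$ satisfies $z \to_{st} y$. The program $P$ is robust if the trace of every computation of $P$ is the trace of some SC computation of $P$. A computation is violating if its trace has a directed cycle (with edges of any of the four kinds). A thread delays actions in $\tau$ if for some store or fence $x$ of that thread, at least one action of the same thread occurs in $\tau$ strictly between $\mathrm{isu}_x$ and $x$. *Claim.* $P$ is not robust if and only if $P$ has a violating computation in which exactly one thread delays actions. -/

import Mathlib

namespace StoreAtomic

/-! ### Syntax -/

/-- An expression: a function on finite sequences of data values, applied to registers. -/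
structure Expr (Dom Reg : Type*) where
  fn : List Dom → Dom
  args : List Reg

/-- The value of an expression under a valuation of the registers. -/
def Expr.eval {Dom Reg : Type*} (e : Expr Dom Reg) (ρ : Reg → Dom) : Dom :=
  e.fn (e.args.map ρ)

/-- The instructions. Data values also serve as addresses. -/
inductive Inst (Dom Reg : Type*) where
  /-- `r ← mem[e]` -/
  | load (r : Reg) (e : Expr Dom Reg)
  /-- `mem[ea] ← ev` -/
  | store (ea ev : Expr Dom Reg)
  /-- `r ← e` -/
  | assign (r : Reg) (e : Expr Dom Reg)
  /-- `assert e` -/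
  | assertion (e : Expr Dom Reg)
  | scfence
  /-- `fence e₁ … eₙ` -/
  | fence (es : List (Expr Dom Reg))

/-- A labelled instruction `label: inst; goto next`. -/
structure LInst (Dom Reg Label : Type*) where
  label : Label
  inst : Inst Dom Reg
  next : Label

/-- The code of a thread: an initial label and finitely many labelled instructions. Several
instructions may carry the same label (non-determinism). -/
structure ThreadCode (Dom Reg Label : Type*) where
  init : Label
  code : List (LInst Dom Reg Label)

/-- A concurrent program assigns code to each of its threads. Registers are local to threads:
each thread has its own valuation of the register names. -/
abbrev Program (Dom Thread Reg Label : Type*) := Thread → ThreadCode Dom Reg Label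

/-! ### Actions and computations -/

/-- The kinds of actions: store and load with address and value, issue (of a store or fence),
local action, scfence, and fence with a list of addresses. -/
inductive Act (Dom : Type*) where
  | st (a v : Dom)
  | ld (a v : Dom)
  | isu
  | loc
  | scfence
  | fence (as : List Dom)

/-- An action of a thread. It belongs to the instruction instance number `node` (counted from `0`
in program order) of that thread. The issue of a store or fence and the store or fence itself
belong to the same instance; this is how the two actions refer to each other. -/
structure Action (Dom Thread : Type*) where
  thread : Thread
  node : ℕ
  act : Act Dom

/-- `x` is a store to address `a`. -/
def Action.IsStoreTo {Dom Thread : Type*} (x : Action Dom Thread) (a : Dom) : Prop :=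
  ∃ v, x.act = Act.st a v

/-- The issue action that corresponds to a store or fence `x`. -/
def Action.issue {Dom Thread : Type*} (x : Action Dom Thread) : Action Dom Thread :=
  ⟨x.thread, x.node, Act.isu⟩

/-- The entries of all-addresses buffers: stores `a ← v` and fences, with the number of the
instruction instance that they belong to. -/
inductive Entry (Dom : Type*) where
  | st (n : ℕ) (a v : Dom)
  | fence (n : ℕ) (as : List Dom)

/-- The entry is a store to address `a`. -/
def Entry.IsStoreTo {Dom : Type*} (x : Entry Dom) (a : Dom) : Prop :=
  ∃ n v, x = Entry.st n a v

/-- The states of the machine. In the buffers, the oldest entry is the first one. -/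
structure State (Dom Thread Reg Label : Type*) where
  /-- program counters -/
  pc : Thread → Label
  /-- the values of the local registers -/
  reg : Thread → Reg → Dom
  /-- the global memory -/
  mem : Dom → Dom
  /-- the per-address buffers of each thread; entries are pairs of an instance number and
  a value -/
  buf : Thread → Dom → List (ℕ × Dom)
  /-- the all-addresses buffer of each thread -/
  abuf : Thread → List (Entry Dom)
  /-- the number of instructions that each thread has issued or executed so far -/
  cnt : Thread → ℕ

/-- The initial state. -/
def State.initial {Dom Thread Reg Label : Type*} [Zero Dom] (P : Program Dom Thread Reg Label) :
    State Dom Thread Reg Label where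
  pc := fun t => (P t).init
  reg := fun _ _ => 0
  mem := fun _ => 0
  buf := fun _ _ => []
  abuf := fun _ => []
  cnt := fun _ => 0

/-- All buffers are empty. -/
def State.BuffersEmpty {Dom Thread Reg Label : Type*} (s : State Dom Thread Reg Label) : Prop :=
  ∀ t, s.abuf t = [] ∧ ∀ a, s.buf t a = []

open Classical in
/-- Thread `t` passes on to label `l` and increments its number of instruction instances. -/
noncomputable def State.goto {Dom Thread Reg Label : Type*} (s : State Dom Thread Reg Label)
    (t : Thread) (l : Label) : State Dom Thread Reg Label :=
  { s with
    pc := Function.update s.pc t l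
    cnt := Function.update s.cnt t (s.cnt t + 1) }

open Classical in
/-- Assign `v` to register `r` of thread `t`. -/
noncomputable def State.setReg {Dom Thread Reg Label : Type*} (s : State Dom Thread Reg Label)
    (t : Thread) (r : Reg) (v : Dom) : State Dom Thread Reg Label :=
  { s with reg := Function.update s.reg t (Function.update (s.reg t) r v) }

open Classical in
/-- Assign `v` to address `a` of the global memory. -/
noncomputable def State.setMem {Dom Thread Reg Label : Type*} (s : State Dom Thread Reg Label)
    (a v : Dom) : State Dom Thread Reg Label :=
  { s with mem := Function.update s.mem a v }

open Classical in
/-- Replace the content of the per-address buffer of thread `t` for address `a`. -/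
noncomputable def State.setBuf {Dom Thread Reg Label : Type*} (s : State Dom Thread Reg Label)
    (t : Thread) (a : Dom) (b : List (ℕ × Dom)) : State Dom Thread Reg Label :=
  { s with buf := Function.update s.buf t (Function.update (s.buf t) a b) }

open Classical in
/-- Replace the content of the all-addresses buffer of thread `t`. -/
noncomputable def State.setABuf {Dom Thread Reg Label : Type*} (s : State Dom Thread Reg Label)
    (t : Thread) (b : List (Entry Dom)) : State Dom Thread Reg Label :=
  { s with abuf := Function.update s.abuf t b }

/-- Thread `t` can execute `inst` next and then continues at label `l`. -/
def Enabled {Dom Thread Reg Label : Type*} (P : Program Dom Thread Reg Label)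
    (s : State Dom Thread Reg Label) (t : Thread) (inst : Inst Dom Reg) (l : Label) : Prop :=
  (⟨s.pc t, inst, l⟩ : LInst Dom Reg Label) ∈ (P t).code

/-- The transition relation. The transition from the per-address to the all-addresses buffer is
silent (label `none`), all other transitions perform an action. -/
inductive Step {Dom Thread Reg Label : Type*} [Zero Dom] (P : Program Dom Thread Reg Label) :
    State Dom Thread Reg Label → Option (Action Dom Thread) → State Dom Thread Reg Label → Prop
  /-- Read the most recent store to the address in the per-address buffer. -/
  | earlyRead₁ (s : State Dom Thread Reg Label) (t : Thread) (r : Reg) (e : Expr Dom Reg)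
      (l : Label) (b : List (ℕ × Dom)) (n : ℕ) (v : Dom)
      (hi : Enabled P s t (Inst.load r e) l)
      (hb : s.buf t (e.eval (s.reg t)) = b ++ [(n, v)]) :
      Step P s (some ⟨t, s.cnt t, Act.ld (e.eval (s.reg t)) v⟩) ((s.setReg t r v).goto t l)
  /-- If the per-address buffer is empty, read the most recent store to the address in the
  all-addresses buffer. -/
  | earlyRead₂ (s : State Dom Thread Reg Label) (t : Thread) (r : Reg) (e : Expr Dom Reg)
      (l : Label) (b c : List (Entry Dom)) (n : ℕ) (v : Dom)
      (hi : Enabled P s t (Inst.load r e) l)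
      (hb : s.buf t (e.eval (s.reg t)) = [])
      (ha : s.abuf t = b ++ Entry.st n (e.eval (s.reg t)) v :: c)
      (hc : ∀ x ∈ c, ¬ x.IsStoreTo (e.eval (s.reg t))) :
      Step P s (some ⟨t, s.cnt t, Act.ld (e.eval (s.reg t)) v⟩) ((s.setReg t r v).goto t l)
  /-- If the buffers contain no store to the address, read from memory. -/
  | readMemory (s : State Dom Thread Reg Label) (t : Thread) (r : Reg) (e : Expr Dom Reg)
      (l : Label)
      (hi : Enabled P s t (Inst.load r e) l)
      (hb : s.buf t (e.eval (s.reg t)) = [])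
      (ha : ∀ x ∈ s.abuf t, ¬ x.IsStoreTo (e.eval (s.reg t))) :
      Step P s (some ⟨t, s.cnt t, Act.ld (e.eval (s.reg t)) (s.mem (e.eval (s.reg t)))⟩)
        ((s.setReg t r (s.mem (e.eval (s.reg t)))).goto t l)
  /-- Issue a store: it enters the per-address buffer. -/
  | issueStore (s : State Dom Thread Reg Label) (t : Thread) (ea ev : Expr Dom Reg) (l : Label)
      (hi : Enabled P s t (Inst.store ea ev) l) :
      Step P s (some ⟨t, s.cnt t, Act.isu⟩)
        ((s.setBuf t (ea.eval (s.reg t))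
          (s.buf t (ea.eval (s.reg t)) ++ [(s.cnt t, ev.eval (s.reg t))])).goto t l)
  /-- The oldest store of a per-address buffer advances to the all-addresses buffer. -/
  | advance (s : State Dom Thread Reg Label) (t : Thread) (a : Dom) (n : ℕ) (v : Dom)
      (b : List (ℕ × Dom))
      (hb : s.buf t a = (n, v) :: b) :
      Step P s none ((s.setBuf t a b).setABuf t (s.abuf t ++ [Entry.st n a v]))
  /-- The oldest entry of an all-addresses buffer is a store, which reaches the memory. -/
  | storeToMemory (s : State Dom Thread Reg Label) (t : Thread) (n : ℕ) (a v : Dom)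
      (b : List (Entry Dom))
      (ha : s.abuf t = Entry.st n a v :: b) :
      Step P s (some ⟨t, n, Act.st a v⟩) ((s.setMem a v).setABuf t b)
  /-- An `scfence` can be executed if all buffers of the thread are empty. -/
  | scfence (s : State Dom Thread Reg Label) (t : Thread) (l : Label)
      (hi : Enabled P s t Inst.scfence l)
      (ha : s.abuf t = [])
      (hb : ∀ a, s.buf t a = []) :
      Step P s (some ⟨t, s.cnt t, Act.scfence⟩) (s.goto t l)
  /-- A `fence` can be issued if the per-address buffers of the thread for the given addresses
  are empty. It enters the all-addresses buffer. -/
  | issueFence (s : State Dom Thread Reg Label) (t : Thread) (es : List (Expr Dom Reg)) (l : Label)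
      (hi : Enabled P s t (Inst.fence es) l)
      (hb : ∀ e ∈ es, s.buf t (e.eval (s.reg t)) = []) :
      Step P s (some ⟨t, s.cnt t, Act.isu⟩)
        ((s.setABuf t
          (s.abuf t ++ [Entry.fence (s.cnt t) (es.map fun e => e.eval (s.reg t))])).goto t l)
  /-- The oldest entry of an all-addresses buffer is a fence, which is executed. -/
  | fence (s : State Dom Thread Reg Label) (t : Thread) (n : ℕ) (as : List Dom)
      (b : List (Entry Dom))
      (ha : s.abuf t = Entry.fence n as :: b) :
      Step P s (some ⟨t, n, Act.fence as⟩) (s.setABuf t b)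
  /-- A local assignment. -/
  | assign (s : State Dom Thread Reg Label) (t : Thread) (r : Reg) (e : Expr Dom Reg) (l : Label)
      (hi : Enabled P s t (Inst.assign r e) l) :
      Step P s (some ⟨t, s.cnt t, Act.loc⟩) ((s.setReg t r (e.eval (s.reg t))).goto t l)
  /-- An assertion, which can only be passed if the value of the expression is not `0`. -/
  | assertion (s : State Dom Thread Reg Label) (t : Thread) (e : Expr Dom Reg) (l : Label)
      (hi : Enabled P s t (Inst.assertion e) l)
      (he : e.eval (s.reg t) ≠ 0) :
      Step P s (some ⟨t, s.cnt t, Act.loc⟩) (s.goto t l)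

/-- `Run P s τ s'`: there is a sequence of transitions from `s` to `s'` that performs the sequence
of actions `τ`. -/
inductive Run {Dom Thread Reg Label : Type*} [Zero Dom] (P : Program Dom Thread Reg Label) :
    State Dom Thread Reg Label → List (Action Dom Thread) → State Dom Thread Reg Label → Prop
  | nil (s : State Dom Thread Reg Label) : Run P s [] s
  | cons {s s' s'' : State Dom Thread Reg Label} {o : Option (Action Dom Thread)}
      {τ : List (Action Dom Thread)} (h : Step P s o s') (hr : Run P s' τ s'') :
      Run P s (o.toList ++ τ) s''

/-- The computations of a program: the action sequences of runs from the initial state to a state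
with empty buffers. -/
def computations {Dom Thread Reg Label : Type*} [Zero Dom] (P : Program Dom Thread Reg Label) :
    Set (List (Action Dom Thread)) :=
  {τ | ∃ s, Run P (State.initial P) τ s ∧ s.BuffersEmpty}

/-- The computations under sequential consistency: stores (and fences) take effect immediately,
that is, every issue is directly followed by the corresponding store or fence. -/
def scComputations {Dom Thread Reg Label : Type*} [Zero Dom] (P : Program Dom Thread Reg Label) :
    Set (List (Action Dom Thread)) :=
  {τ | τ ∈ computations P ∧
    ∀ τ₁ τ₂ t n, τ = τ₁ ++ ⟨t, n, Act.isu⟩ :: τ₂ →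
      ∃ x τ₃, τ₂ = x :: τ₃ ∧ x.thread = t ∧ x.node = n}

/-! ### Happens-before traces -/

/-- `x` occurs before `y` in `τ`. -/
def Before {Dom Thread : Type*} (τ : List (Action Dom Thread)) (x y : Action Dom Thread) : Prop :=
  ∃ τ₁ τ₂ τ₃, τ = τ₁ ++ x :: τ₂ ++ y :: τ₃

/-- The nodes of the trace: the actions of `τ`, where an issue is identified with the
corresponding store or fence. -/
def nodes {Dom Thread : Type*} (τ : List (Action Dom Thread)) : Set (Action Dom Thread) :=
  {x | x ∈ τ ∧ x.act ≠ Act.isu}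

/-- The program order: for stores and fences, the moment of their issue counts, and instruction
instances are numbered in this order. -/
def programOrder {Dom Thread : Type*} (τ : List (Action Dom Thread))
    (x y : Action Dom Thread) : Prop :=
  x ∈ nodes τ ∧ y ∈ nodes τ ∧ x.thread = y.thread ∧ x.node < y.node

/-- The store order: the order in which the stores to an address reach the memory. -/
def storeOrder {Dom Thread : Type*} (τ : List (Action Dom Thread))
    (x y : Action Dom Thread) : Prop :=
  ∃ a, x.IsStoreTo a ∧ y.IsStoreTo a ∧ Before τ x y

/-- With respect to the computation `α ++ β`, the action `x` is a store of thread `t` to address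
`a` that is issued in `α` and reaches the memory in `β`. -/
def Pending {Dom Thread : Type*} (α β : List (Action Dom Thread)) (t : Thread) (a : Dom)
    (x : Action Dom Thread) : Prop :=
  x.thread = t ∧ x.IsStoreTo a ∧ x.issue ∈ α ∧ x ∈ β

/-- The source relation: `x` is the store from which the load `y` receives its value. This is the
most recently issued store of the same thread to the address that has not reached the memory yet,
if any, and otherwise the last store to the address that has reached the memory. -/
def source {Dom Thread : Type*} (τ : List (Action Dom Thread))
    (x y : Action Dom Thread) : Prop :=
  ∃ a v α β, y.act = Act.ld a v ∧ τ = α ++ y :: β ∧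
    ((Pending α β y.thread a x ∧ ∀ z, Pending α β y.thread a z → z.node ≤ x.node) ∨
      ((∀ z, ¬ Pending α β y.thread a z) ∧
        ∃ γ δ, α = γ ++ x :: δ ∧ x.IsStoreTo a ∧ ∀ z ∈ δ, ¬ z.IsStoreTo a))

/-- The conflict relation from loads to stores: the source of the load is before the store in the
store order, or the load reads the initial value and the store is the first one to the address. -/
def conflict {Dom Thread : Type*} (τ : List (Action Dom Thread))
    (x y : Action Dom Thread) : Prop :=
  ∃ a v, x ∈ τ ∧ y ∈ τ ∧ x.act = Act.ld a v ∧ y.IsStoreTo a ∧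
    ((∃ z, source τ z x ∧ storeOrder τ z y) ∨
      ((∀ z, ¬ source τ z x) ∧ ∀ z, ¬ storeOrder τ z y))

/-- Happens-before traces: directed graphs with four kinds of edges, the nodes of which are
actions. -/
structure Trace (Dom Thread : Type*) where
  nodes : Set (Action Dom Thread)
  po : Action Dom Thread → Action Dom Thread → Prop
  st : Action Dom Thread → Action Dom Thread → Prop
  src : Action Dom Thread → Action Dom Thread → Prop
  cf : Action Dom Thread → Action Dom Thread → Prop

/-- The happens-before trace of a computation. -/
def traceOf {Dom Thread : Type*} (τ : List (Action Dom Thread)) : Trace Dom Thread where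
  nodes := nodes τ
  po := programOrder τ
  st := storeOrder τ
  src := source τ
  cf := conflict τ

/-- The happens-before relation of a trace. -/
def Trace.hb {Dom Thread : Type*} (T : Trace Dom Thread) (x y : Action Dom Thread) : Prop :=
  T.po x y ∨ T.st x y ∨ T.src x y ∨ T.cf x y

/-- The happens-before relation of the trace has a cycle. -/
def Trace.Cyclic {Dom Thread : Type*} (T : Trace Dom Thread) : Prop :=
  ∃ x, Relation.TransGen T.hb x x

/-! ### Robustness, violations, delays -/

/-- A program is robust if the traces of its computations are traces of computations under
sequential consistency. -/
def Robust {Dom Thread Reg Label : Type*} [Zero Dom] (P : Program Dom Thread Reg Label) : Prop :=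
  traceOf '' computations P ⊆ traceOf '' scComputations P

/-- A violating computation: a computation with a cyclic happens-before trace. -/
def Violating {Dom Thread Reg Label : Type*} [Zero Dom] (P : Program Dom Thread Reg Label)
    (τ : List (Action Dom Thread)) : Prop :=
  τ ∈ computations P ∧ (traceOf τ).Cyclic

/-- Thread `t` delays an action in `τ`: some store or fence `x` of `t` overtakes an action `y` of
`t`, which means that `y` occurs between the issue of `x` and `x` itself. -/
def DelaysActions {Dom Thread : Type*} (τ : List (Action Dom Thread)) (t : Thread) : Prop :=
  ∃ τ₁ τ₂ τ₃ x, τ = τ₁ ++ x.issue :: τ₂ ++ x :: τ₃ ∧ x.thread = t ∧ ∃ y ∈ τ₂, y.thread = t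

end StoreAtomic

/-! A trace is acyclic exactly when it is the trace of an SC computation. In an SC computation the
execution order extends program order, so all four kinds of edges point forward
(`not_cyclic_of_sc`). Conversely, an acyclic happens-before relation has a linear extension, and
executing the nodes in that order, with every issue as late as possible, gives an SC computation
with the same trace (`exists_sc_of_not_cyclic`). Hence non-robustness means that some computation is
violating, and the content of the theorem is that a violation can be transformed into one where a
single thread delays (`Violating.exists_single_thread`).

The transformation does not touch buffers. A computation is replaced by an abstract execution
`Valid`: a finite set of nodes with a strict total execution order `lt` that may deviate from
program order only as `Act.MayReorder` allows, and in which each load takes the value of its last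
visible store. `exists_realizes` extracts such an execution from a computation by an invariant on
runs; `Valid.exists_computation` goes back by simulating the machine. A thread delays actions in the
resulting computation only if two of its nodes are executed against program order.

For locality, take a cyclic execution with the fewest nodes. Let `m` be the node executed last among
the final nodes of the threads, and choose the order so that as few nodes as possible come after
`m`. By minimality, every cycle passes through `m` and every node happens before `m`. After `m`
there are only delayed stores and fences, and the successors of `m` in the happens-before relation
are stores after `m` to the address of `m`. Let `x` be the first of these. It belongs to another
thread `s`; let `e` be the last node of `s`, so that there is a cycle `m → x → e → … → z → m`.

Now delete `m`. What remains is acyclic and can be executed along a linear extension, except that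
the nodes of `s` that came after `m` are held back until the very end. Finally `m` is inserted just
before these. The cycle is still there, and only `s` delays
(`MinimalViolation.exists_single_thread`). If `m` is a load it may read a different value, which is
harmless because nothing follows it in its thread. The delicate point is that holding back stores of
`s` can change their order against stores of other threads. `exists_path` shows that the path from
`e` to `z` does not notice; the only dangerous case, a load `e` that reads early, is excluded by
`not_early_read`, since then `e` could be dropped from the cycle. -/

namespace StoreAtomic

open Relation

/-! ### Strict total orders on sets -/

/-- `lt` is a strict total order on the set `N`. -/
structure StrictOn {α : Type*} (N : Set α) (lt : α → α → Prop) : Prop where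
  irrefl : ∀ x ∈ N, ¬ lt x x
  trans : ∀ x ∈ N, ∀ y ∈ N, ∀ z ∈ N, lt x y → lt y z → lt x z
  total : ∀ x ∈ N, ∀ y ∈ N, x ≠ y → lt x y ∨ lt y x

/-- The lexicographic order given by a rank function and a relation. -/
def RankLex {α : Type*} (g : α → ℕ) (lt : α → α → Prop) (x y : α) : Prop :=
  g x < g y ∨ (g x = g y ∧ lt x y)

section StrictOn

variable {α : Type*} {N S : Set α} {lt : α → α → Prop}

theorem StrictOn.subset (h : StrictOn N lt) (hS : S ⊆ N) : StrictOn S lt :=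
  ⟨fun x hx => h.irrefl x (hS hx),
   fun x hx y hy z hz => h.trans x (hS hx) y (hS hy) z (hS hz),
   fun x hx y hy => h.total x (hS hx) y (hS hy)⟩

theorem StrictOn.asymm (h : StrictOn N lt) {x y : α} (hx : x ∈ N) (hy : y ∈ N) (hxy : lt x y) :
    ¬ lt y x := fun hyx => h.irrefl x hx (h.trans x hx y hy x hx hxy hyx)

theorem StrictOn.lt_of_not (h : StrictOn N lt) {x y : α} (hx : x ∈ N) (hy : y ∈ N)
    (hxy : ¬ lt x y) : x = y ∨ lt y x := by
  by_cases e : x = y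
  · exact Or.inl e
  · exact Or.inr ((h.total x hx y hy e).resolve_left hxy)

/-- Transitivity and totality of `lt` matter only among elements of equal rank. This covers
`insertLt`, where the inserted node is not related to the others by the underlying order. -/
theorem StrictOn.rankLex {g : α → ℕ} (hi : ∀ x ∈ N, ¬ lt x x)
    (ht : ∀ x ∈ N, ∀ y ∈ N, ∀ z ∈ N, g x = g y → g y = g z → lt x y → lt y z → lt x z)
    (hc : ∀ x ∈ N, ∀ y ∈ N, g x = g y → x ≠ y → lt x y ∨ lt y x) :
    StrictOn N (RankLex g lt) := by
  refine ⟨?_, ?_, ?_⟩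
  · rintro x hx (h | h)
    · omega
    · exact hi x hx h.2
  · rintro x hx y hy z hz (h | h) (h' | h')
    · left; omega
    · left; omega
    · left; omega
    · exact Or.inr ⟨by omega, ht x hx y hy z hz h.1 h'.1 h.2 h'.2⟩
  · intro x hx y hy hne
    rcases lt_trichotomy (g x) (g y) with h | h | h
    · exact Or.inl (Or.inl h)
    · rcases hc x hx y hy h hne with h' | h'
      · exact Or.inl (Or.inr ⟨h, h'⟩)
      · exact Or.inr (Or.inr ⟨h.symm, h'⟩)
    · exact Or.inr (Or.inl h)

theorem StrictOn.toRankLex (h : StrictOn N lt) (g : α → ℕ) : StrictOn N (RankLex g lt) :=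
  StrictOn.rankLex h.irrefl (fun x hx y hy z hz _ _ => h.trans x hx y hy z hz)
    (fun x hx y hy _ => h.total x hx y hy)

/-- An element with the fewest elements above it is maximal: anything above it would have fewer
still. -/
theorem StrictOn.exists_max (h : StrictOn N lt) (hf : N.Finite) (hne : N.Nonempty) :
    ∃ x ∈ N, ∀ z ∈ N, z = x ∨ lt z x := by
  obtain ⟨x, hx, hmin⟩ := Set.exists_min_image N (fun x => {r ∈ N | lt x r}.ncard) hf hne
  refine ⟨x, hx, fun z hz => ?_⟩
  by_contra! hc
  have hxz : lt x z := (h.total x hx z hz hc.1.symm).resolve_right hc.2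
  have h1 : {r ∈ N | lt z r}.ncard < {r ∈ N | lt x r}.ncard := by
    apply Set.ncard_lt_ncard _ (hf.subset (Set.sep_subset _ _))
    refine ⟨fun r hr => ⟨hr.1, h.trans x hx z hz r hr.1 hxz hr.2⟩, fun hsub => ?_⟩
    exact h.irrefl z hz (hsub ⟨hz, hxz⟩).2
  exact absurd (hmin z hz) (by omega)

theorem StrictOn.swap (h : StrictOn N lt) : StrictOn N (fun x y => lt y x) :=
  ⟨h.irrefl, fun x hx y hy z hz h1 h2 => h.trans z hz y hy x hx h2 h1,
    fun x hx y hy hne => (h.total x hx y hy hne).symm⟩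

theorem StrictOn.exists_min (h : StrictOn N lt) (hf : N.Finite) (hne : N.Nonempty) :
    ∃ x ∈ N, ∀ z ∈ N, z = x ∨ lt x z := h.swap.exists_max hf hne

end StrictOn

/-! ### Paths that avoid an element -/

section Avoid

variable {α : Type*} {r : α → α → Prop}

/-- The relation `r` without the element `m`. -/
def Avoiding (r : α → α → Prop) (m x y : α) : Prop := r x y ∧ x ≠ m ∧ y ≠ m

theorem reflTransGen_avoiding {m x y : α} (h : ReflTransGen r x y) (hxm : x ≠ m) (hym : y ≠ m) :
    ReflTransGen (Avoiding r m) x y ∨ (TransGen r x m ∧ TransGen r m y) := by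
  induction h with
  | refl => exact Or.inl .refl
  | @tail b c hb hbc ih =>
    by_cases e : b = m
    · subst e
      refine Or.inr ⟨?_, .single hbc⟩
      rcases reflTransGen_iff_eq_or_transGen.1 hb with h | h
      · exact absurd h.symm hxm
      · exact h
    · rcases ih e with h | h
      · exact Or.inl (h.tail ⟨hbc, e, hym⟩)
      · exact Or.inr ⟨h.1, h.2.tail hbc⟩

/-- A path to `m` reaches `m` for the first time. -/
theorem exists_first_arrival {m x : α} (h : TransGen r x m) (hxm : x ≠ m) :
    ∃ z, z ≠ m ∧ ReflTransGen (Avoiding r m) x z ∧ r z m := by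
  induction h using TransGen.head_induction_on with
  | @single a h => exact ⟨a, hxm, .refl, h⟩
  | @head a c hac hc ih =>
    by_cases e : c = m
    · subst e; exact ⟨a, hxm, .refl, hac⟩
    · obtain ⟨z, hz, hcz, hzm⟩ := ih e
      exact ⟨z, hz, .head ⟨hac, hxm, e⟩ hcz, hzm⟩

theorem transGen_avoiding {m x y : α} (h : TransGen r x y) (hxm : x ≠ m) (hym : y ≠ m) :
    TransGen (Avoiding r m) x y ∨ (TransGen r x m ∧ TransGen r m y) := by
  obtain ⟨b, hxb, hby⟩ := TransGen.tail'_iff.1 h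
  by_cases e : b = m
  · subst e
    rcases reflTransGen_iff_eq_or_transGen.1 hxb with h | h
    · exact absurd h.symm hxm
    · exact Or.inr ⟨h, .single hby⟩
  · rcases reflTransGen_avoiding hxb hxm e with h | h
    · exact Or.inl (TransGen.tail' h ⟨hby, e, hym⟩)
    · exact Or.inr ⟨h.1, h.2.tail hby⟩

/-- An acyclic relation extends to a strict linear order. -/
theorem exists_linear_extension (h : ∀ x, ¬ TransGen r x x) :
    ∃ L : α → α → Prop, (∀ N : Set α, StrictOn N L) ∧ ∀ x y, r x y → L x y := by
  -- Acyclicity is what makes the reflexive transitive closure antisymmetric; Szpilrajn's theorem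
  -- then applies.
  have : IsPartialOrder α (ReflTransGen r) :=
    { refl := fun _ => .refl
      trans := fun _ _ _ => .trans
      antisymm := fun a b hab hba => by
        rcases reflTransGen_iff_eq_or_transGen.1 hab with h' | h'
        · exact h'.symm
        · exact absurd (h'.trans_left hba) (h a) }
  obtain ⟨s, hs, hrs⟩ := extend_partialOrder (ReflTransGen r)
  refine ⟨fun x y => s x y ∧ x ≠ y, fun N => ⟨fun x _ hx => hx.2 rfl, ?_, ?_⟩, ?_⟩
  · rintro x - y - z - ⟨hxy, hne⟩ ⟨hyz, -⟩
    refine ⟨_root_.trans hxy hyz, ?_⟩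
    rintro rfl
    exact hne (antisymm hxy hyz)
  · intro x _ y _ hne
    rcases total_of s x y with h' | h'
    · exact Or.inl ⟨h', hne⟩
    · exact Or.inr ⟨h', hne.symm⟩
  · intro x y hxy
    refine ⟨hrs _ _ (.single hxy), ?_⟩
    rintro rfl
    exact h x (.single hxy)

end Avoid

/-! ### Abstract executions -/

variable {Dom Thread Reg Label : Type*}

/-- Stores and fences, which are issued before they take effect. -/
def Act.Delayable : Act Dom → Prop
  | .st _ _ => True
  | .fence _ => True
  | _ => False

/-- `MayReorder x y`: if `x` precedes `y` in program order, then `y` may be executed before `x`. -/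
def Act.MayReorder : Act Dom → Act Dom → Prop
  | .st _ _, .ld _ _ => True
  | .st _ _, .loc => True
  -- Per-address buffers drain independently of each other, and a fence waits only for those of the
  -- listed addresses. Later stores and fences cannot pass a fence, since they enter the
  -- all-addresses buffer behind it.
  | .st a _, .st b _ => a ≠ b
  | .st a _, .fence as => a ∉ as
  | .fence _, .ld _ _ => True
  | .fence _, .loc => True
  | _, _ => False

theorem Act.MayReorder.delayable {x y : Act Dom} (h : x.MayReorder y) : x.Delayable := by
  cases x <;> cases y <;> simp_all [Act.MayReorder, Act.Delayable]

open Classical in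
/-- The execution of an instruction as seen by the thread, where the value of a load is
arbitrary. -/
inductive LocalStep [Zero Dom] (c : ThreadCode Dom Reg Label) :
    Label × (Reg → Dom) → Act Dom → Label × (Reg → Dom) → Prop
  | load (pc : Label) (ρ : Reg → Dom) (r : Reg) (e : Expr Dom Reg) (l : Label) (v : Dom)
      (h : (⟨pc, Inst.load r e, l⟩ : LInst Dom Reg Label) ∈ c.code) :
      LocalStep c (pc, ρ) (.ld (e.eval ρ) v) (l, Function.update ρ r v)
  | store (pc : Label) (ρ : Reg → Dom) (ea ev : Expr Dom Reg) (l : Label)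
      (h : (⟨pc, Inst.store ea ev, l⟩ : LInst Dom Reg Label) ∈ c.code) :
      LocalStep c (pc, ρ) (.st (ea.eval ρ) (ev.eval ρ)) (l, ρ)
  | scfence (pc : Label) (ρ : Reg → Dom) (l : Label)
      (h : (⟨pc, Inst.scfence, l⟩ : LInst Dom Reg Label) ∈ c.code) :
      LocalStep c (pc, ρ) .scfence (l, ρ)
  | fence (pc : Label) (ρ : Reg → Dom) (es : List (Expr Dom Reg)) (l : Label)
      (h : (⟨pc, Inst.fence es, l⟩ : LInst Dom Reg Label) ∈ c.code) :
      LocalStep c (pc, ρ) (.fence (es.map fun e => e.eval ρ)) (l, ρ)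
  | assign (pc : Label) (ρ : Reg → Dom) (r : Reg) (e : Expr Dom Reg) (l : Label)
      (h : (⟨pc, Inst.assign r e, l⟩ : LInst Dom Reg Label) ∈ c.code) :
      LocalStep c (pc, ρ) .loc (l, Function.update ρ r (e.eval ρ))
  | assertion (pc : Label) (ρ : Reg → Dom) (e : Expr Dom Reg) (l : Label)
      (h : (⟨pc, Inst.assertion e, l⟩ : LInst Dom Reg Label) ∈ c.code) (he : e.eval ρ ≠ 0) :
      LocalStep c (pc, ρ) .loc (l, ρ)

/-- The thread does not constrain the value it loads. This allows the last load of a thread to be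
repeated with a new value. -/
theorem LocalStep.load_any [Zero Dom] {c : ThreadCode Dom Reg Label} {p q : Label × (Reg → Dom)}
    {a v : Dom} (h : LocalStep c p (.ld a v) q) (v' : Dom) :
    ∃ q', LocalStep c p (.ld a v') q' := by
  cases h with
  | load pc ρ r e l _ h => exact ⟨_, .load pc ρ r e l v' h⟩

/-- `x` precedes `y` in the program order. -/
def Action.PO (x y : Action Dom Thread) : Prop := x.thread = y.thread ∧ x.node < y.node

/-- A store `z` is visible to a load `y` if it has reached the memory or is issued earlier by the
same thread. -/
def Visible (lt : Action Dom Thread → Action Dom Thread → Prop) (z y : Action Dom Thread) : Prop :=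
  lt z y ∨ z.PO y

/-- The source of a load is its last visible store. -/
def IsSrc (N : Set (Action Dom Thread)) (lt : Action Dom Thread → Action Dom Thread → Prop)
    (x y : Action Dom Thread) : Prop :=
  ∃ a v, y.act = .ld a v ∧ x ∈ N ∧ y ∈ N ∧ x.IsStoreTo a ∧ Visible lt x y ∧
    ∀ z ∈ N, z.IsStoreTo a → Visible lt z y → z = x ∨ lt z x

/-- The store `z` comes after all stores that are visible to the load `y`. -/
def FromRead (N : Set (Action Dom Thread)) (lt : Action Dom Thread → Action Dom Thread → Prop)
    (y z : Action Dom Thread) : Prop :=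
  ∃ a v, y.act = .ld a v ∧ y ∈ N ∧ z ∈ N ∧ z.IsStoreTo a ∧
    ∀ x ∈ N, x.IsStoreTo a → Visible lt x y → lt x z

/-- The order of the stores to the same address. -/
def Coherence (N : Set (Action Dom Thread)) (lt : Action Dom Thread → Action Dom Thread → Prop)
    (x y : Action Dom Thread) : Prop :=
  ∃ a, x ∈ N ∧ y ∈ N ∧ x.IsStoreTo a ∧ y.IsStoreTo a ∧ lt x y

/-- The happens-before relation of an abstract execution. -/
def HB (N : Set (Action Dom Thread)) (lt : Action Dom Thread → Action Dom Thread → Prop)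
    (x y : Action Dom Thread) : Prop :=
  (x ∈ N ∧ y ∈ N ∧ x.PO y) ∨ Coherence N lt x y ∨ IsSrc N lt x y ∨ FromRead N lt x y

/-- The happens-before relation of an abstract execution is cyclic. -/
def CyclicOn (N : Set (Action Dom Thread)) (lt : Action Dom Thread → Action Dom Thread → Prop) :
    Prop := ∃ x, TransGen (HB N lt) x x

/-- Axiomatic description of the computations: `N` is the set of nodes, `lt` the order in which
they are executed, and `σ t n` the local state of thread `t` after `n` instructions. -/
structure Valid [Zero Dom] (P : Program Dom Thread Reg Label)
    (σ : Thread → ℕ → Label × (Reg → Dom)) (N : Set (Action Dom Thread))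
    (lt : Action Dom Thread → Action Dom Thread → Prop) : Prop where
  fin : N.Finite
  order : StrictOn N lt
  ne_isu : ∀ x ∈ N, x.act ≠ .isu
  uniq : ∀ x ∈ N, ∀ y ∈ N, x.thread = y.thread → x.node = y.node → x = y
  down : ∀ x ∈ N, ∀ k < x.node, ∃ y ∈ N, y.thread = x.thread ∧ y.node = k
  init : ∀ t, σ t 0 = ((P t).init, fun _ => 0)
  step : ∀ x ∈ N, LocalStep (P x.thread) (σ x.thread x.node) x.act (σ x.thread (x.node + 1))
  ppo : ∀ x ∈ N, ∀ y ∈ N, x.PO y → ¬ x.act.MayReorder y.act → lt x y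
  val : ∀ y ∈ N, ∀ a v, y.act = .ld a v →
    (∃ x, IsSrc N lt x y ∧ x.act = .st a v) ∨
      ((∀ x ∈ N, x.IsStoreTo a → ¬ Visible lt x y) ∧ v = 0)

theorem Action.IsStoreTo.delayable {x : Action Dom Thread} {a : Dom} (h : x.IsStoreTo a) :
    x.act.Delayable := by
  obtain ⟨v, hv⟩ := h; simp [hv, Act.Delayable]

theorem Action.IsStoreTo.eq {x : Action Dom Thread} {a b : Dom} (h : x.IsStoreTo a)
    (h' : x.IsStoreTo b) : a = b := by
  obtain ⟨v, hv⟩ := h; obtain ⟨w, hw⟩ := h'; rw [hv] at hw; cases hw; rfl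

theorem Action.IsStoreTo.act_ne_ld {x : Action Dom Thread} {a b w : Dom} (h : x.IsStoreTo a) :
    x.act ≠ .ld b w := by
  obtain ⟨v, hv⟩ := h; simp [hv]

/-! ### Edges of the happens-before relation -/

section

variable {N S : Set (Action Dom Thread)} {lt lt' : Action Dom Thread → Action Dom Thread → Prop}

theorem HB.mem_left {x y : Action Dom Thread} (h : HB N lt x y) : x ∈ N := by
  rcases h with h | ⟨a, h⟩ | ⟨a, v, h⟩ | ⟨a, v, h⟩
  exacts [h.1, h.1, h.2.1, h.2.1]

theorem HB.mem_right {x y : Action Dom Thread} (h : HB N lt x y) : y ∈ N := by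
  rcases h with h | ⟨a, h⟩ | ⟨a, v, h⟩ | ⟨a, v, h⟩
  exacts [h.2.1, h.2.1, h.2.2.1, h.2.2.1]

theorem transGen_hb_mem {x y : Action Dom Thread} (h : TransGen (HB N lt) x y) :
    x ∈ N ∧ y ∈ N := by
  induction h with
  | single h => exact ⟨h.mem_left, h.mem_right⟩
  | tail _ h ih => exact ⟨ih.1, h.mem_right⟩

/-- A store executed before the load would be visible to it, hence would have to precede itself. -/
theorem FromRead.before (ho : StrictOn N lt) {x y : Action Dom Thread} (h : FromRead N lt x y) :
    lt x y := by
  obtain ⟨a, v, hx, hxN, hyN, hy, h⟩ := h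
  have hne : x ≠ y := by rintro rfl; exact hy.act_ne_ld hx
  refine (ho.total x hxN y hyN hne).resolve_right fun hlt => ?_
  exact ho.irrefl y hyN (h y hyN hy (Or.inl hlt))

/-- Only the program order can be against the execution order. -/
theorem HB.lt_or_po (ho : StrictOn N lt) {x y : Action Dom Thread} (h : HB N lt x y) :
    lt x y ∨ x.PO y := by
  rcases h with h | ⟨a, h⟩ | ⟨a, v, h⟩ | h
  · exact Or.inr h.2.2
  · exact Or.inl h.2.2.2.2
  · exact h.2.2.2.2.1
  · exact Or.inl (h.before ho)

/-- All other edges already follow the execution order, so a cycle would be a cycle of `lt`. -/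
theorem not_cyclicOn_of_po (ho : StrictOn N lt) (hpo : ∀ x ∈ N, ∀ y ∈ N, x.PO y → lt x y) :
    ¬ CyclicOn N lt := by
  rintro ⟨x, hx⟩
  have key : ∀ y, TransGen (HB N lt) x y → lt x y := by
    intro y h
    have step : ∀ {x y}, HB N lt x y → lt x y := fun {x y} h =>
      (h.lt_or_po ho).elim id (hpo x h.mem_left y h.mem_right)
    induction h with
    | single h => exact step h
    | @tail b c hb h ih =>
      exact ho.trans x (transGen_hb_mem hb).1 b h.mem_left c h.mem_right ih (step h)
  exact ho.irrefl x (transGen_hb_mem hx).1 (key x hx)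

theorem IsSrc.unique (ho : StrictOn N lt) {x x' y : Action Dom Thread} (h : IsSrc N lt x y)
    (h' : IsSrc N lt x' y) : x = x' := by
  obtain ⟨a, v, hy, hx, -, hxa, hv, hm⟩ := h
  obtain ⟨a', v', hy', hx', -, hxa', hv', hm'⟩ := h'
  rw [hy] at hy'; cases hy'
  rcases hm x' hx' hxa' hv' with h1 | h1
  · exact h1.symm
  · rcases hm' x hx hxa hv with h2 | h2
    · exact h2
    · exact absurd h1 (ho.asymm hx hx' h2)

/-- The conditions on sources and from-read edges quantify universally over the stores in `N`, so
they only get weaker on a subset. -/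
theorem HB.restrict {x y : Action Dom Thread} (h : HB N lt x y) (hS : S ⊆ N) (hx : x ∈ S)
    (hy : y ∈ S) : HB S lt x y := by
  rcases h with h | ⟨a, h⟩ | ⟨a, v, h⟩ | ⟨a, v, h⟩
  · exact Or.inl ⟨hx, hy, h.2.2⟩
  · exact Or.inr (Or.inl ⟨a, hx, hy, h.2.2⟩)
  · exact Or.inr (Or.inr (Or.inl ⟨a, v, h.1, hx, hy, h.2.2.2.1, h.2.2.2.2.1,
      fun z hz => h.2.2.2.2.2 z (hS hz)⟩))
  · exact Or.inr (Or.inr (Or.inr ⟨a, v, h.1, hx, hy, h.2.2.2.1,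
      fun z hz => h.2.2.2.2 z (hS hz)⟩))

/-! ### Reordering and restricting valid executions -/

variable [Zero Dom] {P : Program Dom Thread Reg Label} {σ : Thread → ℕ → Label × (Reg → Dom)}

theorem Valid.isSrc_or (h : Valid P σ N lt) {y : Action Dom Thread} (hy : y ∈ N) {a v : Dom}
    (hact : y.act = .ld a v) :
    (∃ x, IsSrc N lt x y) ∨ ∀ x ∈ N, x.IsStoreTo a → ¬ Visible lt x y := by
  rcases h.val y hy a v hact with ⟨x, hx, -⟩ | hx
  · exact Or.inl ⟨x, hx⟩
  · exact Or.inr hx.1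

/-- Changing the execution order without changing the sources of the loads. -/
theorem Valid.reorder (h : Valid P σ N lt) (ho : StrictOn N lt')
    (hppo : ∀ x ∈ N, ∀ y ∈ N, x.PO y → ¬ x.act.MayReorder y.act → lt' x y)
    (hsrc : ∀ x y, IsSrc N lt x y → IsSrc N lt' x y)
    (hno : ∀ y ∈ N, ∀ a v, y.act = .ld a v → (∀ x ∈ N, x.IsStoreTo a → ¬ Visible lt x y) →
      ∀ x ∈ N, x.IsStoreTo a → ¬ Visible lt' x y) :
    Valid P σ N lt' ∧ ∀ x y, IsSrc N lt' x y ↔ IsSrc N lt x y := by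
  refine ⟨{ h with order := ho, ppo := hppo, val := ?_ }, fun x y => ⟨fun hxy => ?_, hsrc x y⟩⟩
  · intro y hy a v hact
    rcases h.val y hy a v hact with ⟨x, hx, hxv⟩ | hx
    · exact Or.inl ⟨x, hsrc x y hx, hxv⟩
    · exact Or.inr ⟨hno y hy a v hact hx.1, hx.2⟩
  · have hxy' := hxy
    obtain ⟨a, v, hact, hx, hy, hxa, hv, -⟩ := hxy
    rcases h.isSrc_or hy hact with ⟨x', hx'⟩ | hn
    · rwa [hxy'.unique ho (hsrc _ _ hx')]
    · exact absurd hv (hno y hy a v hact hn x hx hxa)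

/-- This expresses from-read edges by sources and coherence alone. Executions that agree on those
two therefore have the same happens-before relation. -/
theorem Valid.fromRead_iff (h : Valid P σ N lt) {y z : Action Dom Thread} :
    FromRead N lt y z ↔ ∃ a v, y.act = .ld a v ∧ y ∈ N ∧ z ∈ N ∧ z.IsStoreTo a ∧
      ((∃ x, IsSrc N lt x y ∧ Coherence N lt x z) ∨ ∀ x, ¬ IsSrc N lt x y) := by
  constructor
  · rintro ⟨a, v, hact, hy, hz, hza, hv⟩
    refine ⟨a, v, hact, hy, hz, hza, ?_⟩
    by_cases hs : ∃ x, IsSrc N lt x y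
    · obtain ⟨x, hx⟩ := hs
      refine Or.inl ⟨x, hx, ?_⟩
      obtain ⟨a', v', hact', hx, -, hxa, hvis, -⟩ := hx
      rw [hact] at hact'; cases hact'
      exact ⟨a, hx, hz, hxa, hza, hv x hx hxa hvis⟩
    · exact Or.inr (not_exists.1 hs)
  · rintro ⟨a, v, hact, hy, hz, hza, ⟨x, hx, hxz⟩ | hn⟩
    · refine ⟨a, v, hact, hy, hz, hza, fun w hw hwa hvis => ?_⟩
      obtain ⟨a', v', hact', hx, -, hxa, -, hm⟩ := hx
      rw [hact] at hact'; cases hact'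
      obtain ⟨_, -, -, -, -, hlt⟩ := hxz
      rcases hm w hw hwa hvis with rfl | h'
      · exact hlt
      · exact h.order.trans w hw x hx z hz h' hlt
    · refine ⟨a, v, hact, hy, hz, hza, fun w hw hwa hvis => ?_⟩
      rcases h.isSrc_or hy hact with ⟨x, hx⟩ | h'
      · exact absurd hx (hn x)
      · exact absurd hvis (h' w hw hwa)

/-- Reordering an execution in accordance with its happens-before relation, except for those parts
of the program order that need not be respected. -/
theorem Valid.resort (h : Valid P σ N lt) (ho : StrictOn N lt')
    (hppo : ∀ x ∈ N, ∀ y ∈ N, x.PO y → ¬ x.act.MayReorder y.act → lt' x y)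
    (hco : ∀ x y, Coherence N lt x y → lt' x y)
    (hsrc : ∀ x y, IsSrc N lt x y → lt' x y ∨ x.PO y)
    (hfr : ∀ x y, FromRead N lt x y → lt' x y) :
    Valid P σ N lt' ∧ (∀ x y, IsSrc N lt' x y ↔ IsSrc N lt x y) ∧
      (∀ x y, Coherence N lt' x y ↔ Coherence N lt x y) ∧
      ∀ x y, HB N lt' x y ↔ HB N lt x y := by
  -- Both orders are total on the stores to one address, so one inclusion gives equality.
  have hco' : ∀ x y, Coherence N lt' x y ↔ Coherence N lt x y := by
    refine fun x y => ⟨?_, ?_⟩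
    · rintro ⟨a, hx, hy, hxa, hya, hlt⟩
      refine ⟨a, hx, hy, hxa, hya, ?_⟩
      have hne : x ≠ y := by rintro rfl; exact ho.irrefl _ hx hlt
      refine (h.order.total x hx y hy hne).resolve_right fun hyx => ?_
      exact ho.asymm hx hy hlt (hco y x ⟨a, hy, hx, hya, hxa, hyx⟩)
    · intro hxy
      obtain ⟨a, hx, hy, hxa, hya, hlt⟩ := id hxy
      exact ⟨a, hx, hy, hxa, hya, hco x y hxy⟩
  obtain ⟨h1, h2⟩ := h.reorder ho hppo (by
    intro x y hxy
    obtain ⟨a, v, hact, hx, hy, hxa, hvis, hm⟩ := id hxy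
    refine ⟨a, v, hact, hx, hy, hxa, hsrc x y hxy, fun z hz hza hzv => ?_⟩
    -- If `z` came after the source `x` in the old order, `y` would be from-read before `z`. Then
    -- `lt'` puts `z` after `y`, so `z` could be visible only through program order, but such a `z`
    -- was visible before.
    have key : z = x ∨ lt z x := by
      by_contra! hc
      have hxz : lt x z := (h.order.total z hz x hx hc.1).resolve_left hc.2
      have hfr' : lt' y z := hfr y z ⟨a, v, hact, hy, hz, hza, fun w hw hwa hwv => by
        rcases hm w hw hwa hwv with rfl | h'
        · exact hxz
        · exact h.order.trans w hw x hx z hz h' hxz⟩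
      rcases hzv with h' | h'
      · exact ho.asymm hy hz hfr' h'
      · rcases hm z hz hza (Or.inr h') with h'' | h''
        · exact hc.1 h''
        · exact hc.2 h''
    exact key.imp_right fun hk => hco z x ⟨a, hz, hx, hza, hxa, hk⟩) (by
    intro y hy a v hact hn x hx hxa hvis
    rcases hvis with h' | h'
    · refine ho.asymm hx hy h' (hfr y x ⟨a, v, hact, hy, hx, hxa, fun w hw hwa hwv => ?_⟩)
      exact absurd hwv (hn w hw hwa)
    · exact hn x hx hxa (Or.inr h'))
  refine ⟨h1, h2, hco', fun x y => ?_⟩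
  simp only [HB, h1.fromRead_iff, h.fromRead_iff, hco', h2]

/-- Restriction to a set of nodes that is closed under program order and sources. -/
theorem Valid.restrict (h : Valid P σ N lt) (hS : S ⊆ N)
    (hpo : ∀ y ∈ S, ∀ x ∈ N, x.PO y → x ∈ S) (hsrc : ∀ y ∈ S, ∀ x, IsSrc N lt x y → x ∈ S) :
    Valid P σ S lt where
  fin := h.fin.subset hS
  order := h.order.subset hS
  ne_isu x hx := h.ne_isu x (hS hx)
  uniq x hx y hy := h.uniq x (hS hx) y (hS hy)
  down x hx k hk := by
    obtain ⟨y, hy, ht, hn⟩ := h.down x (hS hx) k hk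
    exact ⟨y, hpo x hx y hy ⟨ht, by omega⟩, ht, hn⟩
  init := h.init
  step x hx := h.step x (hS hx)
  ppo x hx y hy := h.ppo x (hS hx) y (hS hy)
  val y hy a v hact := by
    rcases h.val y (hS hy) a v hact with ⟨x, hx, hxv⟩ | hx
    · refine Or.inl ⟨x, ?_, hxv⟩
      have hxS := hsrc y hy x hx
      obtain ⟨a, v, hact, -, -, hxa, hvis, hm⟩ := hx
      exact ⟨a, v, hact, hxS, hy, hxa, hvis, fun z hz => hm z (hS hz)⟩
    · exact Or.inr ⟨fun x hxS => hx.1 x (hS hxS), hx.2⟩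

/-- An execution with an acyclic happens-before relation can be reordered such that it respects
the program order. -/
theorem Valid.exists_sc (h : Valid P σ N lt) (hc : ¬ CyclicOn N lt) :
    ∃ lt', Valid P σ N lt' ∧ (∀ x ∈ N, ∀ y ∈ N, x.PO y → lt' x y) ∧
      (∀ x y, IsSrc N lt' x y ↔ IsSrc N lt x y) ∧
      ∀ x y, Coherence N lt' x y ↔ Coherence N lt x y := by
  obtain ⟨L, hL, hr⟩ := exists_linear_extension (not_exists.1 hc)
  obtain ⟨h1, h2, h3, -⟩ := h.resort (hL N)
    (fun x hx y hy hp _ => hr x y (Or.inl ⟨hx, hy, hp⟩))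
    (fun x y hxy => hr x y (Or.inr (Or.inl hxy)))
    (fun x y hxy => Or.inl (hr x y (Or.inr (Or.inr (Or.inl hxy)))))
    (fun x y hxy => hr x y (Or.inr (Or.inr (Or.inr hxy))))
  exact ⟨L, h1, fun x hx y hy hp => hr x y (Or.inl ⟨hx, hy, hp⟩), h2, h3⟩

end

end StoreAtomic

namespace StoreAtomic

open Relation

variable {Dom Thread Reg Label : Type*}

/-! ### Executions with a minimal number of nodes -/

/-- The last node of a thread. -/
def POLast (N : Set (Action Dom Thread)) (x : Action Dom Thread) : Prop :=
  x ∈ N ∧ ∀ y ∈ N, ¬ x.PO y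

/-- A cyclic execution with a minimal number of nodes. Among the last nodes of the threads, `m` is
executed last, and the number of nodes that are executed after `m` cannot be decreased. -/
structure MinimalViolation [Zero Dom] (P : Program Dom Thread Reg Label)
    (σ : Thread → ℕ → Label × (Reg → Dom)) (N : Set (Action Dom Thread))
    (lt : Action Dom Thread → Action Dom Thread → Prop) (m : Action Dom Thread) : Prop where
  valid : Valid P σ N lt
  cyclic : CyclicOn N lt
  min : ∀ N' lt', Valid P σ N' lt' → CyclicOn N' lt' → N.ncard ≤ N'.ncard
  last : POLast N m
  after : ∀ r ∈ N, lt m r → ¬ POLast N r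
  minAfter : ∀ lt', Valid P σ N lt' → CyclicOn N lt' → (∀ r ∈ N, lt' m r → ¬ POLast N r) →
    {r ∈ N | lt m r}.ncard ≤ {r ∈ N | lt' m r}.ncard

theorem exists_poLast {N : Set (Action Dom Thread)} (hf : N.Finite) {x : Action Dom Thread}
    (hx : x ∈ N) : ∃ e, POLast N e ∧ e.thread = x.thread ∧ x.node ≤ e.node := by
  obtain ⟨e, he, hmax⟩ := Set.exists_max_image {y ∈ N | y.thread = x.thread} (fun y => y.node)
    (hf.subset (Set.sep_subset _ _)) ⟨x, hx, rfl⟩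
  refine ⟨e, ⟨he.1, fun y hy hpo => ?_⟩, he.2, hmax x ⟨hx, rfl⟩⟩
  have := hmax y ⟨hy, hpo.1.symm.trans he.2⟩
  have := hpo.2
  omega

variable [Zero Dom] {P : Program Dom Thread Reg Label} {σ : Thread → ℕ → Label × (Reg → Dom)}
  {N : Set (Action Dom Thread)} {lt : Action Dom Thread → Action Dom Thread → Prop}
  {m : Action Dom Thread}

/-- Two minimizations in succession: first over the number of nodes, then, with `N` and `m` fixed,
over the number of nodes after `m`. The condition that no last node of a thread comes after `m` is
kept in the second one. -/
theorem Valid.exists_minimalViolation (h : Valid P σ N lt) (hc : CyclicOn N lt) :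
    ∃ N' lt' m, MinimalViolation P σ N' lt' m := by
  classical
  have h1 : ∃ k, ∃ N' lt', Valid P σ N' lt' ∧ CyclicOn N' lt' ∧ N'.ncard = k :=
    ⟨_, N, lt, h, hc, rfl⟩
  obtain ⟨N, lt, hv, hc, hk⟩ := Nat.find_spec h1
  have hmin : ∀ N' lt', Valid P σ N' lt' → CyclicOn N' lt' → N.ncard ≤ N'.ncard :=
    fun N' lt' hv' hc' => hk ▸ Nat.find_min' h1 ⟨N', lt', hv', hc', rfl⟩
  have hm : ∃ m, POLast N m ∧ ∀ r ∈ N, lt m r → ¬ POLast N r := by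
    obtain ⟨x, hx⟩ := hc
    obtain ⟨e, he, -⟩ := exists_poLast hv.fin (transGen_hb_mem hx).1
    have hsub : {y ∈ N | POLast N y} ⊆ N := Set.sep_subset _ _
    obtain ⟨m, hm, hmax⟩ := (hv.order.subset hsub).exists_max (hv.fin.subset hsub) ⟨e, he.1, he⟩
    refine ⟨m, hm.2, fun r hr hlt hlast => ?_⟩
    rcases hmax r ⟨hr, hlast⟩ with rfl | h'
    · exact hv.order.irrefl _ hr hlt
    · exact hv.order.asymm hr hm.1 h' hlt
  obtain ⟨m, hm, hafter⟩ := hm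
  have h2 : ∃ k, ∃ lt', Valid P σ N lt' ∧ CyclicOn N lt' ∧ (∀ r ∈ N, lt' m r → ¬ POLast N r) ∧
      {r ∈ N | lt' m r}.ncard = k := ⟨_, lt, hv, hc, hafter, rfl⟩
  obtain ⟨lt, hv, hc, hafter, hk'⟩ := Nat.find_spec h2
  exact ⟨N, lt, m, hv, hc, hmin, hm, hafter,
    fun lt' hv' hc' ha' => hk' ▸ Nat.find_min' h2 ⟨lt', hv', hc', ha', rfl⟩⟩

/-! ### The structure of a minimal violation -/

namespace MinimalViolation

variable (h : MinimalViolation P σ N lt m)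
include h

theorem mem : m ∈ N := h.last.1

/-- The nodes after `m` are stores and fences. -/
theorem delayable_after {r : Action Dom Thread} (hr : r ∈ N) (hlt : lt m r) :
    r.act.Delayable := by
  obtain ⟨e, he, het, hen⟩ := exists_poLast h.valid.fin hr
  have hne : r ≠ e := by rintro rfl; exact h.after _ hr hlt he
  have hpo : r.PO e := by
    refine ⟨het.symm, lt_of_le_of_ne hen fun hn => hne ?_⟩
    exact h.valid.uniq r hr e he.1 het.symm hn
  -- The last node `e` of the thread is executed no later than `m`, hence before `r`. So `r` is
  -- overtaken, which happens only to stores and fences.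
  have her : lt e r := by
    rcases h.valid.order.lt_of_not h.mem he.1 (fun h' => h.after e he.1 h' he) with rfl | h'
    · exact hlt
    · exact h.valid.order.trans e he.1 m h.mem r hr h' hlt
  by_contra hd
  exact h.valid.order.asymm hr he.1
    (h.valid.ppo r hr e he.1 hpo fun hmr => hd hmr.delayable) her

theorem not_lt_of_load {y : Action Dom Thread} {a v : Dom} (hy : y ∈ N) (hact : y.act = .ld a v) :
    ¬ lt m y := fun hlt => by
  have := h.delayable_after hy hlt
  simp [hact, Act.Delayable] at this

/-- A load that sees `m` is executed after `m` or follows it in program order. The former is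
impossible because only stores and fences come after `m`, the latter because `m` is last in its
thread. -/
theorem not_isSrc (y : Action Dom Thread) : ¬ IsSrc N lt m y := by
  rintro ⟨a, v, hact, -, hy, -, hvis | hvis, -⟩
  · exact h.not_lt_of_load hy hact hvis
  · exact h.last.2 y hy hvis

theorem valid_diff : Valid P σ (N \ {m}) lt := by
  refine h.valid.restrict Set.sdiff_subset ?_ ?_
  · rintro y ⟨hy, -⟩ x hx hpo
    refine ⟨hx, ?_⟩
    rintro rfl
    exact h.last.2 y hy hpo
  · rintro y ⟨hy, -⟩ x hx
    obtain ⟨_, _, _, hxN, _⟩ := id hx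
    refine ⟨hxN, ?_⟩
    rintro rfl
    exact h.not_isSrc y hx

theorem not_cyclicOn_of_ssubset {S : Set (Action Dom Thread)}
    {lt' : Action Dom Thread → Action Dom Thread → Prop} (hS : S ⊂ N)
    (hv : Valid P σ S lt') : ¬ CyclicOn S lt' := fun hc => by
  have h1 := h.min S lt' hv hc
  have h2 := Set.ncard_lt_ncard hS h.valid.fin
  omega

theorem diff_ssubset : N \ {m} ⊂ N :=
  ⟨Set.sdiff_subset, fun hs => (hs h.mem).2 rfl⟩

/-- A cycle that avoids `m` would survive in the smaller execution without `m`. Hence every cycle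
passes through `m`. -/
theorem transGen_avoiding_irrefl (x : Action Dom Thread) :
    ¬ TransGen (Avoiding (HB N lt) m) x x := fun hx => by
  refine h.not_cyclicOn_of_ssubset h.diff_ssubset h.valid_diff ⟨x, TransGen.mono ?_ _ _ hx⟩
  rintro y z ⟨hyz, hy, hz⟩
  exact hyz.restrict Set.sdiff_subset ⟨hyz.mem_left, hy⟩ ⟨hyz.mem_right, hz⟩

theorem transGen_self : TransGen (HB N lt) m m := by
  obtain ⟨x, hx⟩ := h.cyclic
  by_cases e : x = m
  · exact e ▸ hx
  · rcases transGen_avoiding hx e e with h' | h'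
    · exact absurd h' (h.transGen_avoiding_irrefl x)
    · exact h'.2.trans h'.1

/-- By minimality, all nodes happen before `m`. -/
theorem reflTransGen {w : Action Dom Thread} (hw : w ∈ N) : ReflTransGen (HB N lt) w m := by
  by_contra hc
  -- The nodes that happen before `m` are closed under program order and sources and contain a cycle
  -- through `m`, so they form a violation on their own.
  let S := {w ∈ N | ReflTransGen (HB N lt) w m}
  have hS : S ⊂ N := ⟨Set.sep_subset _ _, fun hs => hc (hs hw).2⟩
  refine h.not_cyclicOn_of_ssubset hS (h.valid.restrict hS.1 ?_ ?_) ⟨m, ?_⟩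
  · rintro y ⟨hy, hym⟩ x hx hpo
    exact ⟨hx, .head (Or.inl ⟨hx, hy, hpo⟩) hym⟩
  · rintro y ⟨hy, hym⟩ x hx
    exact ⟨HB.mem_left (Or.inr (Or.inr (Or.inl hx))), .head (Or.inr (Or.inr (Or.inl hx))) hym⟩
  · have key : ∀ w, TransGen (HB N lt) w m → TransGen (HB S lt) w m := by
      intro w hwm
      have hm : m ∈ S := ⟨h.mem, .refl⟩
      induction hwm using TransGen.head_induction_on with
      | @single a ha => exact .single (ha.restrict hS.1 ⟨ha.mem_left, .single ha⟩ hm)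
      | @head a c hac hcm ih =>
        exact .head (hac.restrict hS.1 ⟨hac.mem_left, .head hac hcm.to_reflTransGen⟩
          ⟨hac.mem_right, hcm.to_reflTransGen⟩) ih
    exact key m h.transGen_self

theorem transGen {w : Action Dom Thread} (hw : w ∈ N) (hne : w ≠ m) : TransGen (HB N lt) w m := by
  rcases reflTransGen_iff_eq_or_transGen.1 (h.reflTransGen hw) with h' | h'
  · exact absurd h'.symm hne
  · exact h'

/-- The successors of `m` in the happens-before relation are later stores to the same address. -/
theorem hb_right {x : Action Dom Thread} (hx : HB N lt m x) :
    x ∈ N ∧ lt m x ∧ ∃ a, x.IsStoreTo a ∧ (m.IsStoreTo a ∨ ∃ v, m.act = .ld a v) := by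
  have hlt : lt m x := (hx.lt_or_po h.valid.order).resolve_right fun hp => h.last.2 x hx.mem_right hp
  refine ⟨hx.mem_right, hlt, ?_⟩
  rcases hx with h' | ⟨a, h'⟩ | h' | ⟨a, v, h'⟩
  · exact absurd h'.2.2 (h.last.2 x h'.2.1)
  · exact ⟨a, h'.2.2.2.1, Or.inl h'.2.2.1⟩
  · exact absurd h' (h.not_isSrc x)
  · exact ⟨a, h'.2.2.2.1, Or.inr ⟨v, h'.1⟩⟩

theorem exists_store_after : ∃ a x, x ∈ N ∧ lt m x ∧ x.IsStoreTo a ∧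
    (m.IsStoreTo a ∨ ∃ v, m.act = .ld a v) := by
  obtain ⟨x, hx, -⟩ := TransGen.head'_iff.1 h.transGen_self
  obtain ⟨h1, h2, a, h3, h4⟩ := h.hb_right hx
  exact ⟨a, x, h1, h2, h3, h4⟩

/-- If `m` is a load, then it does not read early from a store that is executed later. -/
theorem lt_of_visible {a v : Dom} (hm : m.act = .ld a v) {z : Action Dom Thread} (hz : z ∈ N)
    (hza : z.IsStoreTo a) (hvis : Visible lt z m) : lt z m := by
  classical
  by_contra hc
  have ho := h.valid.order
  have hmz : lt m z := (ho.lt_of_not hz h.mem hc).resolve_left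
    (by rintro rfl; exact hza.act_ne_ld hm)
  obtain ⟨w, hws⟩ : ∃ w, IsSrc N lt w m := by
    rcases h.valid.isSrc_or h.mem hm with h' | h'
    · exact h'
    · exact absurd hvis (h' z hz hza)
  obtain ⟨a', v', hm', hw, -, hwa, hwvis, hmax⟩ := id hws
  rw [hm] at hm'; cases hm'
  have hmw : lt m w := by
    rcases hmax z hz hza hvis with rfl | h'
    · exact hmz
    · exact ho.trans m h.mem z hz w hw hmz h'
  have hwpo : w.PO m := hwvis.resolve_left (ho.asymm h.mem hw hmw)
  have hwm : w ≠ m := by rintro rfl; exact hwa.act_ne_ld hm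
  -- The new order moves `m` to just after its source `w`. The load still reads from `w`, and the
  -- stores that it is from-read before come after `w`, so the happens-before relation is unchanged.
  -- But `w` no longer comes after `m`, against `minAfter`.
  let g : Action Dom Thread → ℕ := fun x => if x = m then 1 else if lt w x then 2 else 0
  have hgm : g m = 1 := if_pos rfl
  have hg2 : ∀ x, x ≠ m → lt w x → g x = 2 := fun x h1 h2 => by simp [g, h1, h2]
  have hg0 : ∀ x, x ≠ m → ¬ lt w x → g x = 0 := fun x h1 h2 => by simp [g, h1, h2]
  have hgw : g w = 0 := hg0 w hwm (ho.irrefl w hw)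
  have key : ∀ x ∈ N, ∀ y ∈ N, x ≠ m → y ≠ m → lt x y → RankLex g lt x y := by
    intro x hx y hy hxm hym hxy
    by_cases h1 : lt w x
    · exact Or.inr ⟨(hg2 x hxm h1).trans (hg2 y hym (ho.trans w hw x hx y hy h1 hxy)).symm, hxy⟩
    · by_cases h2 : lt w y
      · left; rw [hg0 x hxm h1, hg2 y hym h2]; omega
      · exact Or.inr ⟨(hg0 x hxm h1).trans (hg0 y hym h2).symm, hxy⟩
  have hbefore : ∀ x ∈ N, lt x m → RankLex g lt x m := by
    intro x hx hxm
    left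
    rw [hgm, hg0 x (by rintro rfl; exact ho.irrefl _ hx hxm)]
    · omega
    · intro hwx; exact ho.asymm h.mem hx (ho.trans m h.mem w hw x hx hmw hwx) hxm
  obtain ⟨h1, -, -, h2⟩ := h.valid.resort (lt' := RankLex g lt) (ho.toRankLex g) (by
    intro x hx y hy hpo hmr
    have hxy := h.valid.ppo x hx y hy hpo hmr
    have hxm : x ≠ m := by rintro rfl; exact h.last.2 y hy hpo
    by_cases hym : y = m
    · subst hym; exact hbefore x hx hxy
    · exact key x hx y hy hxm hym hxy) (by
    rintro x y ⟨b, hx, hy, hxb, hyb, hxy⟩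
    exact key x hx y hy (by rintro rfl; exact hxb.act_ne_ld hm)
      (by rintro rfl; exact hyb.act_ne_ld hm) hxy) (by
    intro x y hxy
    obtain ⟨b, u, hyb, hx, hy, hxb, hxvis, -⟩ := id hxy
    by_cases hym : y = m
    · subst hym
      exact Or.inr ((hxy.unique ho hws) ▸ hwpo)
    · exact hxvis.imp_left
        (key x hx y hy (by rintro rfl; exact hxb.act_ne_ld hm) hym)) (by
    intro x y hxy
    have hlt := hxy.before ho
    obtain ⟨b, u, hxb, hx, hy, hyb, hall⟩ := id hxy
    have hym : y ≠ m := by rintro rfl; exact hyb.act_ne_ld hm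
    by_cases hxm : x = m
    · subst hxm
      rw [hm] at hxb; cases hxb
      left; rw [hgm, hg2 y hym (hall w hw hwa hwvis)]; omega
    · exact key x hx y hy hxm hym hlt)
  have hcyc : CyclicOn N (RankLex g lt) := by
    obtain ⟨x, hx⟩ := h.cyclic
    exact ⟨x, TransGen.mono (fun _ _ => (h2 _ _).2) _ _ hx⟩
  have hsub : ∀ r ∈ N, RankLex g lt m r → lt w r := by
    intro r hr hmr
    have hrm : r ≠ m := by rintro rfl; exact (ho.toRankLex g).irrefl _ hr hmr
    by_contra hwr
    rcases hmr with h' | h'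
    · rw [hg0 r hrm hwr] at h'; omega
    · rw [hg0 r hrm hwr, hgm] at h'; omega
  have hle := h.minAfter _ h1 hcyc fun r hr hmr =>
    h.after r hr (ho.trans m h.mem w hw r hr hmw (hsub r hr hmr))
  refine absurd (Set.ncard_lt_ncard ?_ (h.valid.fin.subset (Set.sep_subset _ _))) (not_lt.2 hle)
  refine ⟨fun r hr => ⟨hr.1, ho.trans m h.mem w hw r hr.1 hmw (hsub r hr.1 hr.2)⟩, fun hs => ?_⟩
  exact ho.irrefl w hw (hsub w hw (hs ⟨hw, hmw⟩).2)

/-- The first store after `m` to the address of `m` is a successor of `m` in the happens-before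
relation, and it happens before all nodes after `m`. -/
theorem exists_first_store : ∃ a x, x ∈ N ∧ lt m x ∧ x.IsStoreTo a ∧
    (m.IsStoreTo a ∨ ∃ v, m.act = .ld a v) ∧ HB N lt m x ∧
    ∀ r ∈ N, lt m r → ReflTransGen (Avoiding (HB N lt) m) x r := by
  classical
  have ho := h.valid.order
  obtain ⟨a, x₀, hx₀, hmx₀, hx₀a, hma⟩ := h.exists_store_after
  have hsub : {x ∈ N | lt m x ∧ x.IsStoreTo a} ⊆ N := Set.sep_subset _ _
  obtain ⟨x, ⟨hx, hmx, hxa⟩, hmin⟩ := (ho.subset hsub).exists_min (h.valid.fin.subset hsub)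
    ⟨x₀, hx₀, hmx₀, hx₀a⟩
  have hxm : x ≠ m := by rintro rfl; exact ho.irrefl _ hx hmx
  refine ⟨a, x, hx, hmx, hxa, hma, ?_, ?_⟩
  · rcases hma with hma | ⟨v, hma⟩
    · exact Or.inr (Or.inl ⟨a, h.mem, hx, hma, hxa, hmx⟩)
    · exact Or.inr (Or.inr (Or.inr ⟨a, v, hma, h.mem, hx, hxa, fun z hz hza hvis =>
        ho.trans z hz m h.mem x hx (h.lt_of_visible hma hz hza hvis) hmx⟩))
  have hma_of : ∀ {b y}, y ∈ N → HB N lt m y → y.IsStoreTo b → b = a := by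
    intro b y hy hmy hyb
    obtain ⟨-, -, c, hyc, hmc⟩ := h.hb_right hmy
    rw [hyb.eq hyc]
    rcases hma with hma | ⟨v, hma⟩ <;> rcases hmc with hmc | ⟨u, hmc⟩
    · exact hmc.eq hma
    · exact absurd hmc hma.act_ne_ld
    · exact absurd hma hmc.act_ne_ld
    · rw [hma] at hmc; cases hmc; rfl
  let Q : Action Dom Thread → Prop := fun r => ReflTransGen (Avoiding (HB N lt) m) x r
  have hQ : ∀ {y z}, Q y → HB N lt y z → y ≠ m → z ≠ m → Q z :=
    fun hy hyz hym hzm => hy.tail ⟨hyz, hym, hzm⟩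
  by_contra! hc
  obtain ⟨z₀, hz₀, hmz₀, hnz₀⟩ := hc
  -- The nodes after `m` that are not reachable from `x` move in front of `m`. No edge opposes this:
  -- `Q` is closed under edges that avoid `m`, and each successor of `m` is `x` or a store to the
  -- same address after `x`, hence lies in `Q`. If anything moves, fewer nodes come after `m`.
  let g : Action Dom Thread → ℕ := fun y =>
    if y = m then 2 else if lt m y then (if Q y then 3 else 1) else 0
  have hgm : g m = 2 := if_pos rfl
  have hg0 : ∀ y ∈ N, lt y m → g y = 0 := fun y hy h1 => by
    have h2 : y ≠ m := by rintro rfl; exact ho.irrefl _ hy h1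
    simp [g, h2, ho.asymm hy h.mem h1]
  have hg1 : ∀ y ∈ N, lt m y → ¬ Q y → g y = 1 := fun y hy h1 h2 => by
    have h3 : y ≠ m := by rintro rfl; exact ho.irrefl _ hy h1
    simp [g, h1, h2, h3]
  have hg3 : ∀ y ∈ N, lt m y → Q y → g y = 3 := fun y hy h1 h2 => by
    have h3 : y ≠ m := by rintro rfl; exact ho.irrefl _ hy h1
    simp [g, h1, h2, h3]
  have key : ∀ y z, HB N lt y z → lt y z → RankLex g lt y z := by
    intro y z hyz hlt
    have hy := hyz.mem_left
    have hz := hyz.mem_right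
    by_cases hym : y = m
    · subst hym
      left
      have hQz : Q z := by
        obtain ⟨-, -, b, hzb, -⟩ := h.hb_right hyz
        have := hma_of hz hyz hzb
        subst this
        rcases hmin z ⟨hz, hlt, hzb⟩ with rfl | hxz
        · exact .refl
        · exact .single ⟨Or.inr (Or.inl ⟨b, hx, hz, hxa, hzb, hxz⟩), hxm,
            by rintro rfl; exact ho.irrefl _ hz hlt⟩
      rw [hgm, hg3 z hz hlt hQz]; omega
    by_cases hzm : z = m
    · subst hzm
      left; rw [hgm, hg0 y hy hlt]; omega
    rcases ho.total y hy m h.mem hym with h1 | h1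
    · by_cases h2 : lt z m
      · exact Or.inr ⟨(hg0 y hy h1).trans (hg0 z hz h2).symm, hlt⟩
      · have h3 := (ho.total z hz m h.mem hzm).resolve_left h2
        left
        rw [hg0 y hy h1]
        by_cases h4 : Q z
        · rw [hg3 z hz h3 h4]; omega
        · rw [hg1 z hz h3 h4]; omega
    · have h3 := ho.trans m h.mem y hy z hz h1 hlt
      by_cases h4 : Q y
      · exact Or.inr ⟨(hg3 y hy h1 h4).trans (hg3 z hz h3 (hQ h4 hyz hym hzm)).symm, hlt⟩
      · by_cases h5 : Q z
        · left; rw [hg1 y hy h1 h4, hg3 z hz h3 h5]; omega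
        · exact Or.inr ⟨(hg1 y hy h1 h4).trans (hg1 z hz h3 h5).symm, hlt⟩
  obtain ⟨h1, -, -, h2⟩ := h.valid.resort (lt' := RankLex g lt) (ho.toRankLex g)
    (fun y hy z hz hpo hmr => key y z (Or.inl ⟨hy, hz, hpo⟩) (h.valid.ppo y hy z hz hpo hmr))
    (fun y z hyz => key y z (Or.inr (Or.inl hyz)) (by obtain ⟨_, _, _, _, _, h'⟩ := hyz; exact h'))
    (fun y z hyz => by
      obtain ⟨_, _, _, _, _, _, hvis, _⟩ := id hyz
      exact hvis.imp_left (key y z (Or.inr (Or.inr (Or.inl hyz)))))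
    (fun y z hyz => key y z (Or.inr (Or.inr (Or.inr hyz))) (hyz.before ho))
  have hcyc : CyclicOn N (RankLex g lt) := by
    obtain ⟨x, hx⟩ := h.cyclic
    exact ⟨x, TransGen.mono (fun _ _ => (h2 _ _).2) _ _ hx⟩
  have hsub' : ∀ r ∈ N, RankLex g lt m r → lt m r ∧ Q r := by
    intro r hr hmr
    have hrm : r ≠ m := by rintro rfl; exact (ho.toRankLex g).irrefl _ hr hmr
    rcases hmr with h' | h'
    · rw [hgm] at h'
      rcases ho.total r hr m h.mem hrm with h3 | h3
      · rw [hg0 r hr h3] at h'; omega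
      · refine ⟨h3, ?_⟩
        by_contra h4
        rw [hg1 r hr h3 h4] at h'; omega
    · refine ⟨h'.2, ?_⟩
      by_contra h4
      rw [hgm, hg1 r hr h'.2 h4] at h'; omega
  have hle := h.minAfter _ h1 hcyc fun r hr hmr => h.after r hr (hsub' r hr hmr).1
  refine absurd (Set.ncard_lt_ncard ?_ (h.valid.fin.subset (Set.sep_subset _ _))) (not_lt.2 hle)
  exact ⟨fun r hr => ⟨hr.1, (hsub' r hr.1 hr.2).1⟩,
    fun hs => hnz₀ (hsub' z₀ hz₀ (hs ⟨hz₀, hmz₀⟩).2).2⟩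

end MinimalViolation

end StoreAtomic

namespace StoreAtomic

open Relation

variable {Dom Thread Reg Label : Type*}

/-! ### Inserting a node at the end of a thread -/

open Classical in
/-- The order on `insert m N` in which `m` comes directly after the elements of `D`. -/
noncomputable def insertLt (m : Action Dom Thread) (N D : Set (Action Dom Thread))
    (lt : Action Dom Thread → Action Dom Thread → Prop) :
    Action Dom Thread → Action Dom Thread → Prop :=
  RankLex (fun x => if x = m then 1 else if x ∈ D then 0 else 2)
    (fun x y => x ∈ N ∧ y ∈ N ∧ lt x y)

section Insert

variable {N D : Set (Action Dom Thread)} {lt : Action Dom Thread → Action Dom Thread → Prop}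
  {m : Action Dom Thread}

theorem insertLt_iff (ho : StrictOn N lt) (hm : m ∉ N)
    (hD : ∀ x ∈ N, x ∈ D → ∀ y ∈ N, lt y x → y ∈ D) {x y : Action Dom Thread} (hx : x ∈ N)
    (hy : y ∈ N) : insertLt m N D lt x y ↔ lt x y := by
  have hxm : x ≠ m := by rintro rfl; exact hm hx
  have hym : y ≠ m := by rintro rfl; exact hm hy
  unfold insertLt RankLex
  simp only [hxm, hym, if_false, hx, hy, true_and]
  by_cases h1 : x ∈ D <;> by_cases h2 : y ∈ D <;> simp only [h1, h2, if_true, if_false]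
  · simp
  · simp only [Nat.zero_lt_succ, true_or, true_iff]
    refine (ho.total x hx y hy ?_).resolve_right fun h => h2 (hD x hx h1 y hy h)
    rintro rfl; exact h2 h1
  · simp only [Nat.not_lt_zero, false_or]
    refine ⟨fun h => absurd h.1 (by simp), fun h => h1 (hD y hy h2 x hx h) |>.elim⟩
  · simp

theorem insertLt_right (hm : m ∉ N) {x : Action Dom Thread} (hx : x ∈ N) :
    insertLt m N D lt x m ↔ x ∈ D := by
  have hxm : x ≠ m := by rintro rfl; exact hm hx
  unfold insertLt RankLex
  by_cases h1 : x ∈ D <;> simp [hxm, h1, hm]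

theorem insertLt_left (hm : m ∉ N) {x : Action Dom Thread} (hx : x ∈ N) :
    insertLt m N D lt m x ↔ x ∉ D := by
  have hxm : x ≠ m := by rintro rfl; exact hm hx
  unfold insertLt RankLex
  by_cases h1 : x ∈ D <;> simp [hxm, h1, hm]

theorem strictOn_insertLt (ho : StrictOn N lt) (hm : m ∉ N) :
    StrictOn (insert m N) (insertLt m N D lt) := by
  classical
  apply StrictOn.rankLex
  · rintro x - ⟨hx, -, hlt⟩
    exact ho.irrefl x hx hlt
  · rintro x - y - z - - - ⟨hx, hy, h1⟩ ⟨-, hz, h2⟩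
    exact ⟨hx, hz, ho.trans x hx y hy z hz h1 h2⟩
  · intro x hx y hy hg hne
    by_cases hxm : x = m
    · subst hxm
      have hyN := hy.resolve_left (Ne.symm hne)
      have hym := Ne.symm hne
      by_cases hyD : y ∈ D <;> simp [hyD, hym] at hg
    by_cases hym : y = m
    · subst hym
      by_cases hxD : x ∈ D <;> simp [hxD, hxm] at hg
    have hx' := hx.resolve_left hxm
    have hy' := hy.resolve_left hym
    exact (ho.total x hx' y hy' hne).imp (fun h => ⟨hx', hy', h⟩) (fun h => ⟨hy', hx', h⟩)

variable [Zero Dom] {P : Program Dom Thread Reg Label} {σ : Thread → ℕ → Label × (Reg → Dom)}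

/-- The set `D` is an initial segment that contains all loads and all nodes of the thread of `m`.
Therefore no load sees `m`, all old edges persist, and the last store in `D` to its address
determines the value of `m` if `m` is a load. -/
theorem Valid.insert_node (h : Valid P σ N lt) (hnode : ∀ x ∈ N, x.thread = m.thread → x.node < m.node)
    (hdown : ∀ k < m.node, ∃ y ∈ N, y.thread = m.thread ∧ y.node = k) (hisu : m.act ≠ .isu)
    (hstep : ∃ q, LocalStep (P m.thread) (σ m.thread m.node) m.act q)
    (hD : ∀ x ∈ N, x ∈ D → ∀ y ∈ N, lt y x → y ∈ D)
    (hpo : ∀ x ∈ N, x.thread = m.thread → x ∈ D)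
    (hload : ∀ y ∈ N, y ∉ D → ∀ a v, y.act ≠ .ld a v)
    (hval : ∀ a v, m.act = .ld a v →
      (∃ x ∈ N, x ∈ D ∧ x.act = .st a v ∧ ∀ z ∈ N, z ∈ D → z.IsStoreTo a → z = x ∨ lt z x) ∨
        (∀ x ∈ N, x ∈ D → ¬ x.IsStoreTo a) ∧ v = 0) :
    (∃ σ', Valid P σ' (insert m N) (insertLt m N D lt)) ∧
      ∀ x y, HB N lt x y → HB (insert m N) (insertLt m N D lt) x y := by
  classical
  have hm : m ∉ N := fun hmN => lt_irrefl _ (hnode m hmN rfl)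
  have ho := h.order
  have hiff : ∀ {x y}, x ∈ N → y ∈ N → (insertLt m N D lt x y ↔ lt x y) :=
    fun hx hy => insertLt_iff ho hm hD hx hy
  have hnpo : ∀ y ∈ N, ¬ m.PO y := fun y hy hp => by
    have := hnode y hy hp.1.symm
    have := hp.2
    omega
  have hvis : ∀ y ∈ N, ∀ a v, y.act = .ld a v → ∀ z ∈ insert m N,
      Visible (insertLt m N D lt) z y → z ∈ N ∧ Visible lt z y := by
    intro y hy a v hact z hz hv
    rcases hz with rfl | hz
    · rcases hv with hv | hv
      · exact absurd hact (hload y hy ((insertLt_left hm hy).1 hv) a v)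
      · exact absurd hv (hnpo y hy)
    · exact ⟨hz, hv.imp_left (hiff hz hy).1⟩
  have hsrc : ∀ x y, IsSrc N lt x y → IsSrc (insert m N) (insertLt m N D lt) x y := by
    rintro x y ⟨a, v, hact, hx, hy, hxa, hv, hmax⟩
    refine ⟨a, v, hact, Or.inr hx, Or.inr hy, hxa, hv.imp_left (hiff hx hy).2, ?_⟩
    intro z hz hza hzv
    obtain ⟨hz, hzv⟩ := hvis y hy a v hact z hz hzv
    exact (hmax z hz hza hzv).imp_right (hiff hz hx).2
  constructor
  · obtain ⟨q, hq⟩ := hstep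
    -- Only the local state after `m` changes, and no node of `N` starts or ends there.
    have hσ : ∀ t n, ¬ (t = m.thread ∧ n = m.node + 1) →
        Function.update σ m.thread (Function.update (σ m.thread) (m.node + 1) q) t n = σ t n := by
      intro t n hne
      by_cases ht : t = m.thread
      · subst ht
        have : n ≠ m.node + 1 := fun hn => hne ⟨rfl, hn⟩
        simp [this]
      · simp [ht]
    have hσ' : Function.update σ m.thread (Function.update (σ m.thread) (m.node + 1) q)
        m.thread (m.node + 1) = q := by simp
    refine ⟨Function.update σ m.thread (Function.update (σ m.thread) (m.node + 1) q), ?_⟩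
    refine
      { fin := h.fin.insert m
        order := strictOn_insertLt ho hm
        ne_isu := ?_
        uniq := ?_
        down := ?_
        init := fun t => by rw [hσ t 0 (by omega)]; exact h.init t
        step := ?_
        ppo := ?_
        val := ?_ }
    · rintro x (rfl | hx)
      · exact hisu
      · exact h.ne_isu x hx
    · rintro x (rfl | hx) y (rfl | hy) ht hn
      · rfl
      · have := hnode y hy ht.symm; omega
      · have := hnode x hx ht; omega
      · exact h.uniq x hx y hy ht hn
    · rintro x (rfl | hx) k hk
      · obtain ⟨y, hy, hy'⟩ := hdown k hk
        exact ⟨y, Or.inr hy, hy'⟩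
      · obtain ⟨y, hy, hy'⟩ := h.down x hx k hk
        exact ⟨y, Or.inr hy, hy'⟩
    · rintro x (rfl | hx)
      · rw [hσ', hσ _ _ (by omega)]; exact hq
      · have h1 : ¬ (x.thread = m.thread ∧ x.node = m.node + 1) := fun hc => by
          have := hnode x hx hc.1; omega
        have h2 : ¬ (x.thread = m.thread ∧ x.node + 1 = m.node + 1) := fun hc => by
          have := hnode x hx hc.1; omega
        rw [hσ _ _ h1, hσ _ _ h2]; exact h.step x hx
    · rintro x (rfl | hx) y (rfl | hy) hp hmr
      · exact absurd hp.2 (lt_irrefl _)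
      · exact absurd hp (hnpo y hy)
      · exact (insertLt_right hm hx).2 (hpo x hx hp.1)
      · exact (hiff hx hy).2 (h.ppo x hx y hy hp hmr)
    · rintro y (rfl | hy) a v hact
      · have hvD : ∀ z ∈ insert y N, z.IsStoreTo a → Visible (insertLt y N D lt) z y →
            z ∈ N ∧ z ∈ D := by
          rintro z (rfl | hz) hza hv
          · exact absurd hact hza.act_ne_ld
          · refine ⟨hz, ?_⟩
            rcases hv with hv | hv
            · exact (insertLt_right hm hz).1 hv
            · exact hpo z hz hv.1
        rcases hval a v hact with ⟨x, hx, hxD, hxv, hmax⟩ | ⟨hno, hv⟩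
        · refine Or.inl ⟨x, ⟨a, v, hact, Or.inr hx, Or.inl rfl, ⟨v, hxv⟩,
            Or.inl ((insertLt_right hm hx).2 hxD), fun z hz hza hzv => ?_⟩, hxv⟩
          obtain ⟨hzN, hzD⟩ := hvD z hz hza hzv
          exact (hmax z hzN hzD hza).imp_right (hiff hzN hx).2
        · refine Or.inr ⟨fun z hz hza hzv => ?_, hv⟩
          obtain ⟨hzN, hzD⟩ := hvD z hz hza hzv
          exact hno z hzN hzD hza
      · rcases h.val y hy a v hact with ⟨x, hx, hxv⟩ | ⟨hno, hv⟩
        · exact Or.inl ⟨x, hsrc x y hx, hxv⟩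
        · refine Or.inr ⟨fun x hx hxa hxv => ?_, hv⟩
          obtain ⟨hxN, hxv⟩ := hvis y hy a v hact x hx hxv
          exact hno x hxN hxa hxv
  · rintro x y (⟨hx, hy, hp⟩ | ⟨a, hx, hy, hxa, hya, hlt⟩ | hs | ⟨a, v, hact, hx, hy, hya, hall⟩)
    · exact Or.inl ⟨Or.inr hx, Or.inr hy, hp⟩
    · exact Or.inr (Or.inl ⟨a, Or.inr hx, Or.inr hy, hxa, hya, (hiff hx hy).2 hlt⟩)
    · exact Or.inr (Or.inr (Or.inl (hsrc x y hs)))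
    · refine Or.inr (Or.inr (Or.inr ⟨a, v, hact, Or.inr hx, Or.inr hy, hya, ?_⟩))
      intro z hz hza hzv
      obtain ⟨hzN, hzv⟩ := hvis x hx a v hact z hz hzv
      exact (hiff hzN hy).2 (hall z hzN hza hzv)

end Insert

/-! ### Locality for abstract executions -/

namespace MinimalViolation

variable {lt : Action Dom Thread → Action Dom Thread → Prop} {m : Action Dom Thread}

open Classical in
/-- The nodes after `m` have positive rank, and among them those of thread `s` have rank `2`. -/
noncomputable def flushRank (lt : Action Dom Thread → Action Dom Thread → Prop)
    (m : Action Dom Thread) (s : Thread) (x : Action Dom Thread) : ℕ :=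
  if lt m x then (if x.thread = s then 2 else 1) else 0

theorem flushRank_of_not_lt {s : Thread} {x : Action Dom Thread} (hx : ¬ lt m x) :
    flushRank lt m s x = 0 := if_neg hx

theorem flushRank_of_lt {s : Thread} {x : Action Dom Thread} (hx : lt m x) (hs : x.thread ≠ s) :
    flushRank lt m s x = 1 := by simp [flushRank, hx, hs]

theorem flushRank_thread {s : Thread} {x : Action Dom Thread} (hx : lt m x) (hs : x.thread = s) :
    flushRank lt m s x = 2 := by simp [flushRank, hx, hs]

variable [Zero Dom] {P : Program Dom Thread Reg Label} {σ : Thread → ℕ → Label × (Reg → Dom)}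
  {N : Set (Action Dom Thread)} (h : MinimalViolation P σ N lt m)
include h

/-- In the thread of `m`, the store `x` would precede `m` in program order. Two stores to one
address are never reordered, and a load `m` would see `x`, against `lt_of_visible`. -/
theorem thread_ne {a : Dom} {x : Action Dom Thread} (hx : x ∈ N) (hmx : lt m x)
    (hxa : x.IsStoreTo a) (hma : m.IsStoreTo a ∨ ∃ v, m.act = .ld a v) :
    x.thread ≠ m.thread := by
  intro ht
  have ho := h.valid.order
  have hne : x ≠ m := by rintro rfl; exact ho.irrefl _ hx hmx
  have hpo : x.PO m := by
    refine ⟨ht, ?_⟩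
    have h1 : ¬ m.node < x.node := fun hn => h.last.2 x hx ⟨ht.symm, hn⟩
    have h2 : x.node ≠ m.node := fun hn => hne (h.valid.uniq x hx m h.mem ht hn)
    omega
  rcases hma with hma | ⟨v, hma⟩
  · refine ho.asymm h.mem hx hmx (h.valid.ppo x hx m h.mem hpo fun hr => ?_)
    obtain ⟨v, hv⟩ := hxa
    obtain ⟨u, hu⟩ := hma
    simp [hv, hu, Act.MayReorder] at hr
  · exact ho.asymm h.mem hx hmx (h.lt_of_visible hma hx hxa (Or.inr hpo))

/-- A store after `m` that is visible to a load belongs to the thread of the load. -/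
theorem po_of_visible {a v : Dom} {y z : Action Dom Thread} (hy : y ∈ N) (hact : y.act = .ld a v)
    (hz : z ∈ N) (hmz : lt m z) (hvis : Visible lt z y) : z.PO y := by
  refine hvis.resolve_left fun hzy => ?_
  exact h.not_lt_of_load hy hact (h.valid.order.trans m h.mem z hz y hy hmz hzy)

/-- Among the nodes after `m`, those of thread `s` are moved behind all others. There are no loads
after `m`, a load sees such a node only in its own thread, and the order inside each thread is kept;
so all sources stay the same. The coherence order between threads may change. -/
theorem valid_flush (s : Thread) : Valid P σ N (RankLex (flushRank lt m s) lt) ∧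
    ∀ x y, IsSrc N (RankLex (flushRank lt m s) lt) x y ↔ IsSrc N lt x y := by
  have ho := h.valid.order
  have hload : ∀ {y a v}, y ∈ N → y.act = .ld a v → flushRank lt m s y = 0 :=
    fun hy hact => flushRank_of_not_lt (h.not_lt_of_load hy hact)
  have hvis : ∀ {y a v z}, y ∈ N → y.act = .ld a v → z ∈ N →
      (Visible (RankLex (flushRank lt m s) lt) z y ↔ Visible lt z y) := by
    intro y a v z hy hact hz
    refine or_congr_left ⟨?_, fun hzy => ?_⟩
    · rintro (h' | h')
      · rw [hload hy hact] at h'; omega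
      · exact h'.2
    · refine Or.inr ⟨?_, hzy⟩
      rw [hload hy hact, flushRank_of_not_lt]
      exact fun hmz => h.not_lt_of_load hy hact (ho.trans m h.mem z hz y hy hmz hzy)
  have hmono : ∀ {x y}, x ∈ N → y ∈ N → x.thread = y.thread → lt x y →
      RankLex (flushRank lt m s) lt x y := by
    intro x y hx hy ht hxy
    by_cases h1 : lt m x
    · have h2 := ho.trans m h.mem x hx y hy h1 hxy
      refine Or.inr ⟨?_, hxy⟩
      by_cases hs : y.thread = s
      · rw [flushRank_thread h1 (ht.trans hs), flushRank_thread h2 hs]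
      · rw [flushRank_of_lt h1 (ht ▸ hs), flushRank_of_lt h2 hs]
    · by_cases h2 : lt m y
      · left
        rw [flushRank_of_not_lt h1]
        by_cases hs : y.thread = s
        · rw [flushRank_thread h2 hs]; omega
        · rw [flushRank_of_lt h2 hs]; omega
      · exact Or.inr ⟨by rw [flushRank_of_not_lt h1, flushRank_of_not_lt h2], hxy⟩
  refine h.valid.reorder (ho.toRankLex _) ?_ ?_ ?_
  · exact fun x hx y hy hpo hr => hmono hx hy hpo.1 (h.valid.ppo x hx y hy hpo hr)
  · rintro x y ⟨a, v, hact, hx, hy, hxa, hxv, hmax⟩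
    refine ⟨a, v, hact, hx, hy, hxa, (hvis hy hact hx).2 hxv, fun z hz hza hzv => ?_⟩
    have hzv := (hvis hy hact hz).1 hzv
    refine (hmax z hz hza hzv).imp_right fun hzx => ?_
    by_cases h1 : lt m z
    · have h2 := ho.trans m h.mem z hz x hx h1 hzx
      exact hmono hz hx ((h.po_of_visible hy hact hz h1 hzv).1.trans
        (h.po_of_visible hy hact hx h2 hxv).1.symm) hzx
    · by_cases h2 : lt m x
      · left
        rw [flushRank_of_not_lt h1]
        by_cases hs : x.thread = s
        · rw [flushRank_thread h2 hs]; omega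
        · rw [flushRank_of_lt h2 hs]; omega
      · exact Or.inr ⟨by rw [flushRank_of_not_lt h1, flushRank_of_not_lt h2], hzx⟩
  · intro y hy a v hact hno x hx hxa hxv
    exact hno x hx hxa ((hvis hy hact hx).1 hxv)

/-- An edge survives the change of the coherence order if neither endpoint is a moved node and, for
a from-read edge, no visible store before its target is one. -/
theorem hb_flush {s : Thread} {x y : Action Dom Thread} (hxy : HB N lt x y)
    (hx : lt m x → x.thread ≠ s) (hy : lt m y → y.thread ≠ s)
    (hfr : ∀ a v, x.act = .ld a v → ∀ w ∈ N, w.IsStoreTo a → Visible lt w x → lt w y →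
      lt m w → w.thread ≠ s) : HB N (RankLex (flushRank lt m s) lt) x y := by
  have ho := h.valid.order
  have hmono : ∀ {x y}, x ∈ N → y ∈ N → (lt m x → x.thread ≠ s) → (lt m y → y.thread ≠ s) →
      lt x y → RankLex (flushRank lt m s) lt x y := by
    intro x y hx hy hxs hys hxy
    by_cases h1 : lt m x
    · have h2 := ho.trans m h.mem x hx y hy h1 hxy
      exact Or.inr ⟨by rw [flushRank_of_lt h1 (hxs h1), flushRank_of_lt h2 (hys h2)], hxy⟩
    · by_cases h2 : lt m y
      · left
        rw [flushRank_of_not_lt h1, flushRank_of_lt h2 (hys h2)]; omega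
      · exact Or.inr ⟨by rw [flushRank_of_not_lt h1, flushRank_of_not_lt h2], hxy⟩
  rcases hxy with h' | ⟨a, hxN, hyN, hxa, hya, hlt⟩ | h' | ⟨a, v, hact, hxN, hyN, hya, hall⟩
  · exact Or.inl h'
  · exact Or.inr (Or.inl ⟨a, hxN, hyN, hxa, hya, hmono hxN hyN hx hy hlt⟩)
  · exact Or.inr (Or.inr (Or.inl (((h.valid_flush s).2 x y).2 h')))
  · refine Or.inr (Or.inr (Or.inr ⟨a, v, hact, hxN, hyN, hya, fun w hw hwa hwv => ?_⟩))
    have hwv' : Visible lt w x := by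
      refine hwv.imp_left ?_
      rintro (h' | h')
      · rw [flushRank_of_not_lt (h.not_lt_of_load hxN hact)] at h'; omega
      · exact h'.2
    have hlt := hall w hw hwa hwv'
    exact hmono hw hyN (hfr a v hact w hw hwa hwv' hlt) hy hlt

/-- Let `x` be a store after `m` as in `exists_first_store`, and `e` the last node of its thread.
Then `e` is not a load that reads early from a store after `m` and that is followed by a store
to the same address in the happens-before relation. -/
theorem not_early_read {x e w y : Action Dom Thread} {a v : Dom} (hxm : x ≠ m)
    (hmx : HB N lt m x)
    (hxr : ∀ r ∈ N, lt m r → ReflTransGen (Avoiding (HB N lt) m) x r) (he : POLast N e)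
    (hem : e ≠ m) (hxe : x.PO e) (hact : e.act = .ld a v) (hw : w ∈ N) (hwa : w.IsStoreTo a)
    (hwv : Visible lt w e) (hmw : lt m w) (hey : HB N lt e y) (hya : y.IsStoreTo a)
    (hwy : lt w y) : False := by
  have ho := h.valid.order
  have hacy := h.transGen_avoiding_irrefl
  have hy := hey.mem_right
  have hwm : w ≠ m := by rintro rfl; exact ho.irrefl _ hw hmw
  have hym : y ≠ m := by rintro rfl; exact ho.asymm hw hy hwy hmw
  have hwe : w.PO e := h.po_of_visible he.1 hact hw hmw hwv
  have hwe' : Avoiding (HB N lt) m w e := ⟨Or.inl ⟨hw, he.1, hwe⟩, hwm, hem⟩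
  have hey' : Avoiding (HB N lt) m e y := ⟨hey, hem, hym⟩
  have hwne : w ≠ e := by rintro rfl; exact hwa.act_ne_ld hact
  have hyne : y ≠ e := by rintro rfl; exact hya.act_ne_ld hact
  have hxne : x ≠ e := by rintro rfl; exact lt_irrefl _ hxe.2
  obtain ⟨z, hzm, hyz, hz⟩ := exists_first_arrival (h.transGen hy hym) hym
  have hzne : z ≠ e := by rintro rfl; exact hacy _ (TransGen.head' hey' hyz)
  -- A visit to `e` would yield a path from `e` to `w`, which `w → e` closes to a cycle that avoids
  -- `m`. In the same way `e → y` keeps the path from `y` to `z` away from `e`.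
  have h1 : ReflTransGen (Avoiding (Avoiding (HB N lt) m) e) x w := by
    rcases reflTransGen_avoiding (hxr w hw hmw) hxne hwne with h' | h'
    · exact h'
    · exact absurd (h'.2.tail hwe') (hacy e)
  have h2 : ReflTransGen (Avoiding (Avoiding (HB N lt) m) e) y z := by
    rcases reflTransGen_avoiding hyz hyne hzne with h' | h'
    · exact h'
    · exact absurd (TransGen.head hey' h'.1) (hacy e)
  have hS : N \ {e} ⊆ N := Set.sdiff_subset
  have hr : ∀ {p q}, HB N lt p q → p ≠ e → q ≠ e → HB (N \ {e}) lt p q := fun hpq hp hq =>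
    hpq.restrict hS ⟨hpq.mem_left, hp⟩ ⟨hpq.mem_right, hq⟩
  have hr' : ∀ {p q}, ReflTransGen (Avoiding (Avoiding (HB N lt) m) e) p q →
      ReflTransGen (HB (N \ {e}) lt) p q := fun hpq =>
    ReflTransGen.mono (fun p q hpq => hr hpq.1.1 hpq.2.1 hpq.2.2) _ _ hpq
  have hv : Valid P σ (N \ {e}) lt := by
    refine h.valid.restrict hS ?_ ?_
    · rintro p ⟨hp, -⟩ q hq hqp
      exact ⟨hq, by rintro rfl; exact he.2 p hp hqp⟩
    · rintro p ⟨hp, -⟩ q hq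
      obtain ⟨_, _, _, hqN, _, hqa, _⟩ := hq
      exact ⟨hqN, by rintro rfl; exact hqa.act_ne_ld hact⟩
  refine h.not_cyclicOn_of_ssubset ⟨hS, fun hs => (hs he.1).2 rfl⟩ hv ⟨m, ?_⟩
  -- The coherence edge `w → y` bypasses `w → e → y`. This gives a cycle through `m` in the
  -- execution without `e`, contrary to minimality.
  have hwy' : HB N lt w y := Or.inr (Or.inl ⟨a, hw, hy, hwa, hya, hwy⟩)
  exact TransGen.head' (hr hmx hem.symm hxne) ((hr' h1).trans
    (((hr' h2).tail (hr hz hzne hem.symm)).head (hr hwy' hwne hyne)))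

/-- The happens-before path from the last node `e` of thread `s` to `m` does not depend on the
stores of thread `s` after `m`. -/
theorem exists_path {x e : Action Dom Thread} (hxm : x ≠ m) (hmx : HB N lt m x)
    (hxr : ∀ r ∈ N, lt m r → ReflTransGen (Avoiding (HB N lt) m) x r) (he : POLast N e)
    (hem : e ≠ m) (hxe : x.PO e) :
    ∃ z, z ∈ N ∧ (lt m z → z.thread ≠ x.thread) ∧ HB N lt z m ∧
      ReflTransGen (Avoiding (HB N (RankLex (flushRank lt m x.thread) lt)) m) e z := by
  have ho := h.valid.order
  have hacy := h.transGen_avoiding_irrefl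
  -- Another node of the thread of `e` on the path would precede `e` in program order and close a
  -- cycle that avoids `m`. Since `e` itself is not executed after `m`, the path contains no moved
  -- node.
  have hR : ∀ w ∈ N, w ≠ m → ReflTransGen (Avoiding (HB N lt) m) e w → w.thread = x.thread →
      w = e := by
    intro w hw hwm hew ht
    by_contra hne
    have hte := ht.trans hxe.1
    have h1 : ¬ e.node < w.node := fun hn => he.2 w hw ⟨hte.symm, hn⟩
    have h2 : w.node ≠ e.node := fun hn => hne (h.valid.uniq w hw e he.1 hte hn)
    exact hacy e (TransGen.tail' hew ⟨Or.inl ⟨hw, he.1, hte, by omega⟩, hwm, hem⟩)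
  have hR' : ∀ w ∈ N, w ≠ m → ReflTransGen (Avoiding (HB N lt) m) e w → lt m w →
      w.thread ≠ x.thread := by
    intro w hw hwm hew hmw ht
    have := hR w hw hwm hew ht
    subst this
    exact h.after w hw hmw he
  obtain ⟨z, hzm, hez, hz⟩ := exists_first_arrival (h.transGen he.1 hem) hem
  refine ⟨z, hz.mem_left, hR' z hz.mem_left hzm hez, hz, ?_⟩
  clear hz
  induction hez with
  | refl => exact .refl
  | @tail p q hep hpq ih =>
    obtain ⟨hpq, hpm, hqm⟩ := hpq
    refine (ih hpm).tail ⟨?_, hpm, hqm⟩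
    have hq := hep.tail ⟨hpq, hpm, hqm⟩
    refine h.hb_flush hpq (hR' p hpq.mem_left hpm hep) (hR' q hpq.mem_right hqm hq) ?_
    -- A load that sees a moved store belongs to the same thread, hence is `e`. Its only possible
    -- outgoing edge is a from-read edge, which is the case excluded by `not_early_read`.
    intro a v hact w hw hwa hwv hwq hmw ht
    have hwp := h.po_of_visible hpq.mem_left hact hw hmw hwv
    have hpe := hR p hpq.mem_left hpm hep (hwp.1.symm.trans ht)
    subst hpe
    rcases hpq with h' | ⟨b, -, -, h', -⟩ | ⟨b, u, -, -, -, h', -⟩ | h'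
    · exact he.2 q h'.2.1 h'.2.2
    · exact h'.act_ne_ld hact
    · exact h'.act_ne_ld hact
    · obtain ⟨b, u, hact', -, -, hqb, -⟩ := id h'
      rw [hact] at hact'; cases hact'
      exact h.not_early_read hxm hmx hxr he hem hxe hact hw hwa hwv hmw
        (Or.inr (Or.inr (Or.inr h'))) hqb hwq

/-- Given a minimal violation, there is a violation in which only one thread does not respect the
program order. -/
theorem exists_single_thread : ∃ σ' N' lt' s, Valid P σ' N' lt' ∧ CyclicOn N' lt' ∧
    ∀ x ∈ N', ∀ y ∈ N', x.PO y → lt' y x → x.thread = s := by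
  have ho := h.valid.order
  obtain ⟨a, x, hx, hmltx, hxa, hma, hmx, hxr⟩ := h.exists_first_store
  have hxm : x ≠ m := by rintro rfl; exact ho.irrefl _ hx hmltx
  have hst : x.thread ≠ m.thread := h.thread_ne hx hmltx hxa hma
  obtain ⟨e, he, het, hen⟩ := exists_poLast h.valid.fin hx
  have hxe : x.PO e := by
    refine ⟨het.symm, lt_of_le_of_ne hen fun hn => ?_⟩
    have := h.valid.uniq x hx e he.1 het.symm hn
    subst this
    exact h.after x hx hmltx he
  have hem : e ≠ m := by rintro rfl; exact hst hxe.1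
  obtain ⟨z, hz, hzR, hzm, hez⟩ := h.exists_path hxm hmx hxr he hem hxe
  obtain ⟨hv2, hs2⟩ := h.valid_flush x.thread
  set lt2 := RankLex (flushRank lt m x.thread) lt with hlt2
  have ho2 := hv2.order
  have hzne : z ≠ m := by
    rintro rfl
    rcases reflTransGen_iff_eq_or_transGen.1 hez with h' | h'
    · exact hem h'.symm
    · obtain ⟨_, -, h'⟩ := TransGen.tail'_iff.1 h'
      exact h'.2.2 rfl
  -- The nodes without `m`, where all stores of the thread of `x` after `m` come last.
  let D : Set (Action Dom Thread) := {y | lt m y → y.thread ≠ x.thread}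
  have hrank : ∀ {y}, y ∉ D → flushRank lt m x.thread y = 2 := by
    intro y hy
    simp only [D, Set.mem_ofPred_eq, not_forall, not_not] at hy
    exact flushRank_thread hy.1 hy.2
  have hD2 : ∀ {y}, flushRank lt m x.thread y = 2 → y ∉ D := by
    intro y hy hyD
    by_cases h1 : lt m y
    · rw [flushRank_of_lt h1 (hyD h1)] at hy; omega
    · rw [flushRank_of_not_lt h1] at hy; omega
  have hle2 : ∀ y, flushRank lt m x.thread y ≤ 2 := by
    intro y; unfold flushRank; split_ifs <;> omega
  have hxD : x ∉ D := fun hc => hc hmltx rfl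
  have hloadD : ∀ {y b v}, y ∈ N → y.act = .ld b v → y ∈ D :=
    fun hy hact hmy => absurd hmy (h.not_lt_of_load hy hact)
  have hltD : ∀ {y}, y ∈ N → lt y m → y ∈ D :=
    fun hy hym hmy => absurd hmy (ho.asymm hy h.mem hym)
  let N' := N \ {m}
  have hN' : N' ⊆ N := Set.sdiff_subset
  have hv2' : Valid P σ N' lt2 := by
    refine hv2.restrict hN' ?_ ?_
    · rintro p ⟨hp, -⟩ q hq hqp
      exact ⟨hq, by rintro rfl; exact h.last.2 p hp hqp⟩
    · rintro p ⟨hp, -⟩ q hq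
      exact ⟨((hs2 q p).1 hq).choose_spec.choose_spec.2.1,
        by rintro rfl; exact h.not_isSrc p ((hs2 _ p).1 hq)⟩
  -- Minimality applies to every valid order on a proper subset of the nodes, in particular to the
  -- flushed one.
  have hac2 : ¬ CyclicOn N' lt2 := h.not_cyclicOn_of_ssubset h.diff_ssubset hv2'
  obtain ⟨L, hL, hrL⟩ := exists_linear_extension (not_exists.1 hac2)
  classical
  -- The new order follows the linear extension, except that the nodes outside `D` are held back to
  -- the end. These are the only ones that get delayed, and all belong to the thread of `x`.
  let g : Action Dom Thread → ℕ := fun y => if y ∈ D then 0 else 1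
  let lt3 := RankLex g L
  have hlt3 : ∀ {y z}, L y z → (y ∉ D → z ∉ D) → lt3 y z := by
    intro y z hyz hD
    by_cases h1 : y ∈ D <;> by_cases h2 : z ∈ D
    · exact Or.inr ⟨by simp [g, h1, h2], hyz⟩
    · exact Or.inl (by simp [g, h1, h2])
    · exact absurd h2 (hD h1)
    · exact Or.inr ⟨by simp [g, h1, h2], hyz⟩
  have hmono : ∀ {y z}, lt2 y z → y ∉ D → z ∉ D := by
    intro y z hyz hyD
    apply hD2
    have h1 := hrank hyD
    have h2 := hle2 z
    rcases hyz with h' | h'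
    · omega
    · rw [← h'.1, h1]
  -- The nodes outside `D` are last in `lt2` too. So no edge that must be respected leads from them
  -- back into `D`, apart from program order that may be violated.
  obtain ⟨hv3, -, -, hhb3⟩ := hv2'.resort (lt' := lt3) ((hL N').toRankLex g)
    (fun p hp q hq hpq hr => hlt3 (hrL _ _ (Or.inl ⟨hp, hq, hpq⟩))
      (hmono (hv2'.ppo p hp q hq hpq hr)))
    (fun p q hpq => hlt3 (hrL _ _ (Or.inr (Or.inl hpq))) (hmono hpq.choose_spec.2.2.2.2))
    (fun p q hpq => by
      obtain ⟨b, v, hact, -, hq, -, hvis, -⟩ := id hpq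
      exact hvis.imp_left fun h' => hlt3 (hrL _ _ (Or.inr (Or.inr (Or.inl hpq)))) (hmono h'))
    (fun p q hpq => by
      obtain ⟨b, v, hact, hp, -⟩ := id hpq
      exact hlt3 (hrL _ _ (Or.inr (Or.inr (Or.inr hpq))))
        fun hpD => absurd (hloadD hp.1 hact) hpD)
  have ho3 := hv3.order
  have hD3 : ∀ p ∈ N', p ∈ D → ∀ q ∈ N', lt3 q p → q ∈ D := by
    intro p _ hpD q _ hqp
    by_contra hqD
    rcases hqp with h' | h' <;> simp [g, hpD, hqD] at h'
  -- The value of `m`, if it is a load, has to be determined anew.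
  obtain ⟨m', ht', hn', hact', hval'⟩ : ∃ m' : Action Dom Thread, m'.thread = m.thread ∧
      m'.node = m.node ∧
      ((m' = m ∧ m.IsStoreTo a) ∨ ∃ v v', m.act = .ld a v ∧ m'.act = .ld a v') ∧
      ∀ b v, m'.act = .ld b v →
        (∃ w ∈ N', w ∈ D ∧ w.act = .st b v ∧ ∀ u ∈ N', u ∈ D → u.IsStoreTo b → u = w ∨ lt3 u w) ∨
        (∀ w ∈ N', w ∈ D → ¬ w.IsStoreTo b) ∧ v = 0 := by
    rcases hma with hma | ⟨v, hma⟩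
    · exact ⟨m, rfl, rfl, Or.inl ⟨rfl, hma⟩, fun b v hact => absurd hact hma.act_ne_ld⟩
    · have hsub : {w ∈ N' | w ∈ D ∧ w.IsStoreTo a} ⊆ N' := Set.sep_subset _ _
      by_cases hne : {w ∈ N' | w ∈ D ∧ w.IsStoreTo a}.Nonempty
      · obtain ⟨w, ⟨hw, hwD, u, hwu⟩, hmax⟩ :=
          (ho3.subset hsub).exists_max (hv3.fin.subset hsub) hne
        refine ⟨⟨m.thread, m.node, .ld a u⟩, rfl, rfl, Or.inr ⟨v, u, hma, rfl⟩, ?_⟩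
        intro b v' hact
        cases hact
        exact Or.inl ⟨w, hw, hwD, hwu, fun q hq hqD hqa => hmax q ⟨hq, hqD, hqa⟩⟩
      · refine ⟨⟨m.thread, m.node, .ld a 0⟩, rfl, rfl, Or.inr ⟨v, 0, hma, rfl⟩, ?_⟩
        intro b v' hact
        cases hact
        exact Or.inr ⟨fun w hw hwD hwa => hne ⟨w, hw, hwD, hwa⟩, rfl⟩
  have hpoM : ∀ p ∈ N', p.thread = m'.thread → p.node < m'.node := by
    rintro p ⟨hp, hpm⟩ ht
    rw [ht'] at ht
    rw [hn']
    have h1 : ¬ m.node < p.node := fun hn => h.last.2 p hp ⟨ht.symm, hn⟩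
    have h2 : p.node ≠ m.node := fun hn => hpm (h.valid.uniq p hp m h.mem ht hn)
    omega
  have hm' : m' ∉ N' := fun hc => lt_irrefl _ (hpoM m' hc rfl)
  have hmD : ∀ p ∈ N', p.thread = m'.thread → p ∈ D := by
    intro p _ ht hmp ht2
    exact hst (ht2.symm.trans (ht.trans ht'))
  obtain ⟨⟨σ', hv4⟩, hhb4⟩ := hv3.insert_node (m := m') (D := D) hpoM
    (by
      intro k hk
      obtain ⟨y, hy, hyt, hyn⟩ := h.valid.down m h.mem k (hn' ▸ hk)
      refine ⟨y, ⟨hy, ?_⟩, hyt.trans ht'.symm, hyn⟩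
      rintro rfl
      omega)
    (by
      rcases hact' with ⟨rfl, -⟩ | ⟨v, v', -, hact⟩
      · exact h.valid.ne_isu _ h.mem
      · rw [hact]; simp)
    (by
      rcases hact' with ⟨rfl, -⟩ | ⟨v, v', hact, hact'⟩
      · exact ⟨_, h.valid.step _ h.mem⟩
      · have := h.valid.step m h.mem
        rw [hact] at this
        rw [hact', ht', hn']
        exact this.load_any v')
    hD3 hmD (fun y hy hyD b v hact => hyD (hloadD hy.1 hact)) hval'
  set lt4 := insertLt m' N' D lt3 with hlt4
  have hxN' : x ∈ N' := ⟨hx, hxm⟩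
  have hzN' : z ∈ N' := ⟨hz, hzne⟩
  have heN' : e ∈ N' := ⟨he.1, hem⟩
  have hiff : ∀ {p q}, p ∈ N' → q ∈ N' → (lt4 p q ↔ lt3 p q) :=
    fun hp hq => insertLt_iff ho3 hm' hD3 hp hq
  have hvisM : ∀ w ∈ insert m' N', w ≠ m' → Visible lt4 w m' → w ∈ N' ∧ w ∈ D := by
    intro w hw hwm hwv
    have hw := hw.resolve_left hwm
    refine ⟨hw, ?_⟩
    rcases hwv with h' | h'
    · exact (insertLt_right hm' hw).1 h'
    · exact hmD w hw h'.1
  -- The store `x` is held back until after `m'`, whereas everything that a load `m'` can see lies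
  -- in `D`.
  have hmx4 : HB (insert m' N') lt4 m' x := by
    have hlt : lt4 m' x := (insertLt_left hm' hxN').2 hxD
    rcases hact' with ⟨rfl, hma⟩ | ⟨v, v', -, hact⟩
    · exact Or.inr (Or.inl ⟨a, Or.inl rfl, Or.inr hxN', hma, hxa, hlt⟩)
    · refine Or.inr (Or.inr (Or.inr ⟨a, v', hact, Or.inl rfl, Or.inr hxN', hxa, ?_⟩))
      intro w hw hwa hwv
      obtain ⟨hwN, hwD⟩ := hvisM w hw (by rintro rfl; exact hwa.act_ne_ld hact) hwv
      exact (hiff hwN hxN').2 (Or.inl (by simp [g, hwD, hxD]))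
  have hez4 : ReflTransGen (HB (insert m' N') lt4) e z := by
    refine ReflTransGen.mono (fun p q hpq => hhb4 p q ((hhb3 p q).2 ?_)) _ _ hez
    exact hpq.1.restrict hN' ⟨hpq.1.mem_left, hpq.2.1⟩ ⟨hpq.1.mem_right, hpq.2.2⟩
  have hzD : z ∈ D := hzR
  have hzm4 : TransGen (HB (insert m' N') lt4) z m' := by
    have hlt : lt4 z m' := (insertLt_right hm' hzN').2 hzD
    rcases hzm with ⟨-, -, hp⟩ | ⟨b, -, -, hzb, hmb, -⟩ | hs | ⟨b, v, hact, -, -, hmb, hall⟩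
    · exact .single (Or.inl ⟨Or.inr hzN', Or.inl rfl, hp.1.trans ht'.symm, hn' ▸ hp.2⟩)
    · rcases hact' with ⟨rfl, -⟩ | ⟨v, v', hact, -⟩
      · exact .single (Or.inr (Or.inl ⟨b, Or.inr hzN', Or.inl rfl, hzb, hmb, hlt⟩))
      · exact absurd hact hmb.act_ne_ld
    · obtain ⟨b, v, hact, -, -, hzb, -, -⟩ := hs
      rcases hact' with ⟨rfl, hma⟩ | ⟨u, v', hact2, hact3⟩
      · exact absurd hact hma.act_ne_ld
      · rw [hact] at hact2; cases hact2
        rcases hv4.isSrc_or (Or.inl rfl) hact3 with ⟨w, hw⟩ | hno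
        · have hwm : HB (insert m' N') lt4 w m' := Or.inr (Or.inr (Or.inl hw))
          obtain ⟨b, u, hact4, hwN, -, hwb, hwv, hmax⟩ := hw
          rw [hact3] at hact4; cases hact4
          -- The new load need not read from `z`, but otherwise its source is a later store to the
          -- same address, so the edge becomes a path of length two.
          rcases hmax z (Or.inr hzN') hzb (Or.inl hlt) with rfl | h'
          · exact .single hwm
          · exact .head (Or.inr (Or.inl ⟨_, Or.inr hzN', hwN, hzb, hwb, h'⟩)) (.single hwm)
        · exact absurd (Or.inl hlt) (hno z (Or.inr hzN') hzb)
    · rcases hact' with ⟨rfl, -⟩ | ⟨u, v', hact2, -⟩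
      · refine .single (Or.inr (Or.inr (Or.inr
          ⟨b, v, hact, Or.inr hzN', Or.inl rfl, hmb, fun w hw hwb hwv => ?_⟩)))
        have hwN : w ∈ N' := by
          refine hw.resolve_left ?_
          rintro rfl
          rcases hwv with h' | h'
          · exact (insertLt_left hm' hzN').1 h' hzD
          · exact h.last.2 z hz h'
        refine (insertLt_right hm' hwN).2 ?_
        rcases hwv with h' | h'
        · exact hD3 z hzN' hzD w hwN ((hiff hwN hzN').1 h')
        · exact hltD hwN.1 (hall w hwN.1 hwb (Or.inr h'))
      · exact absurd hact2 hmb.act_ne_ld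
  refine ⟨σ', insert m' N', lt4, x.thread, hv4, ⟨m', ?_⟩, ?_⟩
  · have hxe4 : HB (insert m' N') lt4 x e := Or.inl ⟨Or.inr hxN', Or.inr heN', hxe⟩
    exact TransGen.head hmx4 (TransGen.head hxe4 (TransGen.trans_right hez4 hzm4))
  · rintro p (rfl | hp) q (rfl | hq) hpq hqp
    · exact absurd hpq.2 (lt_irrefl _)
    · have := hpoM q hq hpq.1.symm
      have := hpq.2
      omega
    · exact absurd (hmD p hp hpq.1) ((insertLt_left hm' hp).1 hqp)
    · have h1 := (hiff hq hp).1 hqp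
      have hLpq : L p q := hrL p q (Or.inl ⟨hp, hq, hpq⟩)
      -- Since `L` respects program order, only the rank can put `q` before `p`, so `p` is one of
      -- the nodes held back.
      rcases h1 with h' | h'
      · by_contra hps
        have hpD : p ∈ D := fun _ => hps
        simp [g, hpD] at h'
      · exact absurd hLpq ((hL N').asymm hq hp h'.2)

end MinimalViolation

end StoreAtomic

namespace StoreAtomic

open Relation

variable {Dom Thread Reg Label : Type*}

/-! ### Histories of runs -/

theorem before_iff {τ : List (Action Dom Thread)} {x y : Action Dom Thread} :
    Before τ x y ↔ ∃ α β, τ = α ++ y :: β ∧ x ∈ α := by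
  constructor
  · rintro ⟨τ₁, τ₂, τ₃, rfl⟩
    exact ⟨τ₁ ++ x :: τ₂, τ₃, rfl, by simp⟩
  · rintro ⟨α, β, rfl, hx⟩
    obtain ⟨γ, δ, rfl⟩ := List.append_of_mem hx
    exact ⟨γ, δ, β, rfl⟩

theorem before_iff_of_nodup {α β : List (Action Dom Thread)} {x y : Action Dom Thread}
    (h : (α ++ y :: β).Nodup) : Before (α ++ y :: β) x y ↔ x ∈ α := by
  rw [before_iff]
  refine ⟨?_, fun hx => ⟨α, β, rfl, hx⟩⟩
  rintro ⟨α', β', he, hx⟩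
  have hy : y ∉ α := fun hy => (List.nodup_append.1 h).2.2 y hy y (by simp) rfl
  have hy' : y ∉ β := (List.nodup_cons.1 (List.nodup_append.1 h).2.1).1
  have h2 := (List.append_cons_inj_of_notMem hy hy').1 he
  exact h2.1 ▸ hx

theorem Before.mem_left {τ : List (Action Dom Thread)} {x y : Action Dom Thread}
    (h : Before τ x y) : x ∈ τ := by
  obtain ⟨τ₁, τ₂, τ₃, rfl⟩ := h; simp

theorem Before.mem_right {τ : List (Action Dom Thread)} {x y : Action Dom Thread}
    (h : Before τ x y) : y ∈ τ := by
  obtain ⟨τ₁, τ₂, τ₃, rfl⟩ := h; simp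

theorem strictOn_before {τ : List (Action Dom Thread)} (hn : τ.Nodup) {N : Set (Action Dom Thread)}
    (hN : ∀ x ∈ N, x ∈ τ) : StrictOn N (Before τ) := by
  refine ⟨?_, ?_, ?_⟩
  · intro x hx hb
    obtain ⟨α, β, rfl⟩ := List.append_of_mem (hN x hx)
    rw [before_iff_of_nodup hn] at hb
    exact (List.nodup_append.1 hn).2.2 x hb x (by simp) rfl
  · intro x _ y _ z hz hxy hyz
    obtain ⟨α, β, rfl⟩ := List.append_of_mem (hN z hz)
    rw [before_iff_of_nodup hn] at hyz ⊢
    obtain ⟨γ, δ, rfl⟩ := List.append_of_mem hyz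
    rw [List.append_assoc, List.cons_append] at hn hxy
    rw [before_iff_of_nodup hn] at hxy
    simp [hxy]
  · intro x hx y hy hne
    obtain ⟨α, β, rfl⟩ := List.append_of_mem (hN y hy)
    have := hN x hx
    rw [List.mem_append, List.mem_cons] at this
    rcases this with h | h | h
    · exact Or.inl ((before_iff_of_nodup hn).2 h)
    · exact absurd h hne
    · obtain ⟨γ, δ, rfl⟩ := List.append_of_mem h
      exact Or.inr ⟨α, γ, δ, by simp⟩

open Classical in
/-- The content of the memory after a sequence of actions. -/
noncomputable def memAfter [Zero Dom] (τ : List (Action Dom Thread)) : Dom → Dom :=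
  τ.foldl (fun M x => match x.act with
    | .st a v => Function.update M a v
    | _ => M) (fun _ => 0)

theorem memAfter_concat_store [Zero Dom] (τ : List (Action Dom Thread)) (t : Thread) (n : ℕ)
    (a v b : Dom) [Decidable (b = a)] :
    memAfter (τ ++ [⟨t, n, .st a v⟩]) b = if b = a then v else memAfter τ b := by
  simp only [memAfter, List.foldl_append, List.foldl_cons, List.foldl_nil, Function.update_apply]
  congr

theorem memAfter_concat [Zero Dom] (τ : List (Action Dom Thread)) {x : Action Dom Thread}
    (hx : ∀ a v, x.act ≠ .st a v) : memAfter (τ ++ [x]) = memAfter τ := by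
  obtain ⟨t, n, A⟩ := x
  cases A <;> simp_all [memAfter]

theorem memAfter_spec [Zero Dom] (τ : List (Action Dom Thread)) (a : Dom) :
    (∃ γ x δ, τ = γ ++ x :: δ ∧ x.act = .st a (memAfter τ a) ∧ ∀ z ∈ δ, ¬ z.IsStoreTo a) ∨
      ((∀ z ∈ τ, ¬ z.IsStoreTo a) ∧ memAfter τ a = 0) := by
  classical
  induction τ using List.reverseRecOn with
  | nil => exact Or.inr ⟨by simp, rfl⟩
  | append_singleton τ x ih =>
    by_cases hx : x.IsStoreTo a
    · obtain ⟨t, n, A⟩ := x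
      obtain ⟨v, hv⟩ := hx
      simp only at hv
      subst hv
      refine Or.inl ⟨τ, _, [], rfl, ?_, by simp⟩
      rw [memAfter_concat_store]; simp
    · have hm : memAfter (τ ++ [x]) a = memAfter τ a := by
        by_cases hs : ∃ b v, x.act = .st b v
        · obtain ⟨t, n, A⟩ := x
          obtain ⟨b, v, hv⟩ := hs
          simp only at hv
          subst hv
          rw [memAfter_concat_store, if_neg]
          rintro rfl
          exact hx ⟨v, rfl⟩
        · rw [memAfter_concat τ fun b v h => hs ⟨b, v, h⟩]
      rw [hm]
      rcases ih with ⟨γ, y, δ, rfl, hy, hδ⟩ | ⟨h1, h2⟩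
      · refine Or.inl ⟨γ, y, δ ++ [x], by simp, hy, ?_⟩
        intro z hz
        rw [List.mem_append, List.mem_singleton] at hz
        rcases hz with hz | rfl
        · exact hδ z hz
        · exact hx
      · refine Or.inr ⟨?_, h2⟩
        intro z hz
        rw [List.mem_append, List.mem_singleton] at hz
        rcases hz with hz | rfl
        · exact h1 z hz
        · exact hx

theorem LocalStep.ne_isu [Zero Dom] {c : ThreadCode Dom Reg Label} {p q : Label × (Reg → Dom)}
    {A : Act Dom} (h : LocalStep c p A q) : A ≠ .isu := by
  cases h <;> simp

/-- What holds for an occurrence of the action `y` after the actions `α`, where `inst t n` is the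
action of instance `n` of thread `t`. -/
structure ActionOK [Zero Dom] (inst : Thread → ℕ → Act Dom) (α : List (Action Dom Thread))
    (y : Action Dom Thread) : Prop where
  order : ¬ y.act.Delayable → (∀ z ∈ α, z.thread = y.thread → z.node < y.node) ∧
    ∀ k < y.node, (inst y.thread k).Delayable → ⟨y.thread, k, .isu⟩ ∈ α
  issue : y.act.Delayable → y.issue ∈ α
  ppo : y.act ≠ .isu → ∀ k < y.node, ¬ (inst y.thread k).MayReorder y.act →
    ⟨y.thread, k, inst y.thread k⟩ ∈ α
  -- The instances before `y` that do not occur in `α` are the pending ones. The load takes the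
  -- youngest pending store to its address, or the memory value if none is pending.
  val : ∀ a v, y.act = .ld a v →
    (∃ k < y.node, inst y.thread k = .st a v ∧ ⟨y.thread, k, inst y.thread k⟩ ∉ α ∧
      ∀ j < y.node, (∃ u, inst y.thread j = .st a u) → ⟨y.thread, j, inst y.thread j⟩ ∉ α → j ≤ k) ∨
    ((∀ j < y.node, (∃ u, inst y.thread j = .st a u) → ⟨y.thread, j, inst y.thread j⟩ ∈ α) ∧
      v = memAfter α a)

theorem ActionOK.congr [Zero Dom] {inst inst' : Thread → ℕ → Act Dom}
    {α : List (Action Dom Thread)} {y : Action Dom Thread} (h : ActionOK inst α y)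
    (he : ∀ k < y.node, inst' y.thread k = inst y.thread k) : ActionOK inst' α y where
  order hd := ⟨(h.order hd).1, fun k hk hdk => (h.order hd).2 k hk (he k hk ▸ hdk)⟩
  issue := h.issue
  ppo hi k hk hr := by
    rw [he k hk] at hr ⊢; exact h.ppo hi k hk hr
  val a v hact := by
    rcases h.val a v hact with ⟨k, hk, h1, h2, h3⟩ | ⟨h1, h2⟩
    · refine Or.inl ⟨k, hk, by rw [he k hk, h1], by rwa [he k hk], fun j hj hs hn => ?_⟩
      rw [he j hj] at hs hn
      exact h3 j hj hs hn
    · refine Or.inr ⟨fun j hj hs => ?_, h2⟩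
      rw [he j hj] at hs ⊢
      exact h1 j hj hs

/-- The history `h` of a run in which each thread `t` has issued `c t` instances; `inst t n` is the
action of instance `n` and `σ t n` the local state before it. -/
structure Hist [Zero Dom] (P : Program Dom Thread Reg Label) (inst : Thread → ℕ → Act Dom)
    (σ : Thread → ℕ → Label × (Reg → Dom)) (h : List (Action Dom Thread)) (c : Thread → ℕ) :
    Prop where
  init : ∀ t, σ t 0 = ((P t).init, fun _ => 0)
  step : ∀ t, ∀ n < c t, LocalStep (P t) (σ t n) (inst t n) (σ t (n + 1))
  mem : ∀ x ∈ h, x.node < c x.thread ∧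
    ((x.act = .isu ∧ (inst x.thread x.node).Delayable) ∨ x.act = inst x.thread x.node)
  nodup : h.Nodup
  exec : ∀ t, ∀ n < c t, ¬ (inst t n).Delayable → ⟨t, n, inst t n⟩ ∈ h
  isu : ∀ t, ∀ n < c t, (inst t n).Delayable → ⟨t, n, .isu⟩ ∈ h
  ok : ∀ α y β, h = α ++ y :: β → ActionOK inst α y

/-- The sequence `h ++ [x]` can only be split at `x` or inside `h`. -/
theorem concat_eq_append_cons {α : Type*} {h γ δ : List α} {x y : α}
    (he : h ++ [x] = γ ++ y :: δ) : (γ = h ∧ y = x) ∨ ∃ δ', h = γ ++ y :: δ' := by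
  rcases List.eq_nil_or_concat δ with rfl | ⟨δ', z, rfl⟩
  · obtain ⟨h1, h2⟩ := List.append_inj' he rfl
    simp only [List.cons.injEq, and_true] at h2
    exact Or.inl ⟨h1.symm, h2.symm⟩
  · rw [List.concat_eq_append, ← List.cons_append, ← List.append_assoc] at he
    exact Or.inr ⟨δ', (List.append_inj' he rfl).1⟩

section Hist

variable [Zero Dom] {P : Program Dom Thread Reg Label} {inst : Thread → ℕ → Act Dom}
  {σ : Thread → ℕ → Label × (Reg → Dom)} {h : List (Action Dom Thread)} {c : Thread → ℕ}

theorem Hist.ne_isu (H : Hist P inst σ h c) {t : Thread} {n : ℕ} (hn : n < c t) :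
    inst t n ≠ .isu := (H.step t n hn).ne_isu

/-- A delayed store or fence is executed. -/
theorem Hist.execute (H : Hist P inst σ h c) {t : Thread} {n : ℕ} (hn : n < c t)
    (hd : (inst t n).Delayable) (hnot : ⟨t, n, inst t n⟩ ∉ h)
    (hppo : ∀ k < n, ¬ (inst t k).MayReorder (inst t n) → ⟨t, k, inst t k⟩ ∈ h) :
    Hist P inst σ (h ++ [⟨t, n, inst t n⟩]) c where
  init := H.init
  step := H.step
  mem x hx := by
    rw [List.mem_append, List.mem_singleton] at hx
    rcases hx with hx | rfl
    · exact H.mem x hx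
    · exact ⟨hn, Or.inr rfl⟩
  nodup := by
    rw [List.nodup_append]
    refine ⟨H.nodup, by simp, ?_⟩
    rintro x hx y hy rfl
    rw [List.mem_singleton] at hy
    subst hy
    exact hnot hx
  exec t n hn hd := List.mem_append_left _ (H.exec t n hn hd)
  isu t n hn hd := List.mem_append_left _ (H.isu t n hn hd)
  ok α y β he := by
    rcases concat_eq_append_cons he with ⟨rfl, rfl⟩ | ⟨δ, he⟩
    · refine ⟨fun h' => absurd hd h', fun _ => H.isu t n hn hd, fun _ => hppo, fun a v hact => ?_⟩
      simp only at hact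
      rw [hact] at hd
      exact hd.elim
    · exact H.ok α y δ he

open Classical in
/-- A new instance is executed, or issued if it is a store or fence. -/
theorem Hist.instr (H : Hist P inst σ h c) (t : Thread) {A B : Act Dom} {q : Label × (Reg → Dom)}
    (hstep : LocalStep (P t) (σ t (c t)) A q)
    (hB : (A.Delayable ∧ B = .isu) ∨ (¬ A.Delayable ∧ B = A))
    (hppo : ¬ A.Delayable → ∀ k < c t, ¬ (inst t k).MayReorder A → ⟨t, k, inst t k⟩ ∈ h)
    (hval : ∀ a v, A = .ld a v →
      (∃ k < c t, inst t k = .st a v ∧ ⟨t, k, inst t k⟩ ∉ h ∧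
        ∀ j < c t, (∃ u, inst t j = .st a u) → ⟨t, j, inst t j⟩ ∉ h → j ≤ k) ∨
      ((∀ j < c t, (∃ u, inst t j = .st a u) → ⟨t, j, inst t j⟩ ∈ h) ∧ v = memAfter h a)) :
    ∃ inst' σ', Hist P inst' σ' (h ++ [⟨t, c t, B⟩]) (Function.update c t (c t + 1)) ∧
      (∀ t', ∀ n < c t', inst' t' n = inst t' n) ∧ (∀ t', ∀ n ≤ c t', σ' t' n = σ t' n) ∧
      inst' t (c t) = A ∧ σ' t (c t + 1) = q := by
  have hi : ∀ t', ∀ n < c t',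
      Function.update inst t (Function.update (inst t) (c t) A) t' n = inst t' n := by
    intro t' n hn
    by_cases ht : t' = t
    · subst ht; simp [hn.ne]
    · simp [ht]
  have hs : ∀ t', ∀ n ≤ c t',
      Function.update σ t (Function.update (σ t) (c t + 1) q) t' n = σ t' n := by
    intro t' n hn
    by_cases ht : t' = t
    · subst ht
      have : n ≠ c t' + 1 := by omega
      simp [this]
    · simp [ht]
  have hiA : Function.update inst t (Function.update (inst t) (c t) A) t (c t) = A := by simp
  have hsq : Function.update σ t (Function.update (σ t) (c t + 1) q) t (c t + 1) = q := by simp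
  refine ⟨_, _, ?_, hi, hs, hiA, hsq⟩
  generalize Function.update inst t (Function.update (inst t) (c t) A) = inst' at hi hiA
  generalize Function.update σ t (Function.update (σ t) (c t + 1) q) = σ' at hs hsq
  have hc : ∀ t', ∀ n < Function.update c t (c t + 1) t', n < c t' ∨ (t' = t ∧ n = c t) := by
    intro t' n hn
    by_cases ht : t' = t
    · subst ht
      rw [Function.update_self] at hn
      by_cases h1 : n = c t'
      · exact Or.inr ⟨rfl, h1⟩
      · left; omega
    · rw [Function.update_of_ne ht] at hn
      exact Or.inl hn
  have hc' : ∀ t', c t' ≤ Function.update c t (c t + 1) t' := by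
    intro t'
    by_cases ht : t' = t
    · subst ht; rw [Function.update_self]; omega
    · rw [Function.update_of_ne ht]
  refine
    { init := fun t' => (hs t' 0 (Nat.zero_le _)).trans (H.init t')
      step := ?_, mem := ?_, nodup := ?_, exec := ?_, isu := ?_, ok := ?_ }
  · intro t' n hn
    rcases hc t' n hn with hn | ⟨rfl, rfl⟩
    · rw [hs t' n hn.le, hs t' (n + 1) hn, hi t' n hn]
      exact H.step t' n hn
    · rw [hs _ _ le_rfl, hiA, hsq]; exact hstep
  · intro x hx
    rw [List.mem_append, List.mem_singleton] at hx
    rcases hx with hx | rfl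
    · have := H.mem x hx
      rw [hi _ _ this.1]
      exact ⟨this.1.trans_le (hc' _), this.2⟩
    · simp only [Function.update_self, Nat.lt_succ_self, true_and, hiA]
      rcases hB with hB | hB
      · exact Or.inl ⟨hB.2, hB.1⟩
      · exact Or.inr hB.2
  · rw [List.nodup_append]
    refine ⟨H.nodup, by simp, ?_⟩
    rintro x hx y hy rfl
    rw [List.mem_singleton] at hy
    subst hy
    exact lt_irrefl _ (H.mem _ hx).1
  · intro t' n hn hd
    rcases hc t' n hn with hn | ⟨rfl, rfl⟩
    · rw [hi t' n hn] at hd ⊢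
      exact List.mem_append_left _ (H.exec t' n hn hd)
    · rw [hiA] at hd ⊢
      rcases hB with hB | hB
      · exact absurd hB.1 hd
      · simp [hB.2]
  · intro t' n hn hd
    rcases hc t' n hn with hn | ⟨rfl, rfl⟩
    · rw [hi t' n hn] at hd
      exact List.mem_append_left _ (H.isu t' n hn hd)
    · rw [hiA] at hd
      rcases hB with hB | hB
      · simp [hB.2]
      · exact absurd hd hB.1
  · intro α y β he
    rcases concat_eq_append_cons he with ⟨rfl, rfl⟩ | ⟨δ, he⟩
    · refine ActionOK.congr (inst := inst) ?_ (fun k hk => hi t k hk)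
      refine ⟨fun _ => ⟨fun z hz ht => (H.mem z hz).1.trans_eq (congrArg c ht), fun k hk hd => H.isu t k hk hd⟩,
        ?_, ?_, ?_⟩
      · intro hd
        rcases hB with ⟨-, rfl⟩ | ⟨h1, rfl⟩
        · exact hd.elim
        · exact absurd hd h1
      · intro hne
        rcases hB with ⟨-, rfl⟩ | ⟨h1, rfl⟩
        · exact absurd rfl hne
        · exact hppo h1
      · intro a v hact
        rcases hB with ⟨-, rfl⟩ | ⟨h1, rfl⟩
        · cases hact
        · exact hval a v hact
    · exact (H.ok α y δ he).congr fun k hk => hi _ k (hk.trans (H.mem y (by simp [he])).1)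

end Hist

/-! ### Contents of the buffers -/

/-- The instance that an entry belongs to. -/
def Entry.node : Entry Dom → ℕ
  | .st n _ _ => n
  | .fence n _ => n

/-- The action of an entry. -/
def Entry.act : Entry Dom → Act Dom
  | .st _ a v => .st a v
  | .fence _ as => .fence as

/-- The buffers `b` and `ab` of a thread contain the stores and fences among its first `c` instances
that are not executed yet, in an admissible order. -/
structure BufInv (I : ℕ → Act Dom) (ex : ℕ → Prop) (c : ℕ) (b : Dom → List (ℕ × Dom))
    (ab : List (Entry Dom)) : Prop where
  buf : ∀ a p, p ∈ b a → p.1 < c ∧ I p.1 = .st a p.2 ∧ ¬ ex p.1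
  abuf : ∀ e ∈ ab, e.node < c ∧ I e.node = e.act ∧ ¬ ex e.node
  pending : ∀ n < c, (I n).Delayable → ¬ ex n →
    (∃ a v, I n = .st a v ∧ (n, v) ∈ b a) ∨ ∃ e ∈ ab, e.node = n
  sorted : ∀ a, (b a).Pairwise fun p q => p.1 < q.1
  -- The entry `e` leaves before `f`, so if `f` is older in program order, this must be a permitted
  -- reordering. The field `cross` says the same about per-address entries, which can only enter
  -- `ab` behind its present content.
  order : ab.Pairwise fun e f => e.node ≠ f.node ∧ (f.node < e.node → f.act.MayReorder e.act)
  cross : ∀ a, ∀ p ∈ b a, ∀ e ∈ ab, p.1 ≠ e.node ∧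
    (p.1 < e.node → (Act.st a p.2).MayReorder e.act)

section BufInv

variable {I I' : ℕ → Act Dom} {ex ex' : ℕ → Prop} {c : ℕ} {b : Dom → List (ℕ × Dom)}
  {ab : List (Entry Dom)}

theorem BufInv.congr (H : BufInv I ex c b ab) (hI : ∀ n < c, I' n = I n)
    (hex : ∀ n < c, (ex' n ↔ ex n)) : BufInv I' ex' c b ab where
  buf a p hp := by
    obtain ⟨h1, h2, h3⟩ := H.buf a p hp
    exact ⟨h1, (hI _ h1).trans h2, fun h => h3 ((hex _ h1).1 h)⟩
  abuf e he := by
    obtain ⟨h1, h2, h3⟩ := H.abuf e he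
    exact ⟨h1, (hI _ h1).trans h2, fun h => h3 ((hex _ h1).1 h)⟩
  pending n hn hd hx := by
    rw [hI n hn] at hd ⊢
    rw [hex n hn] at hx
    exact H.pending n hn hd hx
  sorted := H.sorted
  order := H.order
  cross := H.cross

/-- The next instance is executed immediately. -/
theorem BufInv.succ (H : BufInv I ex c b ab) (hc : ¬ (I c).Delayable) :
    BufInv I ex (c + 1) b ab where
  buf a p hp := by
    obtain ⟨h1, h2⟩ := H.buf a p hp
    exact ⟨by omega, h2⟩
  abuf e he := by
    obtain ⟨h1, h2⟩ := H.abuf e he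
    exact ⟨by omega, h2⟩
  pending n hn hd hx := by
    have hne : n ≠ c := by rintro rfl; exact hc hd
    exact H.pending n (by omega) hd hx
  sorted := H.sorted
  order := H.order
  cross := H.cross

open Classical in
theorem BufInv.issueStore (H : BufInv I ex c b ab) {a v : Dom} (hc : I c = .st a v)
    (hx : ¬ ex c) : BufInv I ex (c + 1) (Function.update b a (b a ++ [(c, v)])) ab := by
  have hmem : ∀ a' p, p ∈ Function.update b a (b a ++ [(c, v)]) a' →
      p ∈ b a' ∨ (a' = a ∧ p = (c, v)) := by
    intro a' p hp
    by_cases ha : a' = a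
    · subst ha
      rw [Function.update_self, List.mem_append, List.mem_singleton] at hp
      exact hp.imp_right fun h => ⟨rfl, h⟩
    · rw [Function.update_of_ne ha] at hp
      exact Or.inl hp
  refine ⟨?_, ?_, ?_, ?_, H.order, ?_⟩
  · intro a' p hp
    rcases hmem a' p hp with hp | ⟨rfl, rfl⟩
    · obtain ⟨h1, h2⟩ := H.buf a' p hp
      exact ⟨by omega, h2⟩
    · exact ⟨by simp, hc, hx⟩
  · intro e he
    obtain ⟨h1, h2⟩ := H.abuf e he
    exact ⟨by omega, h2⟩
  · intro n hn hd hnx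
    by_cases h1 : n = c
    · subst h1
      exact Or.inl ⟨a, v, hc, by simp⟩
    · rcases H.pending n (by omega) hd hnx with ⟨a', v', h2, h3⟩ | h'
      · refine Or.inl ⟨a', v', h2, ?_⟩
        by_cases ha : a' = a
        · subst ha; rw [Function.update_self]; exact List.mem_append_left _ h3
        · rwa [Function.update_of_ne ha]
      · exact Or.inr h'
  · intro a'
    by_cases ha : a' = a
    · subst ha
      rw [Function.update_self, List.pairwise_append]
      refine ⟨H.sorted _, List.pairwise_singleton _ _, ?_⟩
      intro p hp q hq
      rw [List.mem_singleton] at hq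
      subst hq
      exact (H.buf _ p hp).1
    · rw [Function.update_of_ne ha]; exact H.sorted a'
  · intro a' p hp e he
    rcases hmem a' p hp with hp | ⟨rfl, rfl⟩
    · exact H.cross a' p hp e he
    · have := (H.abuf e he).1
      simp only
      exact ⟨by omega, fun h => by omega⟩

theorem BufInv.issueFence (H : BufInv I ex c b ab) {as : List Dom} (hc : I c = .fence as)
    (hx : ¬ ex c) (hb : ∀ a ∈ as, b a = []) :
    BufInv I ex (c + 1) b (ab ++ [.fence c as]) := by
  refine ⟨?_, ?_, ?_, H.sorted, ?_, ?_⟩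
  · intro a' p hp
    obtain ⟨h1, h2⟩ := H.buf a' p hp
    exact ⟨by omega, h2⟩
  · intro e he
    rw [List.mem_append, List.mem_singleton] at he
    rcases he with he | rfl
    · obtain ⟨h1, h2⟩ := H.abuf e he
      exact ⟨by omega, h2⟩
    · exact ⟨by simp [Entry.node], hc, hx⟩
  · intro n hn hd hnx
    by_cases h1 : n = c
    · subst h1
      exact Or.inr ⟨_, List.mem_append_right _ (List.mem_singleton_self _), rfl⟩
    · rcases H.pending n (by omega) hd hnx with h' | ⟨e, he, h'⟩
      · exact Or.inl h'
      · exact Or.inr ⟨e, by simp [he], h'⟩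
  · rw [List.pairwise_append]
    refine ⟨H.order, List.pairwise_singleton _ _, ?_⟩
    intro e he f hf
    rw [List.mem_singleton] at hf
    subst hf
    have := (H.abuf e he).1
    have hn : (Entry.fence c as).node = c := rfl
    rw [hn]
    exact ⟨by omega, fun h => by omega⟩
  · intro a p hp e he
    rw [List.mem_append, List.mem_singleton] at he
    rcases he with he | rfl
    · exact H.cross a p hp e he
    · have := (H.buf a p hp).1
      refine ⟨by simp only [Entry.node]; omega, fun _ ha => ?_⟩
      rw [hb a ha] at hp
      simp at hp

open Classical in
-- For the store that moves, `cross` turns into `order`. The stores that stay behind are younger or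
-- have a different address, which gives the new instances of `cross`.
theorem BufInv.advance (H : BufInv I ex c b ab) {a v : Dom} {n : ℕ} {l : List (ℕ × Dom)}
    (hb : b a = (n, v) :: l) :
    BufInv I ex c (Function.update b a l) (ab ++ [.st n a v]) := by
  have hsub : ∀ a' p, p ∈ Function.update b a l a' → p ∈ b a' ∧ (a' = a → n < p.1) := by
    intro a' p hp
    by_cases ha : a' = a
    · subst ha
      rw [Function.update_self] at hp
      have := H.sorted a'
      rw [hb, List.pairwise_cons] at this
      exact ⟨by simp [hb, hp], fun _ => this.1 p hp⟩
    · rw [Function.update_of_ne ha] at hp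
      exact ⟨hp, fun h => absurd h ha⟩
  have hn : (n, v) ∈ b a := by simp [hb]
  refine ⟨fun a' p hp => H.buf a' p (hsub a' p hp).1, ?_, ?_, ?_, ?_, ?_⟩
  · intro e he
    rw [List.mem_append, List.mem_singleton] at he
    rcases he with he | rfl
    · exact H.abuf e he
    · exact H.buf a _ hn
  · intro k hk hd hnx
    rcases H.pending k hk hd hnx with ⟨a', v', h1, h2⟩ | ⟨e, he, h'⟩
    · by_cases ha : a' = a
      · subst ha
        rw [hb, List.mem_cons] at h2
        rcases h2 with h2 | h2
        · cases h2
          exact Or.inr ⟨_, List.mem_append_right _ (List.mem_singleton_self _), rfl⟩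
        · exact Or.inl ⟨a', v', h1, by rwa [Function.update_self]⟩
      · exact Or.inl ⟨a', v', h1, by rwa [Function.update_of_ne ha]⟩
    · exact Or.inr ⟨e, List.mem_append_left _ he, h'⟩
  · intro a'
    by_cases ha : a' = a
    · subst ha
      rw [Function.update_self]
      have := H.sorted a'
      rw [hb, List.pairwise_cons] at this
      exact this.2
    · rw [Function.update_of_ne ha]; exact H.sorted a'
  · rw [List.pairwise_append]
    refine ⟨H.order, List.pairwise_singleton _ _, ?_⟩
    intro e he f hf
    rw [List.mem_singleton] at hf
    subst hf
    obtain ⟨h1, h2⟩ := H.cross a _ hn e he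
    exact ⟨Ne.symm h1, h2⟩
  · intro a' p hp e he
    obtain ⟨hp1, hp2⟩ := hsub a' p hp
    rw [List.mem_append, List.mem_singleton] at he
    rcases he with he | rfl
    · exact H.cross a' p hp1 e he
    · by_cases ha : a' = a
      · have := hp2 ha
        simp only [Entry.node]
        exact ⟨by omega, fun h => by omega⟩
      · refine ⟨?_, fun _ => ha⟩
        simp only [Entry.node]
        intro hpn
        have h1 := (H.buf a' p hp1).2.1
        have h2 := (H.buf a _ hn).2.1
        rw [hpn] at h1
        simp only at h2
        rw [h1] at h2
        cases h2
        exact ha rfl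

theorem BufInv.execute {e : Entry Dom} (H : BufInv I ex c b (e :: ab))
    (hex : ∀ n < c, (ex' n ↔ ex n ∨ n = e.node)) : BufInv I ex' c b ab := by
  have ho := H.order
  rw [List.pairwise_cons] at ho
  refine ⟨?_, ?_, ?_, H.sorted, ho.2, fun a p hp f hf => H.cross a p hp f (by simp [hf])⟩
  · intro a p hp
    obtain ⟨h1, h2, h3⟩ := H.buf a p hp
    refine ⟨h1, h2, ?_⟩
    rw [hex _ h1]
    rintro (h | h)
    · exact h3 h
    · exact (H.cross a p hp e (by simp)).1 h
  · intro f hf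
    obtain ⟨h1, h2, h3⟩ := H.abuf f (by simp [hf])
    refine ⟨h1, h2, ?_⟩
    rw [hex _ h1]
    rintro (h | h)
    · exact h3 h
    · exact (ho.1 f hf).1 h.symm
  · intro n hn hd hx
    rw [hex n hn, not_or] at hx
    rcases H.pending n hn hd hx.1 with h' | ⟨f, hf, h'⟩
    · exact Or.inl h'
    · rw [List.mem_cons] at hf
      rcases hf with rfl | hf
      · exact absurd h'.symm hx.2
      · exact Or.inr ⟨f, hf, h'⟩

/-- The oldest entry of the all-addresses buffer may be executed. -/
theorem BufInv.executed_of_head {e : Entry Dom} (H : BufInv I ex c b (e :: ab)) {k : ℕ}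
    (hk : k < e.node) (hd : (I k).Delayable) (hr : ¬ (I k).MayReorder e.act) : ex k := by
  by_contra hx
  have hc := (H.abuf e (by simp)).1
  have ho := H.order
  rw [List.pairwise_cons] at ho
  -- An instance that is older than `e` and still buffered stands behind `e`, so `cross` or `order`
  -- would permit the reordering.
  rcases H.pending k (by omega) hd hx with ⟨a, v, h1, h2⟩ | ⟨f, hf, rfl⟩
  · exact hr (h1 ▸ (H.cross a _ h2 e (by simp)).2 hk)
  · have hf' := (H.abuf f hf).2.1
    rw [List.mem_cons] at hf
    rcases hf with rfl | hf
    · exact lt_irrefl _ hk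
    · exact hr (hf' ▸ (ho.1 f hf).2 hk)

end BufInv

end StoreAtomic

/-! ### The invariant along runs -/

namespace StoreAtomic

open Relation

variable {Dom Thread Reg Label : Type*}

section Run

variable [Zero Dom] {P : Program Dom Thread Reg Label}

/-- The invariant of runs: `h` is a possible history of state `s`. -/
def RunInv (P : Program Dom Thread Reg Label) (h : List (Action Dom Thread))
    (s : State Dom Thread Reg Label) : Prop :=
  ∃ inst σ, Hist P inst σ h s.cnt ∧ (∀ t, σ t (s.cnt t) = (s.pc t, s.reg t)) ∧
    s.mem = memAfter h ∧
    ∀ t, BufInv (inst t) (fun n => ⟨t, n, inst t n⟩ ∈ h) (s.cnt t) (s.buf t) (s.abuf t)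

theorem runInv_initial : RunInv P [] (State.initial P) := by
  refine ⟨fun _ _ => .loc, fun t _ => ((P t).init, fun _ => 0), ?_, fun _ => rfl, rfl, fun t => ?_⟩
  · refine ⟨fun _ => rfl, ?_, by simp, by simp, ?_, ?_, by simp⟩ <;> intro t n hn <;>
      exact absurd hn (Nat.not_lt_zero n)
  · refine ⟨by simp [State.initial], by simp [State.initial], ?_, by simp [State.initial],
      by simp [State.initial], by simp [State.initial]⟩
    intro n hn
    exact absurd hn (Nat.not_lt_zero n)

/-- Instructions other than stores and fences are executed immediately. -/
theorem RunInv.instr {h : List (Action Dom Thread)} {s s' : State Dom Thread Reg Label}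
    (H : RunInv P h s) (t : Thread) {A : Act Dom} (hA : ¬ A.Delayable)
    (hstep : LocalStep (P t) (s.pc t, s.reg t) A (s'.pc t, s'.reg t))
    (hother : ∀ t', t' ≠ t → s'.pc t' = s.pc t' ∧ s'.reg t' = s.reg t' ∧ s'.cnt t' = s.cnt t')
    (hcnt : s'.cnt t = s.cnt t + 1) (hmem : s'.mem = s.mem) (hbuf : s'.buf = s.buf)
    (habuf : s'.abuf = s.abuf)
    (hre : (∀ B : Act Dom, B.Delayable → B.MayReorder A) ∨ (s.abuf t = [] ∧ ∀ a, s.buf t a = []))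
    (hval : ∀ a v, A = .ld a v → (∃ b n, s.buf t a = b ++ [(n, v)]) ∨
      (s.buf t a = [] ∧ ∃ b n c, s.abuf t = b ++ Entry.st n a v :: c ∧
        ∀ x ∈ c, ¬ x.IsStoreTo a) ∨
      (s.buf t a = [] ∧ (∀ x ∈ s.abuf t, ¬ x.IsStoreTo a) ∧ v = s.mem a)) :
    RunInv P (h ++ [⟨t, s.cnt t, A⟩]) s' := by
  classical
  obtain ⟨inst, σ, hH, hσ, hm, hb⟩ := H
  have hB := hb t
  obtain ⟨inst', σ', hH', hi, hs, hiA, hsq⟩ := hH.instr t (A := A) (B := A)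
    (q := (s'.pc t, s'.reg t)) (by rw [hσ]; exact hstep) (Or.inr ⟨hA, rfl⟩) (by
      intro _ k hk hr
      by_contra hn
      by_cases hd : (inst t k).Delayable
      · rcases hre with hre | ⟨h1, h2⟩
        · exact hr (hre _ hd)
        · rcases hB.pending k hk hd hn with ⟨a, v, -, h3⟩ | ⟨e, he, -⟩
          · simp [h2] at h3
          · simp [h1] at he
      · exact hn (hH.exec t k hk hd)) (by
      intro a v hact
      rcases hval a v hact with ⟨b, n, h1⟩ | ⟨h1, b, n, c, h2, h3⟩ | ⟨h1, h2, h3⟩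
      · obtain ⟨h2, h3, h4⟩ := hB.buf a (n, v) (by simp [h1])
        refine Or.inl ⟨n, h2, h3, h4, ?_⟩
        rintro j hj ⟨u, hu⟩ hjn
        rcases hB.pending j hj (by rw [hu]; trivial) hjn with ⟨a', v', h5, h6⟩ | ⟨e, he, h6⟩
        · rw [hu] at h5; cases h5
          have hsort := hB.sorted a
          rw [h1, List.pairwise_append] at hsort
          rw [h1, List.mem_append, List.mem_singleton] at h6
          rcases h6 with h6 | h6
          · exact (hsort.2.2 _ h6 _ (List.mem_singleton_self _)).le
          · cases h6; exact le_rfl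
        -- A younger store to the same address cannot already be in the all-addresses buffer,
        -- because `cross` would let two stores to one address be reordered.
        · by_contra hlt
          have h7 := (hB.cross a (n, v) (by simp [h1]) e he).2 (by simp only; omega)
          have h8 := (hB.abuf e he).2.1
          rw [h6, hu] at h8
          rw [← h8] at h7
          exact h7 rfl
      · have hmem : Entry.st n a v ∈ s.abuf t := by simp [h2]
        obtain ⟨h4, h5, h6⟩ := hB.abuf _ hmem
        refine Or.inl ⟨n, h4, h5, h6, ?_⟩
        rintro j hj ⟨u, hu⟩ hjn
        rcases hB.pending j hj (by rw [hu]; trivial) hjn with ⟨a', v', h7, h8⟩ | ⟨e, he, rfl⟩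
        · rw [hu] at h7; cases h7
          simp [h1] at h8
        · by_contra hlt
          have hord := hB.order
          have hea := (hB.abuf e he).2.1
          rw [hu] at hea
          rw [h2, List.pairwise_append, List.pairwise_cons] at hord
          rw [h2, List.mem_append, List.mem_cons] at he
          -- Stores to the address in front of the entry that is read are older, by `order`; behind
          -- it there are none.
          rcases he with he | rfl | he
          · have := (hord.2.2 e he _ List.mem_cons_self).2 (not_le.1 hlt)
            rw [← hea] at this
            exact this rfl
          · exact hlt le_rfl
          · refine h3 e he ?_
            cases e with
            | st n' a' v' => cases hea; exact ⟨_, _, rfl⟩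
            | fence => cases hea
      · refine Or.inr ⟨?_, by rw [h3, hm]⟩
        rintro j hj ⟨u, hu⟩
        by_contra hjn
        rcases hB.pending j hj (by rw [hu]; trivial) hjn with ⟨a', v', h7, h8⟩ | ⟨e, he, rfl⟩
        · rw [hu] at h7; cases h7
          simp [h1] at h8
        · have hea := (hB.abuf e he).2.1
          rw [hu] at hea
          refine h2 e he ?_
          cases e with
          | st n' a' v' => cases hea; exact ⟨_, _, rfl⟩
          | fence => cases hea)
  have hcnt' : s'.cnt = Function.update s.cnt t (s.cnt t + 1) := by
    funext t'
    by_cases ht : t' = t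
    · subst ht; rw [Function.update_self, hcnt]
    · rw [Function.update_of_ne ht, (hother t' ht).2.2]
  refine ⟨inst', σ', hcnt' ▸ hH', ?_, ?_, ?_⟩
  · intro t'
    by_cases ht : t' = t
    · subst ht; rw [hcnt, hsq]
    · obtain ⟨h1, h2, h3⟩ := hother t' ht
      rw [h1, h2, h3, hs t' _ le_rfl, hσ]
  · rw [hmem, hm, memAfter_concat]
    rintro a v rfl
    exact hA trivial
  · intro t'
    rw [hbuf, habuf]
    have hcongr : BufInv (inst' t') (fun n => ⟨t', n, inst' t' n⟩ ∈ h ++ [⟨t, s.cnt t, A⟩])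
        (s.cnt t') (s.buf t') (s.abuf t') := by
      refine (hb t').congr (hi t') fun n hn => ?_
      rw [hi t' n hn, List.mem_append, List.mem_singleton, or_iff_left]
      intro he
      cases he
      exact lt_irrefl _ hn
    by_cases ht : t' = t
    · subst ht
      rw [hcnt]
      exact hcongr.succ (by rw [hiA]; exact hA)
    · rw [(hother t' ht).2.2]; exact hcongr

/-- Stores and fences are issued. -/
theorem RunInv.issue {h : List (Action Dom Thread)} {s s' : State Dom Thread Reg Label}
    (H : RunInv P h s) (t : Thread) {A : Act Dom} (hA : A.Delayable)
    (hstep : LocalStep (P t) (s.pc t, s.reg t) A (s'.pc t, s'.reg t))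
    (hother : ∀ t', t' ≠ t → s'.pc t' = s.pc t' ∧ s'.reg t' = s.reg t' ∧ s'.cnt t' = s.cnt t' ∧
      s'.buf t' = s.buf t' ∧ s'.abuf t' = s.abuf t')
    (hcnt : s'.cnt t = s.cnt t + 1) (hmem : s'.mem = s.mem)
    (hbuf : ∀ I ex, BufInv I ex (s.cnt t) (s.buf t) (s.abuf t) → I (s.cnt t) = A →
      ¬ ex (s.cnt t) → BufInv I ex (s.cnt t + 1) (s'.buf t) (s'.abuf t)) :
    RunInv P (h ++ [⟨t, s.cnt t, .isu⟩]) s' := by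
  classical
  obtain ⟨inst, σ, hH, hσ, hm, hb⟩ := H
  obtain ⟨inst', σ', hH', hi, hs, hiA, hsq⟩ := hH.instr t (A := A) (B := .isu)
    (q := (s'.pc t, s'.reg t)) (by rw [hσ]; exact hstep) (Or.inl ⟨hA, rfl⟩)
    (fun h' => absurd hA h') (by rintro a v rfl; exact hA.elim)
  have hcnt' : s'.cnt = Function.update s.cnt t (s.cnt t + 1) := by
    funext t'
    by_cases ht : t' = t
    · subst ht; rw [Function.update_self, hcnt]
    · rw [Function.update_of_ne ht, (hother t' ht).2.2.1]
  refine ⟨inst', σ', hcnt' ▸ hH', ?_, ?_, ?_⟩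
  · intro t'
    by_cases ht : t' = t
    · subst ht; rw [hcnt, hsq]
    · obtain ⟨h1, h2, h3, -⟩ := hother t' ht
      rw [h1, h2, h3, hs t' _ le_rfl, hσ]
  · rw [hmem, hm, memAfter_concat]
    rintro a v hc
    cases hc
  · intro t'
    have hcongr : BufInv (inst' t') (fun n => ⟨t', n, inst' t' n⟩ ∈ h ++ [⟨t, s.cnt t, .isu⟩])
        (s.cnt t') (s.buf t') (s.abuf t') := by
      refine (hb t').congr (hi t') fun n hn => ?_
      rw [hi t' n hn, List.mem_append, List.mem_singleton, or_iff_left]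
      exact fun he => hH.ne_isu hn (congrArg Action.act he)
    by_cases ht : t' = t
    · subst ht
      rw [hcnt]
      refine hbuf _ _ hcongr hiA ?_
      rw [hiA, List.mem_append, List.mem_singleton]
      rintro (h' | h')
      · exact lt_irrefl _ (hH.mem _ h').1
      · exact hstep.ne_isu (congrArg Action.act h')
    · obtain ⟨-, -, h3, h4, h5⟩ := hother t' ht
      rw [h3, h4, h5]; exact hcongr

/-- The oldest entry of an all-addresses buffer is executed. -/
theorem RunInv.execute {h : List (Action Dom Thread)} {s s' : State Dom Thread Reg Label}
    (H : RunInv P h s) (t : Thread) {e : Entry Dom} (he : s.abuf t = e :: s'.abuf t)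
    (hother : ∀ t', t' ≠ t → s'.abuf t' = s.abuf t')
    (hpc : s'.pc = s.pc) (hreg : s'.reg = s.reg) (hcnt : s'.cnt = s.cnt) (hbuf : s'.buf = s.buf)
    (hmem : s.mem = memAfter h → s'.mem = memAfter (h ++ [⟨t, e.node, e.act⟩])) :
    RunInv P (h ++ [⟨t, e.node, e.act⟩]) s' := by
  obtain ⟨inst, σ, hH, hσ, hm, hb⟩ := H
  have hB := hb t
  rw [he] at hB
  obtain ⟨h1, h2, h3⟩ := hB.abuf e List.mem_cons_self
  have hd : (inst t e.node).Delayable := by rw [h2]; cases e <;> trivial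
  have hH' := hH.execute h1 hd h3 fun k hk hr => by
    by_cases hdk : (inst t k).Delayable
    · exact hB.executed_of_head hk hdk (h2 ▸ hr)
    · exact hH.exec t k (hk.trans h1) hdk
  rw [h2] at hH'
  refine ⟨inst, σ, hcnt ▸ hH', ?_, hmem hm, ?_⟩
  · rw [hpc, hreg, hcnt]; exact hσ
  · intro t'
    rw [hcnt, hbuf]
    by_cases ht : t' = t
    · subst ht
      refine hB.execute fun n hn => ?_
      rw [List.mem_append, List.mem_singleton]
      refine or_congr_right ⟨congrArg Action.node, ?_⟩
      rintro rfl
      rw [h2]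
    · rw [hother t' ht]
      refine (hb t').congr (fun _ _ => rfl) fun n hn => ?_
      rw [List.mem_append, List.mem_singleton, or_iff_left]
      exact fun hc => ht (congrArg Action.thread hc)

theorem RunInv.step {h : List (Action Dom Thread)} {s s' : State Dom Thread Reg Label}
    {o : Option (Action Dom Thread)} (H : RunInv P h s) (hs : Step P s o s') :
    RunInv P (h ++ o.toList) s' := by
  classical
  have hld : ∀ a v, ∀ B : Act Dom, B.Delayable → B.MayReorder (.ld a v) := by
    intro a v B hB; cases B <;> simp_all [Act.Delayable, Act.MayReorder]
  have hloc : ∀ B : Act Dom, B.Delayable → B.MayReorder .loc := by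
    intro B hB; cases B <;> simp_all [Act.Delayable, Act.MayReorder]
  cases hs with
  | earlyRead₁ t r e l b n v hi hb =>
    refine H.instr t (by simp [Act.Delayable]) ?_ ?_ ?_ rfl rfl rfl (Or.inl (hld _ _)) ?_
    · simpa [State.goto, State.setReg] using LocalStep.load _ _ r e l v hi
    · intro t' ht; simp [State.goto, State.setReg, ht]
    · simp [State.goto, State.setReg]
    · intro a v' hact; cases hact; exact Or.inl ⟨b, n, hb⟩
  | earlyRead₂ t r e l b c n v hi hb ha hc =>
    refine H.instr t (by simp [Act.Delayable]) ?_ ?_ ?_ rfl rfl rfl (Or.inl (hld _ _)) ?_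
    · simpa [State.goto, State.setReg] using LocalStep.load _ _ r e l v hi
    · intro t' ht; simp [State.goto, State.setReg, ht]
    · simp [State.goto, State.setReg]
    · intro a v' hact; cases hact; exact Or.inr (Or.inl ⟨hb, b, n, c, ha, hc⟩)
  | readMemory t r e l hi hb ha =>
    refine H.instr t (by simp [Act.Delayable]) ?_ ?_ ?_ rfl rfl rfl (Or.inl (hld _ _)) ?_
    · simpa [State.goto, State.setReg] using LocalStep.load _ _ r e l _ hi
    · intro t' ht; simp [State.goto, State.setReg, ht]
    · simp [State.goto, State.setReg]
    · intro a v' hact; cases hact; exact Or.inr (Or.inr ⟨hb, ha, rfl⟩)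
  | issueStore t ea ev l hi =>
    refine H.issue t (A := .st (ea.eval (s.reg t)) (ev.eval (s.reg t))) trivial ?_ ?_ ?_ rfl ?_
    · simpa [State.goto, State.setBuf] using LocalStep.store _ _ ea ev l hi
    · intro t' ht; simp [State.goto, State.setBuf, ht]
    · simp [State.goto, State.setBuf]
    · intro I ex hB hI hx
      simpa [State.goto, State.setBuf] using hB.issueStore hI hx
  | advance t a n v b hb =>
    obtain ⟨inst, σ, hH, hσ, hm, hB⟩ := H
    refine ⟨inst, σ, (List.append_nil h).symm ▸ hH, hσ, (List.append_nil h).symm ▸ hm, fun t' => ?_⟩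
    by_cases ht : t' = t
    · subst ht
      simpa [State.setABuf, State.setBuf] using (hB t').advance hb
    · simpa [State.setABuf, State.setBuf, ht] using hB t'
  | storeToMemory t n a v b ha =>
    refine H.execute t (e := .st n a v) ?_ ?_ rfl rfl rfl rfl ?_
    · simpa [State.setABuf] using ha
    · intro t' ht; simp [State.setABuf, State.setMem, ht]
    · intro hm
      funext a'
      simp only [Entry.act, Entry.node]
      rw [memAfter_concat_store, ← hm]
      simp [State.setABuf, State.setMem, Function.update_apply]
  | scfence t l hi ha hb =>
    refine H.instr t (by simp [Act.Delayable]) ?_ ?_ ?_ rfl rfl rfl (Or.inr ⟨ha, hb⟩) ?_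
    · simpa [State.goto] using LocalStep.scfence _ _ l hi
    · intro t' ht; simp [State.goto, ht]
    · simp [State.goto]
    · intro a v' hact; cases hact
  | issueFence t es l hi hb =>
    refine H.issue t (A := .fence (es.map fun e => e.eval (s.reg t))) trivial ?_ ?_ ?_ rfl ?_
    · simpa [State.goto, State.setABuf] using LocalStep.fence _ _ es l hi
    · intro t' ht; simp [State.goto, State.setABuf, ht]
    · simp [State.goto, State.setABuf]
    · intro I ex hB hI hx
      have := hB.issueFence hI hx (by
        intro a ha
        rw [List.mem_map] at ha
        obtain ⟨e, he, rfl⟩ := ha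
        exact hb e he)
      simpa [State.goto, State.setABuf] using this
  | fence t n as b ha =>
    refine H.execute t (e := .fence n as) ?_ ?_ rfl rfl rfl rfl ?_
    · simpa [State.setABuf] using ha
    · intro t' ht; simp [State.setABuf, ht]
    · intro hm
      rw [memAfter_concat]
      · exact hm
      · intro a v hc; cases hc
  | assign t r e l hi =>
    refine H.instr t (by simp [Act.Delayable]) ?_ ?_ ?_ rfl rfl rfl (Or.inl hloc) ?_
    · simpa [State.goto, State.setReg] using LocalStep.assign _ _ r e l hi
    · intro t' ht; simp [State.goto, State.setReg, ht]
    · simp [State.goto, State.setReg]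
    · intro a v' hact; cases hact
  | assertion t e l hi he =>
    refine H.instr t (by simp [Act.Delayable]) ?_ ?_ ?_ rfl rfl rfl (Or.inl hloc) ?_
    · simpa [State.goto] using LocalStep.assertion _ _ e l hi he
    · intro t' ht; simp [State.goto, ht]
    · simp [State.goto]
    · intro a v' hact; cases hact

theorem RunInv.run {h τ : List (Action Dom Thread)} {s s' : State Dom Thread Reg Label}
    (H : RunInv P h s) (hr : Run P s τ s') : RunInv P (h ++ τ) s' := by
  induction hr generalizing h with
  | nil => simpa using H
  | cons hs _ ih => rw [← List.append_assoc]; exact ih (H.step hs)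

end Run

end StoreAtomic

namespace StoreAtomic

open Relation

variable {Dom Thread Reg Label : Type*}

/-! ### From computations to abstract executions -/

theorem nodes_finite (τ : List (Action Dom Thread)) : (nodes τ).Finite :=
  (List.finite_toSet τ).subset fun _ hx => hx.1

/-- The computation `τ` realizes the abstract execution given by its nodes and their order. -/
structure Realizes [Zero Dom] (P : Program Dom Thread Reg Label) (τ : List (Action Dom Thread))
    (σ : Thread → ℕ → Label × (Reg → Dom)) : Prop where
  valid : Valid P σ (nodes τ) (Before τ)
  nodup : τ.Nodup
  source : ∀ x y, source τ x y ↔ IsSrc (nodes τ) (Before τ) x y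
  issue_lt : ∀ x ∈ nodes τ, x.act.Delayable → Before τ x.issue x
  issue_lt_of_po : ∀ x ∈ nodes τ, ∀ y ∈ nodes τ, x.PO y → x.act.Delayable → Before τ x.issue y
  node_of_isu : ∀ t n, ⟨t, n, .isu⟩ ∈ τ → ∃ x ∈ nodes τ, x.thread = t ∧ x.node = n ∧ x.act.Delayable

variable [Zero Dom] {P : Program Dom Thread Reg Label} {τ : List (Action Dom Thread)}

/-- At the end of a computation the buffers are empty, so every instance has been executed and the
nodes are exactly the instances. The clauses of `Hist` then become those of `Valid`. -/
theorem exists_realizes (hτ : τ ∈ computations P) : ∃ σ, Realizes P τ σ := by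
  obtain ⟨s, hr, hs⟩ := hτ
  obtain ⟨inst, σ, hH, -, -, hb⟩ := runInv_initial.run hr
  rw [List.nil_append] at hH hb
  have hex : ∀ t, ∀ n < s.cnt t, ⟨t, n, inst t n⟩ ∈ τ := by
    intro t n hn
    by_cases hd : (inst t n).Delayable
    · by_contra hx
      rcases (hb t).pending n hn hd hx with ⟨a, v, -, h⟩ | ⟨e, h, -⟩
      · simp [(hs t).2 a] at h
      · simp [(hs t).1] at h
    · exact hH.exec t n hn hd
  have hnode : ∀ t, ∀ n < s.cnt t, (⟨t, n, inst t n⟩ : Action Dom Thread) ∈ nodes τ :=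
    fun t n hn => ⟨hex t n hn, hH.ne_isu hn⟩
  have hN : ∀ x ∈ nodes τ, x.node < s.cnt x.thread ∧ x = ⟨x.thread, x.node, inst x.thread x.node⟩ := by
    rintro ⟨t, n, A⟩ ⟨hx, hne⟩
    obtain ⟨h1, h2⟩ := hH.mem _ hx
    refine ⟨h1, ?_⟩
    rcases h2 with h2 | h2
    · exact absurd h2.1 hne
    · simp only at h2; rw [h2]
  have hact : ∀ x ∈ nodes τ, inst x.thread x.node = x.act := fun x hx =>
    (congrArg Action.act (hN x hx).2).symm
  have hself : ∀ x ∈ nodes τ, ∀ y : Action Dom Thread, x.thread = y.thread →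
      (⟨y.thread, x.node, inst y.thread x.node⟩ : Action Dom Thread) = x :=
    fun x hx y ht => by rw [← ht]; exact (hN x hx).2.symm
  have ho : StrictOn (nodes τ) (Before τ) := strictOn_before hH.nodup fun x hx => hx.1
  have hbef : ∀ {α y β}, τ = α ++ y :: β → ∀ x, Before τ x y ↔ x ∈ α := by
    rintro α y β rfl x
    exact before_iff_of_nodup hH.nodup
  have hok : ∀ y ∈ nodes τ, ∃ α β, τ = α ++ y :: β ∧ ActionOK inst α y := by
    intro y hy
    obtain ⟨α, β, h⟩ := List.append_of_mem hy.1
    exact ⟨α, β, h, hH.ok _ _ _ h⟩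
  have hppo : ∀ x ∈ nodes τ, ∀ y ∈ nodes τ, x.PO y → ¬ x.act.MayReorder y.act → Before τ x y := by
    intro x hx y hy hpo hr
    obtain ⟨α, β, h, ha⟩ := hok y hy
    rw [hbef h, ← hself x hx y hpo.1]
    refine ha.ppo hy.2 _ hpo.2 ?_
    rwa [← hpo.1, hact x hx]
  have hfifo : ∀ {a x y}, x ∈ nodes τ → y ∈ nodes τ → x.IsStoreTo a → y.IsStoreTo a → x.PO y →
      Before τ x y := by
    rintro a x y hx hy ⟨v, hv⟩ ⟨u, hu⟩ hpo
    exact hppo x hx y hy hpo (by simp [hv, hu, Act.MayReorder])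
  have hissue : ∀ x ∈ nodes τ, x.act.Delayable → Before τ x.issue x := by
    intro x hx hd
    obtain ⟨α, β, h, ha⟩ := hok x hx
    rw [hbef h]
    exact ha.issue hd
  have hmemsplit : ∀ {α y β}, τ = α ++ y :: β → ∀ x ∈ nodes τ, x ≠ y → (x ∈ β ↔ x ∉ α) := by
    rintro α y β h x hx hne
    have hn := h ▸ hH.nodup
    have hx1 := h ▸ hx.1
    rw [List.mem_append, List.mem_cons] at hx1
    refine ⟨fun hb ha => (List.nodup_append.1 hn).2.2 x ha x (by simp [hb]) rfl, fun ha => ?_⟩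
    exact (hx1.resolve_left ha).resolve_left hne
  -- The stores that are pending for a load.
  have hpend : ∀ {α y β a v}, τ = α ++ y :: β → y.act = .ld a v → ∀ x,
      Pending α β y.thread a x ↔ x ∈ nodes τ ∧ x.IsStoreTo a ∧ x.PO y ∧ x ∉ α := by
    intro α y β a v h hy x
    have hok := hH.ok _ _ _ h
    have hyd : ¬ y.act.Delayable := by simp [hy, Act.Delayable]
    constructor
    · rintro ⟨ht, hxa, hi, hxb⟩
      have hxN : x ∈ nodes τ := ⟨by simp [h, hxb], by obtain ⟨u, hu⟩ := hxa; simp [hu]⟩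
      have hne : x ≠ y := by rintro rfl; exact hxa.act_ne_ld hy
      exact ⟨hxN, hxa, ⟨ht, (hok.order hyd).1 x.issue hi ht⟩, (hmemsplit h x hxN hne).1 hxb⟩
    · rintro ⟨hxN, hxa, hpo, hn⟩
      have hne : x ≠ y := by rintro rfl; exact hxa.act_ne_ld hy
      refine ⟨hpo.1, hxa, ?_, (hmemsplit h x hxN hne).2 hn⟩
      have := (hok.order hyd).2 x.node hpo.2 (by rw [← hpo.1, hact x hxN]; exact hxa.delayable)
      rwa [← hpo.1] at this
  have hsrc_mem : ∀ {x y}, source τ x y → x ∈ nodes τ ∧ y ∈ nodes τ := by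
    rintro x y ⟨a, v, α, β, hy, h, hx⟩
    have hyN : y ∈ nodes τ := ⟨by simp [h], by simp [hy]⟩
    rcases hx with ⟨hx, -⟩ | ⟨-, γ, δ, rfl, hxa, -⟩
    · exact ⟨((hpend h hy x).1 hx).1, hyN⟩
    · exact ⟨⟨by simp [h], by obtain ⟨u, hu⟩ := hxa; simp [hu]⟩, hyN⟩
  have hsrc : ∀ {x y}, source τ x y → IsSrc (nodes τ) (Before τ) x y := by
    intro x y hxy
    obtain ⟨hxN, hyN⟩ := hsrc_mem hxy
    obtain ⟨a, v, α, β, hy, h, hx⟩ := hxy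
    rcases hx with ⟨hx, hmax⟩ | ⟨hno, γ, δ, rfl, hxa, hδ⟩
    · obtain ⟨-, hxa, hpo, hxα⟩ := (hpend h hy x).1 hx
      refine ⟨a, v, hy, hxN, hyN, hxa, Or.inr hpo, fun z hzN hza hzv => ?_⟩
      by_cases hzx : z = x
      · exact Or.inl hzx
      right
      by_cases hzα : z ∈ α
      · refine (ho.total z hzN x hxN hzx).resolve_right fun hxz => hxα ?_
        rw [← hbef h]
        exact ho.trans x hxN z hzN y hyN hxz ((hbef h z).2 hzα)
      · have hzpo : z.PO y := hzv.resolve_left fun hb => hzα ((hbef h z).1 hb)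
        have hle := hmax z ((hpend h hy z).2 ⟨hzN, hza, hzpo, hzα⟩)
        have ht := hzpo.1.trans hpo.1.symm
        refine hfifo hzN hxN hza hxa ⟨ht, lt_of_le_of_ne hle fun hn => hzx ?_⟩
        rw [(hN z hzN).2, (hN x hxN).2, ht, hn]
    · have hxy : Before τ x y := (hbef h x).2 (by simp)
      refine ⟨a, v, hy, hxN, hyN, hxa, Or.inl hxy, fun z hzN hza hzv => ?_⟩
      have hzα : z ∈ γ ++ x :: δ := by
        by_contra hzα
        have hzpo : z.PO y := hzv.resolve_left fun hb => hzα ((hbef h z).1 hb)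
        exact hno z ((hpend h hy z).2 ⟨hzN, hza, hzpo, hzα⟩)
      rw [List.mem_append, List.mem_cons] at hzα
      rcases hzα with hz | hz | hz
      · right
        rw [List.append_assoc, List.cons_append] at h
        exact (hbef h z).2 hz
      · exact Or.inl hz
      · exact absurd hza (hδ z hz)
  -- The source of a load exists unless no store is visible.
  have hsrc_ex : ∀ {y a v}, y ∈ nodes τ → y.act = .ld a v →
      (∃ x, source τ x y ∧ x.act = .st a v) ∨
        ((∀ x ∈ nodes τ, x.IsStoreTo a → ¬ Visible (Before τ) x y) ∧ v = 0) := by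
    intro y a v hyN hy
    obtain ⟨α, β, h, hok⟩ := hok y hyN
    have hyc := (hN y hyN).1
    rcases hok.val a v hy with ⟨k, hk, h1, h2, h3⟩ | ⟨h1, h2⟩
    · refine Or.inl ⟨⟨y.thread, k, inst y.thread k⟩, ⟨a, v, α, β, hy, h, Or.inl ⟨?_, ?_⟩⟩, h1⟩
      · exact (hpend h hy _).2 ⟨hnode _ _ (hk.trans hyc), ⟨v, h1⟩, ⟨rfl, hk⟩, h2⟩
      · intro z hz
        obtain ⟨hzN, ⟨u, hu⟩, hpo, hzα⟩ := (hpend h hy z).1 hz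
        refine h3 z.node hpo.2 ⟨u, ?_⟩ ?_
        · rw [← hpo.1, hact z hzN, hu]
        · rwa [hself z hzN y hpo.1]
    · have hno : ∀ z, ¬ Pending α β y.thread a z := by
        intro z hz
        obtain ⟨hzN, ⟨u, hu⟩, hpo, hzα⟩ := (hpend h hy z).1 hz
        refine hzα ?_
        rw [← hself z hzN y hpo.1]
        exact h1 z.node hpo.2 ⟨u, by rw [← hpo.1, hact z hzN, hu]⟩
      rcases memAfter_spec α a with ⟨γ, x, δ, hα, hx, hδ⟩ | ⟨h3, h4⟩
      · rw [← h2] at hx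
        exact Or.inl ⟨x, ⟨a, v, α, β, hy, h, Or.inr ⟨hno, γ, δ, hα, ⟨v, hx⟩, hδ⟩⟩, hx⟩
      · refine Or.inr ⟨fun x hxN hxa hvis => ?_, h2.trans h4⟩
        by_cases hxα : x ∈ α
        · exact h3 x hxα hxa
        · have hpo : x.PO y := hvis.resolve_left fun hb => hxα ((hbef h x).1 hb)
          exact hno x ((hpend h hy x).2 ⟨hxN, hxa, hpo, hxα⟩)
  refine ⟨σ,
    { valid :=
        { fin := nodes_finite τ, order := ho, ne_isu := fun x hx => hx.2, uniq := ?_, down := ?_,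
          init := hH.init, step := ?_, ppo := hppo, val := ?_ }
      nodup := hH.nodup, source := ?_, issue_lt := hissue, issue_lt_of_po := ?_
      node_of_isu := ?_ }⟩
  · intro x hx y hy ht hn
    rw [(hN x hx).2, (hN y hy).2, ht, hn]
  · intro x hx k hk
    exact ⟨_, hnode x.thread k (hk.trans (hN x hx).1), rfl, rfl⟩
  · intro x hx
    have := hH.step x.thread x.node (hN x hx).1
    rwa [hact x hx] at this
  · intro y hy a v hya
    exact (hsrc_ex hy hya).imp_left fun ⟨x, hx, hxv⟩ => ⟨x, hsrc hx, hxv⟩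
  · refine fun x y => ⟨hsrc, fun hxy => ?_⟩
    obtain ⟨a, v, hya, hx, hy, hxa, hvis, -⟩ := id hxy
    -- As abstract sources are unique, the converse follows from the existence of a concrete source.
    rcases hsrc_ex hy hya with ⟨x', hx', -⟩ | ⟨hno, -⟩
    · rwa [hxy.unique ho (hsrc hx')]
    · exact absurd hvis (hno x hx hxa)
  · intro x hx y hy hpo hd
    obtain ⟨α, β, h, ha⟩ := hok y hy
    by_cases hyd : y.act.Delayable
    -- An issue is itself never delayed, so the clause `order` holds for the issue of `y` and puts
    -- the issue of `x` before it.
    · have hiy : y.issue ∈ α := ha.issue hyd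
      obtain ⟨γ, δ, rfl⟩ := List.append_of_mem hiy
      have h' := h
      rw [List.append_assoc, List.cons_append] at h'
      have := ((hH.ok _ _ _ h').order (by simp [Action.issue, Act.Delayable])).2 x.node hpo.2
        (by simp only [Action.issue]; rw [← hpo.1, hact x hx]; exact hd)
      simp only [Action.issue] at this
      rw [← hpo.1] at this
      exact (hbef h _).2 (List.mem_append_left _ this)
    · have := (ha.order hyd).2 x.node hpo.2 (by rw [← hpo.1, hact x hx]; exact hd)
      rw [← hpo.1] at this
      exact (hbef h _).2 this
  · intro t n hi
    obtain ⟨h1, h2⟩ := hH.mem _ hi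
    rcases h2 with h2 | h2
    · exact ⟨_, hnode t n h1, rfl, rfl, h2.2⟩
    · exact absurd h2.symm (hH.ne_isu h1)

end StoreAtomic

namespace StoreAtomic

open Relation

/-! ### Sublists given by a property -/

section Sel

variable {α : Type*}

open Classical in
/-- The elements of a list with a given property. -/
noncomputable def sel (p : α → Prop) (L : List α) : List α := L.filter fun x => decide (p x)

theorem mem_sel {p : α → Prop} {L : List α} {x : α} : x ∈ sel p L ↔ x ∈ L ∧ p x := by
  simp [sel]

theorem sel_cons_pos {p : α → Prop} {L : List α} {x : α} (h : p x) :
    sel p (x :: L) = x :: sel p L := by simp [sel, h]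

theorem sel_cons_neg {p : α → Prop} {L : List α} {x : α} (h : ¬ p x) :
    sel p (x :: L) = sel p L := by simp [sel, h]

theorem sel_congr {p q : α → Prop} {L : List α} (h : ∀ x ∈ L, p x ↔ q x) : sel p L = sel q L := by
  unfold sel
  exact List.filter_congr fun x hx => by simp [h x hx]

theorem sel_eq_nil {p : α → Prop} {L : List α} (h : ∀ x ∈ L, ¬ p x) : sel p L = [] := by
  simpa [sel, List.filter_eq_nil_iff] using h

theorem sel_append {p : α → Prop} {L L' : List α} : sel p (L ++ L') = sel p L ++ sel p L' := by
  simp [sel]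

theorem sel_sublist {p : α → Prop} {L : List α} : (sel p L).Sublist L := List.filter_sublist

variable {N : Set α} {lt : α → α → Prop} {L : List α} {p q : α → Prop} {y : α}

theorem sel_split (ho : StrictOn N lt) (hN : ∀ x ∈ L, x ∈ N) (hL : L.Pairwise lt) (hy : y ∈ L) :
    ∃ l₁ l₂, L = l₁ ++ y :: l₂ ∧ (∀ z ∈ l₁, z ≠ y ∧ ¬ lt y z) ∧ ∀ z ∈ l₂, z ≠ y ∧ ¬ lt z y := by
  obtain ⟨l₁, l₂, rfl⟩ := List.append_of_mem hy
  rw [List.pairwise_append, List.pairwise_cons] at hL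
  refine ⟨l₁, l₂, rfl, fun z hz => ?_, fun z hz => ?_⟩
  · have h1 := hL.2.2 z hz y List.mem_cons_self
    have hzN := hN z (by simp [hz])
    exact ⟨by rintro rfl; exact ho.irrefl _ hzN h1, ho.asymm hzN (hN y hy) h1⟩
  · have h1 := hL.2.1.1 z hz
    have hzN := hN z (by simp [hz])
    exact ⟨by rintro rfl; exact ho.irrefl _ hzN h1, ho.asymm (hN y hy) hzN h1⟩

/-- Buffers are described as selections from the sorted list of remaining nodes. This lemma is for
an oldest entry that leaves; `sel_eq_concat` is for a newest entry that enters. -/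
theorem sel_eq_cons (ho : StrictOn N lt) (hN : ∀ x ∈ L, x ∈ N) (hL : L.Pairwise lt) (hy : y ∈ L)
    (hp : ∀ z ∈ L, p z ↔ z = y ∨ q z) (hq : ∀ z ∈ L, q z → lt y z) :
    sel p L = y :: sel q L := by
  obtain ⟨l₁, l₂, rfl, h1, h2⟩ := sel_split ho hN hL hy
  have hqy : ¬ q y := fun h => ho.irrefl y (hN y hy) (hq y hy h)
  have hq1 : ∀ z ∈ l₁, ¬ q z := fun z hz h => (h1 z hz).2 (hq z (by simp [hz]) h)
  rw [sel_append, sel_append, sel_eq_nil hq1, sel_eq_nil (L := l₁), List.nil_append,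
    List.nil_append, sel_cons_neg hqy, sel_cons_pos ((hp y hy).2 (Or.inl rfl))]
  · congr 1
    refine sel_congr fun z hz => ?_
    rw [hp z (by simp [hz]), or_iff_right (h2 z hz).1]
  · intro z hz
    rw [hp z (by simp [hz]), not_or]
    exact ⟨(h1 z hz).1, hq1 z hz⟩

theorem sel_eq_concat (ho : StrictOn N lt) (hN : ∀ x ∈ L, x ∈ N) (hL : L.Pairwise lt) (hy : y ∈ L)
    (hp : ∀ z ∈ L, p z ↔ z = y ∨ q z) (hq : ∀ z ∈ L, q z → lt z y) :
    sel p L = sel q L ++ [y] := by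
  obtain ⟨l₁, l₂, rfl, h1, h2⟩ := sel_split ho hN hL hy
  have hqy : ¬ q y := fun h => ho.irrefl y (hN y hy) (hq y hy h)
  have hq2 : ∀ z ∈ l₂, ¬ q z := fun z hz h => (h2 z hz).2 (hq z (by simp [hz]) h)
  rw [sel_append, sel_append, sel_cons_neg hqy, sel_eq_nil hq2,
    sel_cons_pos ((hp y hy).2 (Or.inl rfl)), sel_eq_nil (L := l₂), List.append_nil]
  · congr 1
    refine sel_congr fun z hz => ?_
    rw [hp z (by simp [hz]), or_iff_right (h1 z hz).1]
  · intro z hz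
    rw [hp z (by simp [hz]), not_or]
    exact ⟨(h2 z hz).1, hq2 z hz⟩

end Sel

variable {Dom Thread Reg Label : Type*}

/-! ### Realizing abstract executions -/

/-- The value of a store. -/
def Act.value [Zero Dom] : Act Dom → Dom
  | .st _ v => v
  | _ => 0

/-- The buffer entry of a store or fence. -/
def Action.entry (x : Action Dom Thread) : Entry Dom :=
  match x.act with
  | .st a v => .st x.node a v
  | .fence as => .fence x.node as
  -- An arbitrary value: only stores and fences are ever selected for a buffer.
  | _ => .fence x.node []

theorem Action.entry_isStoreTo {x : Action Dom Thread} {a : Dom} (h : x.entry.IsStoreTo a) :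
    x.IsStoreTo a := by
  obtain ⟨t, n, A⟩ := x
  obtain ⟨m, v, h⟩ := h
  cases A <;> simp_all [Action.entry, Action.IsStoreTo]

/-- The store or fence `x` of thread `t` is issued if the first `c t` instances are. -/
def Issued (c : Thread → ℕ) (t : Thread) (x : Action Dom Thread) : Prop :=
  x.thread = t ∧ x.node < c t ∧ x.act.Delayable

/-- In state `s`, it remains to execute the nodes in `rest` in the given order. Each thread `t` has
issued `c t` instances. The nodes in `A` have passed on to the all-addresses buffers. -/
structure Represents [Zero Dom] (σ : Thread → ℕ → Label × (Reg → Dom)) (N : Set (Action Dom Thread))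
    (lt : Action Dom Thread → Action Dom Thread → Prop) (s : State Dom Thread Reg Label)
    (rest : List (Action Dom Thread)) (A : Set (Action Dom Thread)) : Prop where
  pc : ∀ t, (s.pc t, s.reg t) = σ t (s.cnt t)
  buf : ∀ t a, s.buf t a = (sel (fun x => Issued s.cnt t x ∧ x ∉ A ∧ x.IsStoreTo a) rest).map
    fun x => (x.node, x.act.value)
  abuf : ∀ t, s.abuf t = (sel (fun x => Issued s.cnt t x ∧ x ∈ A) rest).map Action.entry
  mem : ∀ a, (∃ x ∈ N, x ∉ rest ∧ x.act = .st a (s.mem a) ∧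
      ∀ z ∈ N, z ∉ rest → z.IsStoreTo a → z = x ∨ lt z x) ∨
    ((∀ x ∈ N, x ∉ rest → ¬ x.IsStoreTo a) ∧ s.mem a = 0)
  sorted : rest.Pairwise lt
  rest_mem : ∀ x ∈ rest, x ∈ N
  lt_rest : ∀ x ∈ N, x ∉ rest → ∀ y ∈ rest, lt x y
  executed : ∀ x ∈ N, x ∉ rest → x.node < s.cnt x.thread
  delayable : ∀ x ∈ rest, x.node < s.cnt x.thread → x.act.Delayable
  issued : ∀ x ∈ rest, x ∈ A → x.node < s.cnt x.thread
  fence_mem : ∀ x ∈ rest, x.node < s.cnt x.thread → (∃ as, x.act = .fence as) → x ∈ A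
  -- The next two clauses make the FIFO order of the all-addresses buffer agree with `lt`. In each
  -- thread, `A` is an initial segment of the issued remaining nodes and precedes all stores and
  -- fences still to be issued.
  closed : ∀ x ∈ rest, x ∈ A → ∀ y ∈ rest, y.thread = x.thread → y.node < s.cnt y.thread →
    lt y x → y ∈ A
  lt_unissued : ∀ x ∈ rest, x ∈ A → ∀ y ∈ rest, y.thread = x.thread → s.cnt y.thread ≤ y.node →
    y.act.Delayable → lt x y

section Run

variable [Zero Dom] {P : Program Dom Thread Reg Label}

theorem Run.trans {s s' s'' : State Dom Thread Reg Label} {τ τ' : List (Action Dom Thread)}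
    (h : Run P s τ s') (h' : Run P s' τ' s'') : Run P s (τ ++ τ') s'' := by
  induction h with
  | nil => exact h'
  | cons hs _ ih => rw [List.append_assoc]; exact .cons hs (ih h')

theorem Step.run {s s' : State Dom Thread Reg Label} {o : Option (Action Dom Thread)}
    (h : Step P s o s') : Run P s o.toList s' := by
  simpa using Run.cons h (.nil s')

end Run

/-! ### Passing stores on to the all-addresses buffers -/

namespace Represents

variable [Zero Dom] {P : Program Dom Thread Reg Label} {σ : Thread → ℕ → Label × (Reg → Dom)}
  {N : Set (Action Dom Thread)} {lt : Action Dom Thread → Action Dom Thread → Prop}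
  {s : State Dom Thread Reg Label} {rest : List (Action Dom Thread)} {A : Set (Action Dom Thread)}

/-- The oldest store outside `A` of a thread passes on to the all-addresses buffer. -/
theorem advance (hV : Valid P σ N lt) (H : Represents σ N lt s rest A) {y : Action Dom Thread}
    (hy : y ∈ rest) (hc : y.node < s.cnt y.thread) (hA : y ∉ A)
    (hfirst : ∀ z ∈ rest, z.thread = y.thread → z.node < s.cnt z.thread → lt z y → z ∈ A)
    (hun : ∀ z ∈ rest, z.thread = y.thread → s.cnt z.thread ≤ z.node → z.act.Delayable → lt y z) :
    ∃ s', Run P s [] s' ∧ Represents σ N lt s' rest (insert y A) ∧ s'.cnt = s.cnt := by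
  classical
  have ho := hV.order
  obtain ⟨a, v, hact⟩ : ∃ a v, y.act = .st a v := by
    have hd := H.delayable y hy hc
    cases hyA : y.act with
    | st a v => exact ⟨a, v, rfl⟩
    | fence as => exact absurd (H.fence_mem y hy hc ⟨as, hyA⟩) hA
    | _ => rw [hyA] at hd; exact hd.elim
  have hbuf : s.buf y.thread a = (y.node, v) :: (sel (fun x => Issued s.cnt y.thread x ∧
      x ∉ insert y A ∧ x.IsStoreTo a) rest).map fun x => (x.node, x.act.value) := by
    have hv : y.act.value = v := by rw [hact]; rfl
    rw [H.buf, sel_eq_cons ho H.rest_mem H.sorted hy (q := fun x => Issued s.cnt y.thread x ∧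
      x ∉ insert y A ∧ x.IsStoreTo a), List.map_cons, hv]
    · intro z hz
      by_cases hzy : z = y
      · subst hzy
        simp only [true_or, iff_true]
        exact ⟨⟨rfl, hc, H.delayable z hz hc⟩, hA, v, hact⟩
      · simp [hzy]
    · rintro z hz ⟨⟨h1, h2, -⟩, h3, -⟩
      rw [Set.mem_insert_iff, not_or] at h3
      refine (ho.total z (H.rest_mem z hz) y (H.rest_mem y hy) h3.1).resolve_left fun h4 => ?_
      exact h3.2 (hfirst z hz h1 (h1 ▸ h2) h4)
  have habuf : ∀ t, (sel (fun x => Issued s.cnt t x ∧ x ∈ insert y A) rest).map Action.entry =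
      s.abuf t ++ if t = y.thread then [.st y.node a v] else [] := by
    intro t
    by_cases ht : t = y.thread
    · subst ht
      have hv : y.entry = .st y.node a v := by simp [Action.entry, hact]
      rw [if_pos rfl, H.abuf, sel_eq_concat ho H.rest_mem H.sorted hy (q := fun x =>
        Issued s.cnt y.thread x ∧ x ∈ A), List.map_append, List.map_cons, List.map_nil, hv]
      · intro z hz
        by_cases hzy : z = y
        · subst hzy
          simp only [Set.mem_insert_iff, true_or, and_true, iff_true]
          exact ⟨rfl, hc, H.delayable z hz hc⟩
        · simp [hzy]
      · rintro z hz ⟨⟨h1, h2, -⟩, h3⟩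
        refine (ho.total z (H.rest_mem z hz) y (H.rest_mem y hy) ?_).resolve_right fun h4 => ?_
        · rintro rfl; exact hA h3
        · exact hA (H.closed z hz h3 y hy h1.symm hc h4)
    · rw [if_neg ht, List.append_nil, H.abuf]
      congr 1
      refine sel_congr fun z _ => ?_
      have : Issued s.cnt t z → z ≠ y := by rintro h1 rfl; exact ht h1.1.symm
      simp only [Set.mem_insert_iff]
      tauto
  refine ⟨_, (Step.advance s y.thread a y.node v _ hbuf).run, ?_, rfl⟩
  refine
    { H with
      buf := ?_, abuf := ?_, issued := ?_, fence_mem := ?_, closed := ?_, lt_unissued := ?_ }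
  · intro t a'
    by_cases hta : t = y.thread ∧ a' = a
    · obtain ⟨rfl, rfl⟩ := hta
      simp [State.setABuf, State.setBuf]
    · have h1 : ((s.setBuf y.thread a ((sel (fun x => Issued s.cnt y.thread x ∧
          x ∉ insert y A ∧ x.IsStoreTo a) rest).map fun x => (x.node, x.act.value))).setABuf
          y.thread (s.abuf y.thread ++ [Entry.st y.node a v])).buf t a' = s.buf t a' := by
        by_cases ht : t = y.thread
        · subst ht
          have : a' ≠ a := fun h => hta ⟨rfl, h⟩
          simp [State.setABuf, State.setBuf, this]
        · simp [State.setABuf, State.setBuf, ht]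
      rw [h1, H.buf]
      congr 1
      refine sel_congr fun z _ => ?_
      have : Issued s.cnt t z ∧ z.IsStoreTo a' → z ≠ y := by
        rintro ⟨h5, h6⟩ rfl
        exact hta ⟨h5.1.symm, h6.eq ⟨v, hact⟩⟩
      simp only [Set.mem_insert_iff, not_or, State.setABuf, State.setBuf]
      tauto
  · intro t
    simp only [State.setABuf, State.setBuf]
    rw [habuf t]
    by_cases ht : t = y.thread
    · subst ht; simp
    · simp [ht]
  · rintro x hx (rfl | hxA)
    · exact hc
    · exact H.issued x hx hxA
  · intro x hx h1 h2
    exact Or.inr (H.fence_mem x hx h1 h2)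
  · rintro x hx (rfl | hxA) z hz ht hzc hlt
    · exact Or.inr (hfirst z hz ht hzc hlt)
    · exact Or.inr (H.closed x hx hxA z hz ht hzc hlt)
  · rintro x hx (rfl | hxA) z hz ht hzc hzd
    · exact hun z hz ht hzc hzd
    · exact H.lt_unissued x hx hxA z hz ht hzc hzd

/-- Before a fence is issued, the stores that are executed before it pass on to the all-addresses
buffer. -/
theorem advance_all (hV : Valid P σ N lt) {f : Action Dom Thread} (hf : f ∈ rest)
    (hff : ∃ as, f.act = .fence as) (hfc : f.node = s.cnt f.thread) (k : ℕ)
    (H : Represents σ N lt s rest A)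
    (hk : (sel (fun z => z.thread = f.thread ∧ z.node < s.cnt z.thread ∧ z ∉ A ∧ lt z f)
      rest).length = k) :
    ∃ s' A', Run P s [] s' ∧ Represents σ N lt s' rest A' ∧ s'.cnt = s.cnt ∧
      ∀ z ∈ rest, z.thread = f.thread → z.node < s.cnt z.thread → lt z f → z ∈ A' := by
  have ho := hV.order
  induction k generalizing s A with
  | zero =>
    refine ⟨s, A, .nil s, H, rfl, fun z hz h1 h2 h3 => ?_⟩
    by_contra h4
    rw [List.length_eq_zero_iff] at hk
    have : z ∈ sel (fun z => z.thread = f.thread ∧ z.node < s.cnt z.thread ∧ z ∉ A ∧ lt z f) rest :=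
      mem_sel.2 ⟨hz, h1, h2, h4, h3⟩
    rw [hk] at this
    simp at this
  | succ k ih =>
    -- The stores move one at a time, the one executed earliest first.
    obtain ⟨y, l, hl⟩ := List.exists_cons_of_length_eq_add_one hk
    have hy := (mem_sel (x := y)).1 (hl ▸ List.mem_cons_self)
    obtain ⟨hyr, h1, h2, h3, h4⟩ := hy
    have hp := (List.Pairwise.sublist sel_sublist H.sorted : (sel (fun z => z.thread = f.thread ∧
      z.node < s.cnt z.thread ∧ z ∉ A ∧ lt z f) rest).Pairwise lt)
    have hN : ∀ x ∈ rest, x ∈ N := H.rest_mem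
    obtain ⟨s', hr, H', hcnt⟩ := H.advance hV hyr h2 h3 (by
      intro z hz ht hzc hzy
      by_contra hzA
      have hzs : z ∈ sel (fun z => z.thread = f.thread ∧ z.node < s.cnt z.thread ∧ z ∉ A ∧ lt z f)
          rest := mem_sel.2 ⟨hz, ht.trans h1, hzc, hzA,
            ho.trans z (hN z hz) y (hN y hyr) f (hN f hf) hzy h4⟩
      rw [hl, List.mem_cons] at hzs
      rw [hl, List.pairwise_cons] at hp
      rcases hzs with rfl | hzs
      · exact ho.irrefl _ (hN _ hz) hzy
      · exact ho.asymm (hN z hz) (hN y hyr) hzy (hp.1 z hzs)) (by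
      intro z hz ht hzc hzd
      -- A store or fence of the thread not yet issued is `f` itself or follows `f` in program
      -- order, and then it cannot overtake the fence.
      by_cases hzf : z = f
      · exact hzf ▸ h4
      · have htf := ht.trans h1
        have hfz : f.PO z := by
          refine ⟨htf.symm, ?_⟩
          have h5 : z.node ≠ f.node := fun hn => hzf (hV.uniq z (hN z hz) f (hN f hf) htf hn)
          rw [htf] at hzc
          omega
        refine ho.trans y (hN y hyr) f (hN f hf) z (hN z hz) h4
          (hV.ppo f (hN f hf) z (hN z hz) hfz ?_)
        obtain ⟨as, has⟩ := hff
        cases hza : z.act <;> simp_all [Act.MayReorder, Act.Delayable])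
    have hk' : (sel (fun z => z.thread = f.thread ∧ z.node < s'.cnt z.thread ∧ z ∉ insert y A ∧
        lt z f) rest).length = k := by
      rw [hcnt]
      have := sel_eq_cons ho H.rest_mem H.sorted hyr (p := fun z => z.thread = f.thread ∧
        z.node < s.cnt z.thread ∧ z ∉ A ∧ lt z f) (q := fun z => z.thread = f.thread ∧
        z.node < s.cnt z.thread ∧ z ∉ insert y A ∧ lt z f) (by
          intro z hz
          by_cases hzy : z = y
          · subst hzy; exact ⟨fun _ => Or.inl rfl, fun _ => ⟨h1, h2, h3, h4⟩⟩
          · simp [hzy]) (by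
          rintro z hz ⟨h5, h6, h7, h8⟩
          rw [Set.mem_insert_iff, not_or] at h7
          have hzs : z ∈ sel (fun z => z.thread = f.thread ∧ z.node < s.cnt z.thread ∧ z ∉ A ∧
            lt z f) rest := mem_sel.2 ⟨hz, h5, h6, h7.2, h8⟩
          rw [hl, List.mem_cons] at hzs
          rw [hl, List.pairwise_cons] at hp
          exact hp.1 z (hzs.resolve_left h7.1))
      rw [this, List.length_cons] at hk
      omega
    obtain ⟨s'', A', hr', H'', hcnt', hA'⟩ := ih (hcnt ▸ hfc) H' hk'
    refine ⟨s'', A', hr.trans hr', H'', hcnt'.trans hcnt, fun z hz h5 h6 h7 => ?_⟩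
    exact hA' z hz h5 (hcnt ▸ h6) h7

end Represents

end StoreAtomic

/-! ### Issuing stores and fences in the simulation -/

namespace StoreAtomic

open Relation

variable {Dom Thread Reg Label : Type*}

namespace Represents

variable [Zero Dom] {P : Program Dom Thread Reg Label} {σ : Thread → ℕ → Label × (Reg → Dom)}
  {N : Set (Action Dom Thread)} {lt : Action Dom Thread → Action Dom Thread → Prop}
  {s : State Dom Thread Reg Label} {rest : List (Action Dom Thread)} {A : Set (Action Dom Thread)}

theorem issued_succ (H : Represents σ N lt s rest A) (hV : Valid P σ N lt)
    {x : Action Dom Thread} (hx : x ∈ N) {c : Thread → ℕ} (hc : x.node = s.cnt x.thread)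
    (hcx : c x.thread = s.cnt x.thread + 1) (hct : ∀ t, t ≠ x.thread → c t = s.cnt t)
    {z : Action Dom Thread} (hz : z ∈ rest) :
    (z.node < c z.thread ↔ z = x ∨ z.node < s.cnt z.thread) := by
  by_cases ht : z.thread = x.thread
  · rw [ht, hcx]
    refine ⟨fun h => ?_, ?_⟩
    · by_cases hn : z.node = x.node
      · exact Or.inl (hV.uniq z (H.rest_mem z hz) x hx ht hn)
      · right; omega
    · rintro (rfl | h) <;> omega
  · rw [hct _ ht]
    refine ⟨Or.inr, ?_⟩
    rintro (rfl | h)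
    · exact absurd rfl ht
    · exact h

/-- A store can be issued. -/
theorem issue_store (hV : Valid P σ N lt) (H : Represents σ N lt s rest A) {x : Action Dom Thread}
    (hx : x ∈ rest) (hc : x.node = s.cnt x.thread) {a v : Dom} (hact : x.act = .st a v) :
    ∃ s', Run P s [⟨x.thread, x.node, .isu⟩] s' ∧ Represents σ N lt s' rest A ∧
      s'.cnt x.thread = s.cnt x.thread + 1 ∧ ∀ t, t ≠ x.thread → s'.cnt t = s.cnt t := by
  classical
  have ho := hV.order
  have hxN := H.rest_mem x hx
  have hpc := H.pc x.thread
  have hst := hV.step x hxN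
  rw [hact, hc, ← hpc] at hst
  have hxd : x.act.Delayable := by rw [hact]; trivial
  have hxA : x ∉ A := fun h => by have := H.issued x hx h; omega
  generalize hq : σ x.thread (s.cnt x.thread + 1) = q at hst
  cases hst with
  | store _ _ ea ev l hi =>
  have hstep := Step.issueStore s x.thread ea ev l hi
  generalize hs' : ((s.setBuf x.thread (ea.eval (s.reg x.thread))
          (s.buf x.thread (ea.eval (s.reg x.thread)) ++ [(s.cnt x.thread, ev.eval (s.reg x.thread))])).goto
          x.thread l) = s' at hstep
  have hcx : s'.cnt x.thread = s.cnt x.thread + 1 := by subst hs'; simp [State.goto, State.setBuf]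
  have hct : ∀ t, t ≠ x.thread → s'.cnt t = s.cnt t := fun t ht => by
    subst hs'; simp [State.goto, State.setBuf, ht]
  have hpc' : (s'.pc x.thread, s'.reg x.thread) = (l, s.reg x.thread) := by
    subst hs'; simp [State.goto, State.setBuf]
  have hpct : ∀ t, t ≠ x.thread → s'.pc t = s.pc t ∧ s'.reg t = s.reg t := fun t ht => by
    subst hs'; simp [State.goto, State.setBuf, ht]
  have hmem : s'.mem = s.mem := by subst hs'; rfl
  have habuf : s'.abuf = s.abuf := by subst hs'; rfl
  have hbuf : ∀ t a', s'.buf t a' = s.buf t a' ++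
      if t = x.thread ∧ a' = ea.eval (s.reg x.thread) then
        [(x.node, ev.eval (s.reg x.thread))] else [] := by
    intro t a'
    rw [hc]
    subst hs'
    by_cases ht : t = x.thread
    · subst ht
      by_cases ha : a' = ea.eval (s.reg x.thread)
      · subst ha; simp [State.goto, State.setBuf]
      · simp [State.goto, State.setBuf, ha]
    · simp [State.goto, State.setBuf, ht]
  have hiss := fun {z} (hz : z ∈ rest) => H.issued_succ hV hxN hc hcx hct (z := z) hz
  have hIss : ∀ t, ∀ z ∈ rest, Issued s'.cnt t z ↔ (z = x ∧ t = x.thread) ∨ Issued s.cnt t z := by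
    intro t z hz
    constructor
    · rintro ⟨rfl, h2, h3⟩
      rcases (hiss hz).1 h2 with rfl | h
      · exact Or.inl ⟨rfl, rfl⟩
      · exact Or.inr ⟨rfl, h, h3⟩
    · rintro (⟨rfl, rfl⟩ | ⟨rfl, h2, h3⟩)
      · exact ⟨rfl, (hiss hz).2 (Or.inl rfl), hxd⟩
      · exact ⟨rfl, (hiss hz).2 (Or.inr h2), h3⟩
  refine ⟨s', by rw [hc]; exact hstep.run, ?_, hcx, hct⟩
  refine
    { pc := ?_, buf := ?_, abuf := ?_, mem := hmem ▸ H.mem, sorted := H.sorted,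
      rest_mem := H.rest_mem, lt_rest := H.lt_rest, executed := ?_, delayable := ?_, issued := ?_,
      fence_mem := ?_, closed := ?_, lt_unissued := ?_ }
  · intro t
    by_cases ht : t = x.thread
    · subst ht; rw [hpc', hcx, hq]
    · rw [(hpct t ht).1, (hpct t ht).2, hct t ht]; exact H.pc t
  · intro t a'
    rw [hbuf, H.buf]
    by_cases hta : t = x.thread ∧ a' = ea.eval (s.reg x.thread)
    · obtain ⟨rfl, rfl⟩ := hta
      have hv : x.act.value = ev.eval (s.reg x.thread) := by rw [hact]; rfl
      rw [if_pos ⟨rfl, rfl⟩, sel_eq_concat ho H.rest_mem H.sorted hx (p := fun z =>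
        Issued s'.cnt x.thread z ∧ z ∉ A ∧ z.IsStoreTo _) (q := fun z =>
        Issued s.cnt x.thread z ∧ z ∉ A ∧ z.IsStoreTo (ea.eval (s.reg x.thread))),
        List.map_append, List.map_cons, List.map_nil, hv]
      · intro z hz
        rw [hIss _ z hz]
        by_cases hzx : z = x
        · subst hzx
          simp only [true_and, true_or, iff_true]
          exact ⟨hxA, _, hact⟩
        · simp [hzx]
      -- Stores to one address are executed in program order, so appending `x` keeps the buffer
      -- sorted.
      · rintro z hz ⟨⟨h1, h2, h3⟩, h4, u, h5⟩
        refine hV.ppo z (H.rest_mem z hz) x hxN ⟨h1, by omega⟩ ?_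
        rw [h5, hact]
        simp [Act.MayReorder]
    · rw [if_neg hta, List.append_nil]
      congr 1
      refine sel_congr fun z hz => ?_
      rw [hIss t z hz]
      have : z.IsStoreTo a' → ¬ (z = x ∧ t = x.thread) := by
        rintro h5 ⟨rfl, rfl⟩
        exact hta ⟨rfl, h5.eq ⟨_, hact⟩⟩
      tauto
  · intro t
    rw [habuf, H.abuf]
    congr 1
    refine sel_congr fun z hz => ?_
    rw [hIss t z hz]
    have : z ∈ A → ¬ (z = x ∧ t = x.thread) := by
      rintro h5 ⟨rfl, rfl⟩
      exact hxA h5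
    tauto
  · intro z hz hzr
    have := H.executed z hz hzr
    by_cases ht : z.thread = x.thread
    · rw [ht] at this ⊢; omega
    · rw [hct _ ht]; exact this
  · intro z hz hzc
    rcases (hiss hz).1 hzc with rfl | h
    · exact hxd
    · exact H.delayable z hz h
  · exact fun z hz hzA => (hiss hz).2 (Or.inr (H.issued z hz hzA))
  · intro z hz hzc hzf
    rcases (hiss hz).1 hzc with rfl | h
    · obtain ⟨as, h⟩ := hzf
      rw [hact] at h; cases h
    · exact H.fence_mem z hz h hzf
  · intro z hz hzA y hy ht hyc hlt
    rcases (hiss hy).1 hyc with rfl | h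
    -- The clause `lt_unissued` for the earlier state excludes that the new store should have
    -- entered the all-addresses buffer before `z`.
    · exact absurd hlt (ho.asymm (H.rest_mem z hz) hxN
        (H.lt_unissued z hz hzA y hy ht hc.ge hxd))
    · exact H.closed z hz hzA y hy ht h hlt
  · intro z hz hzA y hy ht hyc hyd
    refine H.lt_unissued z hz hzA y hy ht (le_of_not_gt fun h => ?_) hyd
    have := (hiss hy).2 (Or.inr h)
    omega

/-- A fence can be issued if the stores that precede it are in the all-addresses buffer. -/
theorem issue_fence (hV : Valid P σ N lt) (H : Represents σ N lt s rest A) {x : Action Dom Thread}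
    (hx : x ∈ rest) (hc : x.node = s.cnt x.thread) {as : List Dom} (hact : x.act = .fence as)
    (hA : ∀ z ∈ rest, z.thread = x.thread → z.node < s.cnt z.thread → lt z x → z ∈ A) :
    ∃ s', Run P s [⟨x.thread, x.node, .isu⟩] s' ∧ Represents σ N lt s' rest (insert x A) ∧
      s'.cnt x.thread = s.cnt x.thread + 1 ∧ ∀ t, t ≠ x.thread → s'.cnt t = s.cnt t := by
  classical
  have ho := hV.order
  have hxN := H.rest_mem x hx
  have hpc := H.pc x.thread
  have hst := hV.step x hxN
  rw [hact, hc, ← hpc] at hst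
  have hxd : x.act.Delayable := by rw [hact]; trivial
  have hxA : x ∉ A := fun h => by have := H.issued x hx h; omega
  generalize hq : σ x.thread (s.cnt x.thread + 1) = q at hst
  cases hst with
  | fence _ _ es l hi =>
  have hstep := Step.issueFence s x.thread es l hi (by
    intro e he
    rw [H.buf, sel_eq_nil, List.map_nil]
    rintro z hz ⟨⟨h1, h2, h3⟩, h4, u, h5⟩
    -- A store waiting for a listed address must be executed before the fence, hence has already
    -- been passed on.
    refine h4 (hA z hz h1 (h1 ▸ h2) (hV.ppo z (H.rest_mem z hz) x hxN ⟨h1, by omega⟩ ?_))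
    rw [h5, hact]
    simp only [Act.MayReorder, not_not, List.mem_map]
    exact ⟨e, he, rfl⟩)
  generalize hs' : ((s.setABuf x.thread (s.abuf x.thread ++ [Entry.fence (s.cnt x.thread)
    (es.map fun e => e.eval (s.reg x.thread))])).goto x.thread l) = s' at hstep
  have hcx : s'.cnt x.thread = s.cnt x.thread + 1 := by subst hs'; simp [State.goto, State.setABuf]
  have hct : ∀ t, t ≠ x.thread → s'.cnt t = s.cnt t := fun t ht => by
    subst hs'; simp [State.goto, State.setABuf, ht]
  have hpc' : (s'.pc x.thread, s'.reg x.thread) = (l, s.reg x.thread) := by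
    subst hs'; simp [State.goto, State.setABuf]
  have hpct : ∀ t, t ≠ x.thread → s'.pc t = s.pc t ∧ s'.reg t = s.reg t := fun t ht => by
    subst hs'; simp [State.goto, State.setABuf, ht]
  have hmem : s'.mem = s.mem := by subst hs'; rfl
  have hbuf : s'.buf = s.buf := by subst hs'; rfl
  have habuf : ∀ t, s'.abuf t = s.abuf t ++ if t = x.thread then [x.entry] else [] := by
    intro t
    have he : x.entry = .fence (s.cnt x.thread) (es.map fun e => e.eval (s.reg x.thread)) := by
      simp [Action.entry, hact, hc]
    rw [he]
    subst hs'
    by_cases ht : t = x.thread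
    · subst ht; simp [State.goto, State.setABuf]
    · simp [State.goto, State.setABuf, ht]
  have hiss := fun {z} (hz : z ∈ rest) => H.issued_succ hV hxN hc hcx hct (z := z) hz
  have hIss : ∀ t, ∀ z ∈ rest, Issued s'.cnt t z ↔ (z = x ∧ t = x.thread) ∨ Issued s.cnt t z := by
    intro t z hz
    constructor
    · rintro ⟨rfl, h2, h3⟩
      rcases (hiss hz).1 h2 with rfl | h
      · exact Or.inl ⟨rfl, rfl⟩
      · exact Or.inr ⟨rfl, h, h3⟩
    · rintro (⟨rfl, rfl⟩ | ⟨rfl, h2, h3⟩)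
      · exact ⟨rfl, (hiss hz).2 (Or.inl rfl), hxd⟩
      · exact ⟨rfl, (hiss hz).2 (Or.inr h2), h3⟩
  refine ⟨s', by rw [hc]; exact hstep.run, ?_, hcx, hct⟩
  refine
    { pc := ?_, buf := ?_, abuf := ?_, mem := hmem ▸ H.mem, sorted := H.sorted,
      rest_mem := H.rest_mem, lt_rest := H.lt_rest, executed := ?_, delayable := ?_, issued := ?_,
      fence_mem := ?_, closed := ?_, lt_unissued := ?_ }
  · intro t
    by_cases ht : t = x.thread
    · subst ht; rw [hpc', hcx, hq]
    · rw [(hpct t ht).1, (hpct t ht).2, hct t ht]; exact H.pc t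
  · intro t a'
    rw [hbuf, H.buf]
    congr 1
    refine sel_congr fun z hz => ?_
    rw [hIss t z hz, Set.mem_insert_iff]
    have : z.IsStoreTo a' → z ≠ x := by
      rintro ⟨u, h5⟩ rfl
      rw [hact] at h5; cases h5
    tauto
  · intro t
    rw [habuf, H.abuf]
    by_cases ht : t = x.thread
    · subst ht
      rw [if_pos rfl, sel_eq_concat ho H.rest_mem H.sorted hx (p := fun z =>
        Issued s'.cnt x.thread z ∧ z ∈ insert x A) (q := fun z =>
        Issued s.cnt x.thread z ∧ z ∈ A),
        List.map_append, List.map_cons, List.map_nil]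
      · intro z hz
        rw [hIss _ z hz, Set.mem_insert_iff]
        by_cases hzx : z = x <;> simp [hzx]
      · rintro z hz ⟨⟨h1, -⟩, h2⟩
        exact H.lt_unissued z hz h2 x hx h1.symm hc.ge hxd
    · rw [if_neg ht, List.append_nil]
      congr 1
      refine sel_congr fun z hz => ?_
      rw [hIss _ z hz, Set.mem_insert_iff]
      have : Issued s.cnt t z → z ≠ x := by
        rintro ⟨h5, -⟩ rfl
        exact ht h5.symm
      tauto
  · intro z hz hzr
    have := H.executed z hz hzr
    by_cases ht : z.thread = x.thread
    · rw [ht] at this ⊢; omega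
    · rw [hct _ ht]; exact this
  · intro z hz hzc
    rcases (hiss hz).1 hzc with rfl | h
    · exact hxd
    · exact H.delayable z hz h
  · rintro z hz (rfl | hzA)
    · exact (hiss hz).2 (Or.inl rfl)
    · exact (hiss hz).2 (Or.inr (H.issued z hz hzA))
  · intro z hz hzc hzf
    rcases (hiss hz).1 hzc with rfl | h
    · exact Or.inl rfl
    · exact Or.inr (H.fence_mem z hz h hzf)
  · rintro z hz hzA y hy ht hyc hlt
    rcases (hiss hy).1 hyc with rfl | h
    · exact Or.inl rfl
    · right
      rcases hzA with rfl | hzA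
      · exact hA y hy ht h hlt
      · exact H.closed z hz hzA y hy ht h hlt
  · rintro z hz hzA y hy ht hyc hyd
    have hyc' : s.cnt y.thread ≤ y.node := le_of_not_gt fun h => by
      have := (hiss hy).2 (Or.inr h)
      omega
    rcases hzA with rfl | hzA
    · refine hV.ppo z hxN y (H.rest_mem y hy) ⟨ht.symm, ?_⟩ ?_
      · rw [ht] at hyc; omega
      · rw [hact]
        cases hya : y.act <;> simp_all [Act.MayReorder, Act.Delayable]
    · exact H.lt_unissued z hz hzA y hy ht hyc' hyd

/-- A store or fence can be issued. -/
theorem issue (hV : Valid P σ N lt) (H : Represents σ N lt s rest A) {x : Action Dom Thread}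
    (hx : x ∈ rest) (hc : x.node = s.cnt x.thread) (hd : x.act.Delayable) :
    ∃ s' A', Run P s [⟨x.thread, x.node, .isu⟩] s' ∧ Represents σ N lt s' rest A' ∧
      s'.cnt x.thread = s.cnt x.thread + 1 ∧ ∀ t, t ≠ x.thread → s'.cnt t = s.cnt t := by
  cases hact : x.act with
  | st a v =>
    obtain ⟨s', h⟩ := H.issue_store hV hx hc hact
    exact ⟨s', A, h⟩
  | fence as =>
    obtain ⟨s', A', hr, H', hcnt, hA'⟩ := advance_all hV hx ⟨as, hact⟩ hc _ H rfl
    obtain ⟨s'', hr', H'', h1, h2⟩ := H'.issue_fence hV hx (hcnt ▸ hc) hact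
      (fun z hz ht hzc hlt => hA' z hz ht (hcnt ▸ hzc) hlt)
    exact ⟨s'', _, hr.trans hr', H'', hcnt ▸ h1, hcnt ▸ h2⟩
  | _ => rw [hact] at hd; exact hd.elim

/-- Several stores and fences are issued. -/
theorem issue_many (hV : Valid P σ N lt) (t : Thread) (k : ℕ) (H : Represents σ N lt s rest A)
    (hk : ∀ j < k, ∃ x ∈ rest, x.thread = t ∧ x.node = s.cnt t + j ∧ x.act.Delayable) :
    ∃ l s' A', Run P s l s' ∧ Represents σ N lt s' rest A' ∧ s'.cnt t = s.cnt t + k ∧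
      (∀ y ∈ l, y.act = .isu ∧ y.thread = t ∧ y.node < s.cnt t + k) ∧
      l.Pairwise (fun x y => x.node < y.node) := by
  induction k with
  | zero => exact ⟨[], s, A, .nil s, H, rfl, by simp, .nil⟩
  | succ k ih =>
    obtain ⟨l, s', A', hr, H', hc, hl, hp⟩ := ih fun j hj => hk j (by omega)
    obtain ⟨x, hx, rfl, hn, hd⟩ := hk k (by omega)
    obtain ⟨s'', A'', hr', H'', h1, -⟩ := H'.issue hV hx (hn.trans hc.symm) hd
    refine ⟨l ++ [⟨x.thread, x.node, .isu⟩], s'', A'', hr.trans hr', H'', by omega, ?_, ?_⟩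
    · intro y hy
      rw [List.mem_append, List.mem_singleton] at hy
      rcases hy with hy | rfl
      · obtain ⟨h2, h3, h4⟩ := hl y hy
        exact ⟨h2, h3, by omega⟩
      · exact ⟨rfl, rfl, by simp only; omega⟩
    · rw [List.pairwise_append]
      refine ⟨hp, List.pairwise_singleton _ _, fun y hy z hz => ?_⟩
      rw [List.mem_singleton] at hz
      subst hz
      have := (hl y hy).2.2
      simp only
      omega

end Represents

end StoreAtomic

/-! ### Executing the first remaining node in the simulation -/

namespace StoreAtomic

open Relation

variable {Dom Thread Reg Label : Type*}

namespace Represents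

variable [Zero Dom] {P : Program Dom Thread Reg Label} {σ : Thread → ℕ → Label × (Reg → Dom)}
  {N : Set (Action Dom Thread)} {lt : Action Dom Thread → Action Dom Thread → Prop}
  {s s' : State Dom Thread Reg Label} {rest : List (Action Dom Thread)}
  {A : Set (Action Dom Thread)} {x : Action Dom Thread}

theorem head_mem (H : Represents σ N lt s (x :: rest) A) : x ∈ N :=
  H.rest_mem x List.mem_cons_self

theorem lt_of_mem (H : Represents σ N lt s (x :: rest) A) {z : Action Dom Thread} (hz : z ∈ rest) :
    lt x z := by
  have := H.sorted
  rw [List.pairwise_cons] at this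
  exact this.1 z hz

theorem head_notMem (ho : StrictOn N lt) (H : Represents σ N lt s (x :: rest) A) : x ∉ rest :=
  fun h => ho.irrefl x H.head_mem (H.lt_of_mem h)

theorem lt_head_iff (ho : StrictOn N lt) (H : Represents σ N lt s (x :: rest) A)
    {z : Action Dom Thread} (hz : z ∈ N) : lt z x ↔ z ∉ x :: rest := by
  refine ⟨fun hlt hzr => ?_, fun h => H.lt_rest z hz h x List.mem_cons_self⟩
  rw [List.mem_cons] at hzr
  rcases hzr with rfl | hzr
  · exact ho.irrefl _ hz hlt
  · exact ho.asymm hz H.head_mem hlt (H.lt_of_mem hzr)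

/-- The state after the first of the remaining nodes is executed. -/
theorem tail (ho : StrictOn N lt) (H : Represents σ N lt s (x :: rest) A)
    (hpc : ∀ t, (s'.pc t, s'.reg t) = σ t (s'.cnt t))
    (hcnt : ∀ z ∈ rest, z.node < s'.cnt z.thread ↔ z.node < s.cnt z.thread)
    (hle : ∀ t, s.cnt t ≤ s'.cnt t) (hx : x.node < s'.cnt x.thread)
    (hbuf : ∀ t a, s'.buf t a = (sel (fun x => Issued s.cnt t x ∧ x ∉ A ∧ x.IsStoreTo a) rest).map
      fun x => (x.node, x.act.value))
    (habuf : ∀ t, s'.abuf t = (sel (fun x => Issued s.cnt t x ∧ x ∈ A) rest).map Action.entry)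
    (hmem : ∀ a, (x.act = .st a (s'.mem a)) ∨ (¬ x.IsStoreTo a ∧ s'.mem a = s.mem a)) :
    Represents σ N lt s' rest A := by
  have hIss : ∀ t, ∀ z ∈ rest, Issued s'.cnt t z ↔ Issued s.cnt t z := by
    intro t z hz
    have := hcnt z hz
    constructor <;> rintro ⟨rfl, h1, h2⟩
    · exact ⟨rfl, this.1 h1, h2⟩
    · exact ⟨rfl, this.2 h1, h2⟩
  have hxr := H.head_notMem ho
  have hout : ∀ z, z ∉ rest → z = x ∨ z ∉ x :: rest := by
    intro z hz
    by_cases h : z = x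
    · exact Or.inl h
    · exact Or.inr (by simp [h, hz])
  have hin : ∀ z ∈ rest, z ∈ x :: rest := fun z hz => List.mem_cons_of_mem _ hz
  refine
    { pc := hpc, buf := ?_, abuf := ?_, mem := ?_, sorted := ?_,
      rest_mem := fun z hz => H.rest_mem z (hin z hz), lt_rest := ?_, executed := ?_,
      delayable := fun z hz hc => H.delayable z (hin z hz) ((hcnt z hz).1 hc),
      issued := fun z hz hA => (hcnt z hz).2 (H.issued z (hin z hz) hA),
      fence_mem := fun z hz hc => H.fence_mem z (hin z hz) ((hcnt z hz).1 hc),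
      closed := fun z hz hA y hy ht hc =>
        H.closed z (hin z hz) hA y (hin y hy) ht ((hcnt y hy).1 hc),
      lt_unissued := fun z hz hA y hy ht hc =>
        H.lt_unissued z (hin z hz) hA y (hin y hy) ht ((hle _).trans hc) }
  · intro t a
    rw [hbuf]
    congr 1
    exact sel_congr fun z hz => by rw [hIss t z hz]
  · intro t
    rw [habuf]
    congr 1
    exact sel_congr fun z hz => by rw [hIss t z hz]
  · intro a
    rcases hmem a with hxa | ⟨hxa, hm⟩
    · refine Or.inl ⟨x, H.head_mem, hxr, hxa, fun z hz hzr _ => ?_⟩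
      exact (hout z hzr).imp_right fun h => H.lt_rest z hz h x List.mem_cons_self
    · rw [hm]
      rcases H.mem a with ⟨w, hw, hwr, hwa, hmax⟩ | ⟨hno, h0⟩
      · refine Or.inl ⟨w, hw, fun h => hwr (hin w h), hwa, fun z hz hzr hza => ?_⟩
        rcases hout z hzr with rfl | h
        · exact absurd hza hxa
        · exact hmax z hz h hza
      · refine Or.inr ⟨fun z hz hzr hza => ?_, h0⟩
        rcases hout z hzr with rfl | h
        · exact hxa hza
        · exact hno z hz h hza
  · have := H.sorted
    rw [List.pairwise_cons] at this
    exact this.2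
  · intro z hz hzr y hy
    rcases hout z hzr with rfl | h
    · exact H.lt_of_mem hy
    · exact H.lt_rest z hz h y (hin y hy)
  · intro z hz hzr
    rcases hout z hzr with rfl | h
    · exact hx
    · exact (H.executed z hz h).trans_le (hle _)

/-- The first of the remaining nodes is executed if it is a store or fence that is already issued. -/
theorem execute_delayable (hV : Valid P σ N lt) (H : Represents σ N lt s (x :: rest) A)
    (hc : x.node < s.cnt x.thread) :
    ∃ s' A', Run P s [x] s' ∧ Represents σ N lt s' rest A' := by
  classical
  have ho := hV.order
  have hd := H.delayable x List.mem_cons_self hc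
  obtain ⟨s₁, A₁, hr₁, H₁, hc₁, hxA⟩ : ∃ s₁ A₁, Run P s [] s₁ ∧
      Represents σ N lt s₁ (x :: rest) A₁ ∧ s₁.cnt = s.cnt ∧ x ∈ A₁ := by
    by_cases hxA : x ∈ A
    · exact ⟨s, A, .nil s, H, rfl, hxA⟩
    -- As `x` is the first of the remaining nodes, nothing has to enter the all-addresses buffer
    -- before it.
    · obtain ⟨s', hr, H', hc'⟩ := H.advance hV List.mem_cons_self hc hxA
        (fun z hz _ _ hlt => absurd hz ((H.lt_head_iff ho (H.rest_mem z hz)).1 hlt))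
        (fun z hz ht hzc _ => by
          rw [List.mem_cons] at hz
          rcases hz with rfl | hz
          · omega
          · exact H.lt_of_mem hz)
      exact ⟨s', _, hr, H', hc', Or.inl rfl⟩
  rw [← hc₁] at hc
  have hbuf : ∀ t a, s₁.buf t a = (sel (fun x => Issued s₁.cnt t x ∧ x ∉ A₁ ∧ x.IsStoreTo a)
      rest).map fun x => (x.node, x.act.value) := fun t a => by
    rw [H₁.buf, sel_cons_neg]; exact fun h => h.2.1 hxA
  have habuf : s₁.abuf x.thread = x.entry :: (sel (fun y => Issued s₁.cnt x.thread y ∧ y ∈ A₁)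
      rest).map Action.entry := by
    rw [H₁.abuf, sel_cons_pos, List.map_cons]; exact ⟨⟨rfl, hc, hd⟩, hxA⟩
  have habuf' : ∀ t, t ≠ x.thread → s₁.abuf t = (sel (fun y => Issued s₁.cnt t y ∧ y ∈ A₁)
      rest).map Action.entry := fun t ht => by
    rw [H₁.abuf, sel_cons_neg]; exact fun h => ht h.1.1.symm
  cases hact : x.act with
  | st a v =>
    have he : x.entry = .st x.node a v := by simp [Action.entry, hact]
    rw [he] at habuf
    have hxe : x = ⟨x.thread, x.node, .st a v⟩ := by rw [← hact]
    have hstep := Step.storeToMemory (P := P) s₁ x.thread x.node a v _ habuf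
    rw [← hxe] at hstep
    refine ⟨_, A₁, hr₁.trans hstep.run, H₁.tail ho H₁.pc (fun _ _ => Iff.rfl) (fun _ => le_rfl) hc
      hbuf ?_ ?_⟩
    · intro t
      by_cases ht : t = x.thread
      · subst ht; simp [State.setABuf, State.setMem]
      · simp only [State.setABuf, State.setMem, Function.update_of_ne ht]; exact habuf' t ht
    · intro b
      by_cases hb : b = a
      · subst hb; left; simp [State.setABuf, State.setMem, hact]
      · right
        refine ⟨fun h => hb (h.eq ⟨v, hact⟩), ?_⟩
        simp [State.setABuf, State.setMem, hb]
  | fence as =>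
    have he : x.entry = .fence x.node as := by simp [Action.entry, hact]
    rw [he] at habuf
    have hxe : x = ⟨x.thread, x.node, .fence as⟩ := by rw [← hact]
    have hstep := Step.fence (P := P) s₁ x.thread x.node as _ habuf
    rw [← hxe] at hstep
    refine ⟨_, A₁, hr₁.trans hstep.run, H₁.tail ho H₁.pc (fun _ _ => Iff.rfl) (fun _ => le_rfl) hc
      hbuf ?_ ?_⟩
    · intro t
      by_cases ht : t = x.thread
      · subst ht; simp [State.setABuf]
      · simp only [State.setABuf, Function.update_of_ne ht]; exact habuf' t ht
    · intro b
      refine Or.inr ⟨?_, rfl⟩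
      rintro ⟨v, h⟩
      rw [hact] at h; cases h
  | _ => rw [hact] at hd; exact hd.elim

/-- A load can read its value. -/
theorem exists_read (hV : Valid P σ N lt) (H : Represents σ N lt s (x :: rest) A)
    (hc : x.node = s.cnt x.thread) {a v : Dom} (hact : x.act = .ld a v) :
    (∃ b n, s.buf x.thread a = b ++ [(n, v)]) ∨
      (s.buf x.thread a = [] ∧ ∃ b n c, s.abuf x.thread = b ++ Entry.st n a v :: c ∧
        ∀ y ∈ c, ¬ y.IsStoreTo a) ∨
      (s.buf x.thread a = [] ∧ (∀ y ∈ s.abuf x.thread, ¬ y.IsStoreTo a) ∧ v = s.mem a) := by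
  have ho := hV.order
  have hxN := H.head_mem
  -- Pending stores are visible, and the source is one of them if there is one.
  have hvis : ∀ z ∈ x :: rest, Issued s.cnt x.thread z → Visible lt z x :=
    fun z _ h => Or.inr ⟨h.1, hc ▸ h.2.1⟩
  have hsrc : ∀ z ∈ x :: rest, Issued s.cnt x.thread z → z.IsStoreTo a →
      ∃ w ∈ x :: rest, Issued s.cnt x.thread w ∧ w.act = .st a v ∧
        ∀ y ∈ N, y.IsStoreTo a → Visible lt y x → y = w ∨ lt y w := by
    intro z hz hzi hza
    have hzN := H.rest_mem z hz
    rcases hV.val x hxN a v hact with ⟨w, ⟨a', v', hact', hw, -, hwa, hwv, hmax⟩, hwv'⟩ | ⟨hno, -⟩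
    · rw [hact] at hact'; cases hact'
      have hwr : w ∈ x :: rest := by
        by_contra hwr
        rcases hmax z hzN hza (hvis z hz hzi) with rfl | hlt
        · exact hwr hz
        · exact ho.asymm hzN hw hlt (H.lt_rest w hw hwr z hz)
      have hpo : w.PO x := hwv.resolve_left fun h => (H.lt_head_iff ho hw).1 h hwr
      exact ⟨w, hwr, ⟨hpo.1, hc ▸ hpo.2, hwa.delayable⟩, hwv', hmax⟩
    · exact absurd (hvis z hz hzi) (hno z hzN hza)
  by_cases h1 : ∃ z ∈ x :: rest, Issued s.cnt x.thread z ∧ z ∉ A ∧ z.IsStoreTo a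
  · left
    obtain ⟨z, hz, hzi, hzA, hza⟩ := h1
    obtain ⟨w, hw, hwi, hwa, hmax⟩ := hsrc z hz hzi hza
    -- The source is not older than `z` in the execution order. Were it in `A`, then `z` would be
    -- too, by `closed`.
    have hwA : w ∉ A := by
      intro hwA
      rcases hmax z (H.rest_mem z hz) hza (hvis z hz hzi) with rfl | hlt
      · exact hzA hwA
      · exact hzA (H.closed w hw hwA z hz (hzi.1.trans hwi.1.symm) (hzi.1 ▸ hzi.2.1) hlt)
    have hv : w.act.value = v := by rw [hwa]; rfl
    refine ⟨(sel (fun y => (Issued s.cnt x.thread y ∧ y ∉ A ∧ y.IsStoreTo a) ∧ y ≠ w)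
      (x :: rest)).map fun x => (x.node, x.act.value), w.node, ?_⟩
    rw [H.buf, sel_eq_concat ho H.rest_mem H.sorted hw (q := fun y => (Issued s.cnt x.thread y ∧
      y ∉ A ∧ y.IsStoreTo a) ∧ y ≠ w), List.map_append, List.map_cons, List.map_nil, hv]
    · intro y _
      by_cases hyw : y = w
      · subst hyw
        simp only [true_or, iff_true]
        exact ⟨hwi, hwA, v, hwa⟩
      · simp [hyw]
    · rintro y hy ⟨⟨h2, h3, h4⟩, h5⟩
      exact (hmax y (H.rest_mem y hy) h4 (hvis y hy h2)).resolve_left h5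
  · right
    have hbuf : s.buf x.thread a = [] := by
      rw [H.buf, sel_eq_nil, List.map_nil]
      exact fun z hz h => h1 ⟨z, hz, h⟩
    by_cases h2 : ∃ z ∈ x :: rest, Issued s.cnt x.thread z ∧ z.IsStoreTo a
    · left
      obtain ⟨z, hz, hzi, hza⟩ := h2
      obtain ⟨w, hw, hwi, hwa, hmax⟩ := hsrc z hz hzi hza
      have hwA : w ∈ A := by
        by_contra hwA
        exact h1 ⟨w, hw, hwi, hwA, v, hwa⟩
      obtain ⟨l₁, l₂, hl, -, hl₂⟩ := sel_split ho H.rest_mem H.sorted hw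
      have he : w.entry = .st w.node a v := by simp [Action.entry, hwa]
      refine ⟨hbuf, (sel (fun y => Issued s.cnt x.thread y ∧ y ∈ A) l₁).map Action.entry, w.node,
        (sel (fun y => Issued s.cnt x.thread y ∧ y ∈ A) l₂).map Action.entry, ?_, ?_⟩
      · rw [H.abuf, hl, sel_append, sel_cons_pos ⟨hwi, hwA⟩, List.map_append, List.map_cons, he]
      · intro e he hea
        obtain ⟨y, hy, rfl⟩ := List.mem_map.1 he
        obtain ⟨hy2, hyi, -⟩ := mem_sel.1 hy
        have hyr : y ∈ x :: rest := by rw [hl]; simp [hy2]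
        have hya := Action.entry_isStoreTo hea
        rcases hmax y (H.rest_mem y hyr) hya (hvis y hyr hyi) with h3 | h3
        · exact (hl₂ y hy2).1 h3
        · exact (hl₂ y hy2).2 h3
    · right
      refine ⟨hbuf, ?_, ?_⟩
      · intro e he hea
        rw [H.abuf] at he
        obtain ⟨y, hy, rfl⟩ := List.mem_map.1 he
        obtain ⟨hyr, hyi, -⟩ := mem_sel.1 hy
        exact h2 ⟨y, hyr, hyi, Action.entry_isStoreTo hea⟩
      -- Without pending stores to the address, the visible stores are exactly the executed ones,
      -- whose last value is in memory.
      · have hex : ∀ z ∈ N, z.IsStoreTo a → (Visible lt z x ↔ z ∉ x :: rest) := by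
          intro z hz hza
          rw [← H.lt_head_iff ho hz]
          refine ⟨?_, Or.inl⟩
          rintro (h | h)
          · exact h
          · by_contra hlt
            rw [H.lt_head_iff ho hz, not_not] at hlt
            exact h2 ⟨z, hlt, ⟨h.1, hc ▸ h.2, hza.delayable⟩, hza⟩
        rcases hV.val x hxN a v hact with ⟨w, ⟨a', v', hact', hw, -, hwa, hwv, hmax⟩, hwv'⟩ |
            ⟨hno, hv⟩
        · rw [hact] at hact'; cases hact'
          rw [hex w hw hwa] at hwv
          rcases H.mem a with ⟨u, hu, hur, hua, hmax'⟩ | ⟨hno, -⟩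
          · have huw : u = w := by
              rcases hmax u hu ⟨_, hua⟩ ((hex u hu ⟨_, hua⟩).2 hur) with h | h
              · exact h
              · rcases hmax' w hw hwv hwa with h' | h'
                · exact h'.symm
                · exact absurd h (ho.asymm hw hu h')
            subst huw
            rw [hwv'] at hua
            cases hua
            rfl
          · exact absurd hwa (hno w hw hwv)
        · rcases H.mem a with ⟨u, hu, hur, hua, -⟩ | ⟨-, h0⟩
          · exact absurd ((hex u hu ⟨_, hua⟩).2 hur) (hno u hu ⟨_, hua⟩)
          · exact hv.trans h0.symm

/-- The first of the remaining nodes is executed if it is neither a store nor a fence. -/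
theorem execute_instr (hV : Valid P σ N lt) (H : Represents σ N lt s (x :: rest) A)
    (hc : x.node = s.cnt x.thread) (hd : ¬ x.act.Delayable) :
    ∃ s', Run P s [x] s' ∧ Represents σ N lt s' rest A := by
  classical
  have ho := hV.order
  have hxN := H.head_mem
  have hpc := H.pc x.thread
  have hst := hV.step x hxN
  rw [hc, ← hpc] at hst
  -- All instructions that are executed at once have the same effect: a jump and a new register
  -- valuation `r'`, which for `scfence` and assertions is the old one.
  have key : ∀ (r' : Reg → Dom) (l : Label), σ x.thread (s.cnt x.thread + 1) = (l, r') →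
      Step P s (some x) (({ s with reg := Function.update s.reg x.thread r' }).goto x.thread l) →
      ∃ s', Run P s [x] s' ∧ Represents σ N lt s' rest A := by
    intro r' l hσ hstep
    refine ⟨_, hstep.run, H.tail ho ?_ ?_ ?_ ?_ ?_ ?_ ?_⟩
    · intro t
      by_cases ht : t = x.thread
      · subst ht; simp [State.goto, hσ]
      · simpa [State.goto, ht] using H.pc t
    · intro z hz
      have := H.issued_succ hV hxN hc
        (c := Function.update s.cnt x.thread (s.cnt x.thread + 1))
        (by simp) (fun t ht => by simp [ht]) (List.mem_cons_of_mem x hz)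
      simp only [State.goto]
      rw [this, or_iff_right]
      rintro rfl
      exact H.head_notMem ho hz
    · intro t
      by_cases ht : t = x.thread
      · subst ht; simp [State.goto]
      · simp [State.goto, ht]
    · simp [State.goto, hc]
    · intro t a
      have := H.buf t a
      rw [sel_cons_neg] at this
      · exact this
      · exact fun h => hd h.1.2.2
    · intro t
      have := H.abuf t
      rw [sel_cons_neg] at this
      · exact this
      · exact fun h => hd h.1.2.2
    · exact fun a => Or.inr ⟨fun h => hd h.delayable, rfl⟩
  have hxe : ∀ B, x.act = B → x = ⟨x.thread, s.cnt x.thread, B⟩ := by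
    rintro _ rfl; rw [← hc]
  have hself : Function.update s.reg x.thread (s.reg x.thread) = s.reg :=
    Function.update_eq_self _ _
  generalize hq : σ x.thread (s.cnt x.thread + 1) = q at hst key
  generalize hB : x.act = B at hst
  cases hst with
  | load _ _ r e l v hi =>
    refine key _ _ rfl ?_
    have hxe := hxe _ hB
    rcases H.exists_read hV hc hB with ⟨b, n, h1⟩ | ⟨h1, b, n, c, h2, h3⟩ | ⟨h1, h2, h3⟩
    · have := Step.earlyRead₁ s x.thread r e l b n v hi h1
      rw [← hxe] at this
      exact this
    · have := Step.earlyRead₂ s x.thread r e l b c n v hi h1 h2 h3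
      rw [← hxe] at this
      exact this
    · have := Step.readMemory s x.thread r e l hi h1 h2
      rw [← h3, ← hxe] at this
      exact this
  | scfence _ _ l hi =>
    refine key _ _ rfl ?_
    have hempty : ∀ z ∈ x :: rest, ¬ Issued s.cnt x.thread z := by
      rintro z hz ⟨h1, h2, h3⟩
      have hzN := H.rest_mem z hz
      refine (H.lt_head_iff ho hzN).1 (hV.ppo z hzN x hxN ⟨h1, hc ▸ h2⟩ ?_) hz
      rw [hB]
      cases z.act <;> simp [Act.MayReorder]
    have := Step.scfence s x.thread l hi
      (by rw [H.abuf, sel_eq_nil, List.map_nil]; exact fun z hz h => hempty z hz h.1)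
      (fun a => by rw [H.buf, sel_eq_nil, List.map_nil]; exact fun z hz h => hempty z hz h.1)
    rw [← hxe _ hB] at this
    rw [hself]
    exact this
  | assign _ _ r e l hi =>
    refine key _ _ rfl ?_
    have := Step.assign s x.thread r e l hi
    rw [← hxe _ hB] at this
    exact this
  | assertion _ _ e l hi he =>
    refine key _ _ rfl ?_
    have := Step.assertion s x.thread e l hi he
    rw [← hxe _ hB] at this
    rw [hself]
    exact this
  | store => rw [hB] at hd; exact absurd trivial hd
  | fence => rw [hB] at hd; exact absurd trivial hd

/-- The first of the remaining nodes is executed, after the issue of all earlier stores and fences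
of the thread. -/
theorem execute (hV : Valid P σ N lt) (H : Represents σ N lt s (x :: rest) A) :
    ∃ l s' A', Run P s (l ++ [x]) s' ∧ Represents σ N lt s' rest A' ∧
      (∀ y ∈ l, y.act = .isu ∧ y.thread = x.thread ∧ y.node ≤ x.node) ∧
      l.Pairwise (fun x y => x.node < y.node) := by
  have ho := hV.order
  have hxN := H.head_mem
  by_cases hc : x.node < s.cnt x.thread
  · obtain ⟨s', A', hr, H'⟩ := H.execute_delayable hV hc
    exact ⟨[], s', A', hr, H', by simp, .nil⟩
  -- The instances of the thread before `x` that are not yet issued are stores and fences, since any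
  -- other would have to be executed before `x`.
  have hpend : ∀ j, j < x.node - s.cnt x.thread →
      ∃ z ∈ x :: rest, z.thread = x.thread ∧ z.node = s.cnt x.thread + j ∧ z.act.Delayable := by
    intro j hj
    obtain ⟨z, hz, hzt, hzn⟩ := hV.down x hxN (s.cnt x.thread + j) (by omega)
    have hzr : z ∈ x :: rest := by
      by_contra hzr
      have := H.executed z hz hzr
      rw [hzt] at this
      omega
    refine ⟨z, hzr, hzt, hzn, ?_⟩
    by_contra hzd
    refine (H.lt_head_iff ho hz).1 (hV.ppo z hz x hxN ⟨hzt, by omega⟩ fun h => ?_) hzr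
    exact hzd h.delayable
  by_cases hd : x.act.Delayable
  · obtain ⟨l, s', A', hr, H', hc', hl, hp⟩ := H.issue_many hV x.thread
      (x.node + 1 - s.cnt x.thread) (by
        intro j hj
        by_cases hjx : j < x.node - s.cnt x.thread
        · exact hpend j hjx
        · exact ⟨x, List.mem_cons_self, rfl, by omega, hd⟩)
    obtain ⟨s'', A'', hr', H''⟩ := H'.execute_delayable hV (by omega)
    refine ⟨l, s'', A'', hr.trans hr', H'', fun y hy => ?_, hp⟩
    obtain ⟨h1, h2, h3⟩ := hl y hy
    exact ⟨h1, h2, by omega⟩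
  · obtain ⟨l, s', A', hr, H', hc', hl, hp⟩ := H.issue_many hV x.thread
      (x.node - s.cnt x.thread) hpend
    obtain ⟨s'', hr', H''⟩ := H'.execute_instr hV (by omega) hd
    refine ⟨l, s'', A', hr.trans hr', H'', fun y hy => ?_, hp⟩
    obtain ⟨h1, h2, h3⟩ := hl y hy
    exact ⟨h1, h2, by omega⟩

end Represents

end StoreAtomic

namespace StoreAtomic

open Relation

variable {Dom Thread Reg Label : Type*}

/-! ### From abstract executions to computations -/

theorem StrictOn.exists_sorted {α : Type*} {N : Set α} {lt : α → α → Prop} (h : StrictOn N lt)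
    (hf : N.Finite) : ∃ L : List α, L.Pairwise lt ∧ ∀ x, x ∈ L ↔ x ∈ N := by
  induction hn : N.ncard generalizing N with
  | zero =>
    rw [Set.ncard_eq_zero hf] at hn
    exact ⟨[], .nil, by simp [hn]⟩
  | succ k ih =>
    obtain ⟨x, hx, hmin⟩ := h.exists_min hf ((Set.ncard_pos hf).1 (by omega))
    obtain ⟨L, hL, hmem⟩ := ih (h.subset Set.sdiff_subset) (hf.subset Set.sdiff_subset)
      (by rw [Set.ncard_sdiff_singleton_of_mem hx]; omega)
    refine ⟨x :: L, List.pairwise_cons.2 ⟨fun z hz => ?_, hL⟩, fun z => ?_⟩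
    · have := (hmem z).1 hz
      exact (hmin z this.1).resolve_left this.2
    · rw [List.mem_cons, hmem, Set.mem_sdiff, Set.mem_singleton_iff]
      by_cases hzx : z = x
      · simp [hzx, hx]
      · simp [hzx]

/-- The computation `τ` executes the nodes in `S`, where each node is immediately preceded by
issues of earlier instances of the same thread. -/
inductive Blocks : List (Action Dom Thread) → List (Action Dom Thread) → Prop
  | nil : Blocks [] []
  | cons {τ S l : List (Action Dom Thread)} {x : Action Dom Thread}
      (hl : ∀ y ∈ l, y.act = .isu ∧ y.thread = x.thread ∧ y.node ≤ x.node)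
      (hp : l.Pairwise fun y z => y.node < z.node) (h : Blocks τ S) : Blocks (l ++ x :: τ) (x :: S)

namespace Blocks

variable {τ S : List (Action Dom Thread)}

theorem mem_nodes_iff (h : Blocks τ S) (hS : ∀ x ∈ S, x.act ≠ .isu) (x : Action Dom Thread) :
    x ∈ nodes τ ↔ x ∈ S := by
  induction h with
  | nil => simp [nodes]
  | @cons τ S l w hl hp h ih =>
    have ih := ih fun y hy => hS y (by simp [hy])
    have hw := hS w (by simp)
    simp only [nodes, Set.mem_ofPred_eq, List.mem_append, List.mem_cons] at ih ⊢
    constructor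
    · rintro ⟨h1 | h1 | h1, hx⟩
      · exact absurd (hl x h1).1 hx
      · exact Or.inl h1
      · exact Or.inr (ih.1 ⟨h1, hx⟩)
    · rintro (rfl | h1)
      · exact ⟨by simp, hw⟩
      · exact ⟨by simp [(ih.2 h1).1], (ih.2 h1).2⟩

theorem sublist (h : Blocks τ S) : S.Sublist τ := by
  induction h with
  | nil => exact .slnil
  | cons hl hp h ih => exact (ih.cons_cons _).trans (List.sublist_append_right _ _)

theorem before (h : Blocks τ S) {x y : Action Dom Thread} (hxy : Before S x y) : Before τ x y := by
  induction h with
  | nil => exact absurd hxy.mem_left (by simp)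
  | @cons τ S l w hl hp h ih =>
    obtain ⟨α, β, he, hx⟩ := before_iff.1 hxy
    obtain _ | ⟨z, α⟩ := α
    · simp at hx
    · rw [List.cons_append, List.cons.injEq] at he
      obtain ⟨rfl, rfl⟩ := he
      rcases List.mem_cons.1 hx with rfl | hx
      · obtain ⟨γ, δ, rfl⟩ := List.append_of_mem (h.sublist.subset (by simp : y ∈ α ++ y :: β))
        exact ⟨l, γ, δ, by simp⟩
      · obtain ⟨γ, δ, rfl, hx⟩ := before_iff.1 (ih (before_iff.2 ⟨α, β, rfl, hx⟩))
        exact before_iff.2 ⟨l ++ w :: γ, δ, by simp, by simp [hx]⟩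

/-- After an issue, only issues of the same thread follow until a node of the thread is
executed. -/
theorem exists_next (h : Blocks τ S) (hS : ∀ x ∈ S, x.act ≠ .isu) {τ₁ τ₂ : List (Action Dom Thread)}
    {i : Action Dom Thread} (hi : i.act = .isu) (he : τ = τ₁ ++ i :: τ₂) :
    ∃ l w τ₃, τ₂ = l ++ w :: τ₃ ∧ (∀ y ∈ l, y.act = .isu) ∧ w ∈ S ∧ w.thread = i.thread ∧
      i.node ≤ w.node ∧ (w.node = i.node → l = []) := by
  induction h generalizing τ₁ with
  | nil => simp at he
  | @cons τ S l w hl hp h ih =>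
    have hw := hS w (by simp)
    have hwi : w ≠ i := by rintro rfl; exact hw hi
    rcases List.append_eq_append_iff.1 he with ⟨l', rfl, h2⟩ | ⟨l', rfl, h2⟩
    · obtain _ | ⟨z, l'⟩ := l'
      · rw [List.nil_append, List.cons.injEq] at h2
        exact absurd h2.1 hwi
      · rw [List.cons_append, List.cons.injEq] at h2
        obtain ⟨l₂, w', τ₃, h3, h4, h5, h6⟩ := ih (fun y hy => hS y (by simp [hy])) h2.2
        exact ⟨l₂, w', τ₃, h3, h4, by simp [h5], h6⟩
    · obtain _ | ⟨z, l'⟩ := l'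
      · rw [List.nil_append, List.cons.injEq] at h2
        exact absurd h2.1.symm hwi
      · rw [List.cons_append, List.cons.injEq] at h2
        obtain ⟨rfl, rfl⟩ := h2
        obtain ⟨-, h3, h4⟩ := hl i (by simp)
        refine ⟨l', w, τ, rfl, fun y hy => (hl y (by simp [hy])).1, by simp, h3.symm, h4, ?_⟩
        -- Within a block the instance numbers increase strictly and are at most that of `w`, so
        -- nothing comes between the issue of `w` and `w`.
        intro hn
        by_contra hne
        obtain ⟨y, hy⟩ := List.exists_mem_of_ne_nil l' hne
        have h5 := (List.pairwise_cons.1 (List.pairwise_append.1 hp).2.1).1 y hy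
        have h6 := (hl y (by simp [hy])).2.2
        omega

end Blocks

section

variable [Zero Dom] {P : Program Dom Thread Reg Label} {σ : Thread → ℕ → Label × (Reg → Dom)}
  {N : Set (Action Dom Thread)} {lt : Action Dom Thread → Action Dom Thread → Prop}

theorem Represents.exists_run (hV : Valid P σ N lt) {S : List (Action Dom Thread)}
    {s : State Dom Thread Reg Label} {A : Set (Action Dom Thread)} (H : Represents σ N lt s S A) :
    ∃ τ s', Run P s τ s' ∧ s'.BuffersEmpty ∧ Blocks τ S := by
  induction S generalizing s A with
  | nil =>
    exact ⟨[], s, .nil s, fun t => ⟨by simp [H.abuf, sel], fun a => by simp [H.buf, sel]⟩, .nil⟩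
  | cons x S ih =>
    obtain ⟨l, s₁, A₁, hr, H₁, hl, hp⟩ := H.execute hV
    obtain ⟨τ, s', hr', hb, h⟩ := ih H₁
    refine ⟨l ++ x :: τ, s', ?_, hb, .cons hl hp h⟩
    simpa using hr.trans hr'

theorem Valid.represents_initial (hV : Valid P σ N lt) {S : List (Action Dom Thread)}
    (hS : S.Pairwise lt) (hm : ∀ x, x ∈ S ↔ x ∈ N) :
    Represents σ N lt (State.initial P) S ∅ where
  pc t := (hV.init t).symm
  buf t a := by
    rw [sel_eq_nil fun x _ h => Nat.not_lt_zero _ h.1.2.1]; rfl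
  abuf t := by
    rw [sel_eq_nil fun x _ h => Nat.not_lt_zero _ h.1.2.1]; rfl
  mem a := Or.inr ⟨fun x hx hn => absurd ((hm x).2 hx) hn, rfl⟩
  sorted := hS
  rest_mem x hx := (hm x).1 hx
  lt_rest x hx hn := absurd ((hm x).2 hx) hn
  executed x hx hn := absurd ((hm x).2 hx) hn
  delayable x _ h := absurd h (Nat.not_lt_zero _)
  issued x _ h := h.elim
  fence_mem x _ h := absurd h (Nat.not_lt_zero _)
  closed x _ h := h.elim
  lt_unissued x _ h := h.elim

/-- Abstract executions are realized by computations that issue stores and fences as late as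
possible. -/
theorem Valid.exists_computation (hV : Valid P σ N lt) :
    ∃ τ ∈ computations P, nodes τ = N ∧ (∀ x ∈ N, ∀ y ∈ N, lt x y ↔ Before τ x y) ∧
      (∀ t, DelaysActions τ t → ∃ x ∈ N, ∃ y ∈ N, x.PO y ∧ lt y x ∧ x.thread = t) ∧
      ((∀ x ∈ N, ∀ y ∈ N, x.PO y → lt x y) → τ ∈ scComputations P) := by
  obtain ⟨S, hS, hm⟩ := hV.order.exists_sorted hV.fin
  obtain ⟨τ, s, hr, hb, h⟩ := (hV.represents_initial hS hm).exists_run hV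
  have hτ : τ ∈ computations P := ⟨s, hr, hb⟩
  obtain ⟨σ', R⟩ := exists_realizes hτ
  have hisu : ∀ x ∈ S, x.act ≠ .isu := fun x hx => hV.ne_isu x ((hm x).1 hx)
  have hN : nodes τ = N := Set.ext fun x => (h.mem_nodes_iff hisu x).trans (hm x)
  have ho := R.valid.order
  rw [hN] at ho
  have hlt : ∀ x ∈ N, ∀ y ∈ N, lt x y → Before τ x y := by
    intro x hx y hy hxy
    obtain ⟨l₁, l₂, rfl, -, h2⟩ :=
      sel_split hV.order (fun x hx => (hm x).1 hx) hS ((hm y).2 hy)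
    refine h.before (before_iff.2 ⟨l₁, l₂, rfl, ?_⟩)
    have hx' := (hm x).2 hx
    rw [List.mem_append, List.mem_cons] at hx'
    rcases hx' with h1 | rfl | h1
    · exact h1
    · exact absurd hxy (hV.order.irrefl x hx)
    · exact absurd hxy (h2 x h1).2
  have hiff : ∀ x ∈ N, ∀ y ∈ N, lt x y ↔ Before τ x y := by
    refine fun x hx y hy => ⟨hlt x hx y hy, fun hb => ?_⟩
    by_contra hn
    rcases hV.order.lt_of_not hx hy hn with rfl | h1
    · exact ho.irrefl x hx hb
    · exact ho.asymm hx hy hb (hlt y hy x hx h1)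
  refine ⟨τ, hτ, hN, hiff, ?_, fun hpo => ⟨hτ, ?_⟩⟩
  · rintro t ⟨τ₁, τ₂, τ₃, x, he, rfl, y, hy, -⟩
    have hnd := R.nodup
    have he' : τ = τ₁ ++ x.issue :: (τ₂ ++ x :: τ₃) := by simp [he]
    have hxN : x ∈ N := by
      rw [← hN]
      refine ⟨by simp [he], fun hx => ?_⟩
      have hxi : x.issue = x := by rw [Action.issue, ← hx]
      rw [he', hxi] at hnd
      exact (List.nodup_cons.1 (List.nodup_append.1 hnd).2.1).1 (by simp)
    -- The next executed node `w` belongs to the same thread and is not older than `x`. If it were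
    -- `x`, nothing would lie between the issue and `x`; so it is younger, and it is executed before
    -- `x`.
    obtain ⟨l, w, τ₄, h1, hl, hw, ht, hn, hnil⟩ := h.exists_next hisu rfl he'
    have hwN := (hm w).1 hw
    have hxl : x ∉ l := fun hx => hV.ne_isu x hxN (hl x hx)
    have hne : w.node ≠ x.node := by
      intro hn
      rw [hnil hn, List.nil_append, hV.uniq w hwN x hxN ht hn] at h1
      obtain _ | ⟨z, τ₂⟩ := τ₂
      · simp at hy
      · rw [List.cons_append, List.cons.injEq] at h1
        rw [he', h1.1] at hnd
        have := (List.nodup_cons.1 (List.nodup_append.1 hnd).2.1).2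
        exact (List.nodup_cons.1 this).1 (by simp)
    refine ⟨x, hxN, w, hwN, ⟨ht.symm, lt_of_le_of_ne hn hne.symm⟩, (hiff w hwN x hxN).2 ?_, rfl⟩
    have hx : x ∈ l ++ w :: τ₄ := by rw [← h1]; simp
    rw [List.mem_append, List.mem_cons] at hx
    rcases hx with hx | rfl | hx
    · exact absurd hx hxl
    · exact absurd rfl hne
    · obtain ⟨γ, δ, rfl⟩ := List.append_of_mem hx
      exact ⟨τ₁ ++ x.issue :: l, γ, δ, by rw [he', h1]; simp⟩
  · intro τ₁ τ₂ t n he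
    obtain ⟨l, w, τ₃, rfl, hl, hw, ht, hn, hnil⟩ := h.exists_next hisu rfl he
    by_cases hwn : w.node = n
    · exact ⟨w, τ₃, by rw [hnil hwn, List.nil_append], ht, hwn⟩
    -- Otherwise `w` is a younger instance, and by assumption `x` is executed before it. Between the
    -- issue of `x` and `w` there are only issues, so `x` would precede its own issue.
    · exfalso
      have hwN := (hm w).1 hw
      obtain ⟨x, hx, rfl, rfl, hd⟩ := R.node_of_isu t n (by simp [he])
      have hix := R.issue_lt x hx hd
      have hnd := R.nodup
      rw [hN] at hx
      have hxw := (hiff x hx w hwN).1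
        (hpo x hx w hwN ⟨ht.symm, lt_of_le_of_ne hn (Ne.symm hwn)⟩)
      rw [he, show τ₁ ++ (⟨x.thread, x.node, .isu⟩ : Action Dom Thread) :: (l ++ w :: τ₃) =
        (τ₁ ++ x.issue :: l) ++ w :: τ₃ by simp [Action.issue]] at hxw hnd
      rw [before_iff_of_nodup hnd, List.mem_append, List.mem_cons] at hxw
      rcases hxw with hxw | hxw | hxw
      · obtain ⟨γ, δ, rfl⟩ := List.append_of_mem hxw
        rw [he, show γ ++ x :: δ ++ (⟨x.thread, x.node, .isu⟩ : Action Dom Thread) ::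
          (l ++ w :: τ₃) = γ ++ x :: (δ ++ x.issue :: (l ++ w :: τ₃)) by
            simp [Action.issue]] at hix
        rw [before_iff_of_nodup (by simpa using hnd)] at hix
        have h2 : γ ++ x :: δ ++ x.issue :: l ++ w :: τ₃ =
          γ ++ (x :: (δ ++ x.issue :: (l ++ w :: τ₃))) := by simp
        rw [h2] at hnd
        exact (List.nodup_append.1 hnd).2.2 _ hix x.issue (by simp) rfl
      · exact hV.ne_isu x hx (by rw [hxw]; rfl)
      · exact hV.ne_isu x hx (hl x hxw)

end

end StoreAtomic

namespace StoreAtomic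

open Relation

variable {Dom Thread Reg Label : Type*}

/-! ### Traces of computations -/

section Congr

variable {N : Set (Action Dom Thread)} {lt lt' : Action Dom Thread → Action Dom Thread → Prop}

theorem isSrc_congr (h : ∀ x ∈ N, ∀ y ∈ N, lt x y ↔ lt' x y) (x y : Action Dom Thread) :
    IsSrc N lt x y ↔ IsSrc N lt' x y := by
  unfold IsSrc Visible
  refine exists₂_congr fun a v => and_congr_right fun _ => and_congr_right fun hx =>
    and_congr_right fun hy => and_congr_right fun _ => and_congr ?_ ?_
  · rw [h x hx y hy]
  · refine forall₂_congr fun z hz => ?_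
    rw [h z hz y hy, h z hz x hx]

theorem coherence_congr (h : ∀ x ∈ N, ∀ y ∈ N, lt x y ↔ lt' x y) (x y : Action Dom Thread) :
    Coherence N lt x y ↔ Coherence N lt' x y :=
  exists_congr fun _ => and_congr_right fun hx => and_congr_right fun hy => and_congr_right fun _ =>
    and_congr_right fun _ => h x hx y hy

theorem hb_congr (h : ∀ x ∈ N, ∀ y ∈ N, lt x y ↔ lt' x y) (x y : Action Dom Thread) :
    HB N lt x y ↔ HB N lt' x y := by
  unfold HB
  refine or_congr_right (or_congr (coherence_congr h x y) (or_congr (isSrc_congr h x y) ?_))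
  unfold FromRead Visible
  refine exists₂_congr fun a v => and_congr_right fun _ => and_congr_right fun hx =>
    and_congr_right fun hy => and_congr_right fun _ => forall₂_congr fun z hz => ?_
  rw [h z hz x hx, h z hz y hy]

theorem cyclicOn_congr (h : ∀ x ∈ N, ∀ y ∈ N, lt x y ↔ lt' x y) :
    CyclicOn N lt ↔ CyclicOn N lt' := by
  have : HB N lt = HB N lt' := funext₂ fun x y => propext (hb_congr h x y)
  rw [CyclicOn, CyclicOn, this]

end Congr

section

variable {τ τ' : List (Action Dom Thread)}

theorem storeOrder_iff_coherence {x y : Action Dom Thread} :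
    storeOrder τ x y ↔ Coherence (nodes τ) (Before τ) x y := by
  constructor
  · rintro ⟨a, ⟨v, hx⟩, ⟨w, hy⟩, h⟩
    exact ⟨a, ⟨h.mem_left, by simp [hx]⟩, ⟨h.mem_right, by simp [hy]⟩, ⟨v, hx⟩, ⟨w, hy⟩, h⟩
  · rintro ⟨a, -, -, hx, hy, h⟩
    exact ⟨a, hx, hy, h⟩

theorem conflict_iff {x y : Action Dom Thread} :
    conflict τ x y ↔ ∃ a v, x ∈ nodes τ ∧ y ∈ nodes τ ∧ x.act = .ld a v ∧ y.IsStoreTo a ∧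
      ((∃ z, source τ z x ∧ storeOrder τ z y) ∨
        ((∀ z, ¬ source τ z x) ∧ ∀ z, ¬ storeOrder τ z y)) := by
  refine exists₂_congr fun a v => ⟨?_, ?_⟩
  · rintro ⟨hx, hy, hxa, ⟨u, hya⟩, h⟩
    exact ⟨⟨hx, by simp [hxa]⟩, ⟨hy, by simp [hya]⟩, hxa, ⟨u, hya⟩, h⟩
  · rintro ⟨hx, hy, h⟩
    exact ⟨hx.1, hy.1, h⟩

/-- Program order depends only on the nodes, and conflicts are defined from sources and store order.
-/
theorem traceOf_eq (hn : nodes τ = nodes τ') (hst : ∀ x y, storeOrder τ x y ↔ storeOrder τ' x y)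
    (hsrc : ∀ x y, source τ x y ↔ source τ' x y) : traceOf τ = traceOf τ' := by
  have hst : storeOrder τ = storeOrder τ' := funext₂ fun x y => propext (hst x y)
  have hsrc : source τ = source τ' := funext₂ fun x y => propext (hsrc x y)
  have hcf : conflict τ = conflict τ' := funext₂ fun x y => by
    rw [eq_iff_iff, conflict_iff, conflict_iff, hn, hst, hsrc]
  have hpo : programOrder τ = programOrder τ' := funext₂ fun x y => by
    rw [programOrder, programOrder, hn]
  rw [traceOf, traceOf, hn, hst, hsrc, hcf, hpo]

end

section

variable [Zero Dom] {P : Program Dom Thread Reg Label}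
  {σ : Thread → ℕ → Label × (Reg → Dom)} {τ : List (Action Dom Thread)}

/-- The two relations differ only for loads of the initial value: `conflict` leads to the first
store to the address, `FromRead` to all of them. The others are reached from the first one by store
order, so the transitive closures agree. -/
theorem Realizes.cyclic_iff (R : Realizes P τ σ) :
    (traceOf τ).Cyclic ↔ CyclicOn (nodes τ) (Before τ) := by
  have ho := R.valid.order
  have h1 : ∀ x y, (traceOf τ).hb x y → HB (nodes τ) (Before τ) x y := by
    rintro x y (h | h | h | h)
    · exact Or.inl h
    · exact Or.inr (Or.inl (storeOrder_iff_coherence.1 h))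
    · exact Or.inr (Or.inr (Or.inl ((R.source x y).1 h)))
    · obtain ⟨a, v, hx, hy, hxa, hya, h⟩ := conflict_iff.1 h
      refine Or.inr (Or.inr (Or.inr (R.valid.fromRead_iff.2 ⟨a, v, hxa, hx, hy, hya, ?_⟩)))
      refine h.imp ?_ ?_
      · rintro ⟨z, hz, hzy⟩
        exact ⟨z, (R.source z x).1 hz, storeOrder_iff_coherence.1 hzy⟩
      · rintro ⟨h, -⟩ z hz
        exact h z ((R.source z x).2 hz)
  have h2 : ∀ x y, HB (nodes τ) (Before τ) x y → TransGen (traceOf τ).hb x y := by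
    rintro x y (h | h | h | h)
    · exact .single (Or.inl h)
    · exact .single (Or.inr (Or.inl (storeOrder_iff_coherence.2 h)))
    · exact .single (Or.inr (Or.inr (Or.inl ((R.source x y).2 h))))
    · obtain ⟨a, v, hxa, hx, hy, hya, ⟨z, hz, hzy⟩ | h⟩ := R.valid.fromRead_iff.1 h
      · exact .single (Or.inr (Or.inr (Or.inr (conflict_iff.2 ⟨a, v, hx, hy, hxa, hya, Or.inl
          ⟨z, (R.source z x).2 hz, storeOrder_iff_coherence.2 hzy⟩⟩))))
      · have hsub : {z ∈ nodes τ | z.IsStoreTo a} ⊆ nodes τ := Set.sep_subset _ _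
        obtain ⟨u, ⟨hu, hua⟩, hmin⟩ :=
          (ho.subset hsub).exists_min ((nodes_finite τ).subset hsub) ⟨y, hy, hya⟩
        have hxu : (traceOf τ).hb x u := by
          refine Or.inr (Or.inr (Or.inr (conflict_iff.2 ⟨a, v, hx, hu, hxa, hua, Or.inr
            ⟨fun z hz => h z ((R.source z x).1 hz), fun z hz => ?_⟩⟩)))
          obtain ⟨b, hzN, -, hzb, hub, hlt⟩ := storeOrder_iff_coherence.1 hz
          rw [hub.eq hua] at hzb
          rcases hmin z ⟨hzN, hzb⟩ with rfl | h'
          · exact ho.irrefl z hzN hlt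
          · exact ho.asymm hzN hu hlt h'
        rcases hmin y ⟨hy, hya⟩ with rfl | h'
        · exact .single hxu
        · exact .tail (.single hxu) (Or.inr (Or.inl ⟨a, hua, hya, h'⟩))
  constructor
  · rintro ⟨x, hx⟩
    exact ⟨x, TransGen.mono h1 _ _ hx⟩
  · rintro ⟨x, hx⟩
    exact ⟨x, TransGen.lift' id h2 _ _ hx⟩

/-- If a node is executed before one of its predecessors in the program order, then the latter is
delayed. -/
theorem Realizes.delaysActions (R : Realizes P τ σ) {x y : Action Dom Thread} (hx : x ∈ nodes τ)
    (hy : y ∈ nodes τ) (hpo : x.PO y) (hlt : Before τ y x) :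
    ∃ τ₁ τ₂ τ₃, τ = τ₁ ++ x.issue :: τ₂ ++ x :: τ₃ ∧ y ∈ τ₂ := by
  have hd : x.act.Delayable := by
    by_contra hd
    exact R.valid.order.asymm hx hy (R.valid.ppo x hx y hy hpo fun h => hd h.delayable) hlt
  have h1 := R.issue_lt_of_po x hx y hy hpo hd
  have hn := R.nodup
  obtain ⟨α, β, rfl, h2⟩ := before_iff.1 hlt
  obtain ⟨γ, δ, rfl⟩ := List.append_of_mem h2
  rw [List.append_assoc, List.cons_append] at h1 hn
  rw [before_iff_of_nodup hn] at h1
  obtain ⟨γ₁, γ₂, rfl⟩ := List.append_of_mem h1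
  exact ⟨γ₁, γ₂ ++ y :: δ, β, by simp, by simp⟩

/-- A node executed before a program-order predecessor would lie between that predecessor and its
issue. So the execution order extends program order. -/
theorem not_cyclic_of_sc (h : τ ∈ scComputations P) : ¬ (traceOf τ).Cyclic := by
  obtain ⟨σ, R⟩ := exists_realizes h.1
  rw [R.cyclic_iff]
  refine not_cyclicOn_of_po R.valid.order fun x hx y hy hpo => ?_
  by_contra hn
  have hne : x ≠ y := by rintro rfl; exact lt_irrefl _ hpo.2
  have hlt := (R.valid.order.total x hx y hy hne).resolve_left hn
  obtain ⟨τ₁, τ₂, τ₃, he, hyτ⟩ := R.delaysActions hx hy hpo hlt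
  obtain ⟨w, τ₄, hw, hwt, hwn⟩ := h.2 τ₁ (τ₂ ++ x :: τ₃) x.thread x.node (by simp [he, Action.issue])
  obtain _ | ⟨z, τ₂⟩ := τ₂
  · simp at hyτ
  rw [List.cons_append, List.cons.injEq] at hw
  obtain ⟨rfl, -⟩ := hw
  have hnd := R.nodup
  rw [he, List.append_assoc] at hnd
  have hnd := (List.nodup_append.1 hnd).2.1
  have hz : z.act ≠ .isu := by
    intro hz
    have hzx : z = x.issue := by rw [Action.issue, ← hwt, ← hwn, ← hz]
    exact (List.nodup_cons.1 hnd).1 (by simp [hzx])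
  have hzx : z = x := R.valid.uniq z ⟨by simp [he], hz⟩ x hx hwt hwn
  rw [hzx] at hnd
  exact (List.nodup_cons.1 (List.nodup_cons.1 hnd).2).1 (by simp)

/-- A computation with an acyclic trace has the trace of a computation under sequential
consistency. -/
theorem exists_sc_of_not_cyclic (h : τ ∈ computations P) (hc : ¬ (traceOf τ).Cyclic) :
    ∃ τ' ∈ scComputations P, traceOf τ' = traceOf τ := by
  obtain ⟨σ, R⟩ := exists_realizes h
  rw [R.cyclic_iff] at hc
  obtain ⟨lt, hV, hpo, hsrc, hco⟩ := R.valid.exists_sc hc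
  obtain ⟨τ', hτ', hn, hlt, -, hsc⟩ := hV.exists_computation
  obtain ⟨σ', R'⟩ := exists_realizes hτ'
  refine ⟨τ', hsc hpo, traceOf_eq hn (fun x y => ?_) fun x y => ?_⟩
  · rw [storeOrder_iff_coherence, storeOrder_iff_coherence, hn, ← hco, coherence_congr hlt]
  · rw [R'.source, R.source, hn, ← hsrc, isSrc_congr hlt]

/-- If there is a violating computation, then there is one in which exactly one thread delays
actions. -/
theorem Violating.exists_single_thread (h : Violating P τ) :
    ∃ τ, Violating P τ ∧ ∃! t, DelaysActions τ t := by
  obtain ⟨σ, R⟩ := exists_realizes h.1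
  obtain ⟨N, lt, m, hm⟩ := R.valid.exists_minimalViolation (R.cyclic_iff.1 h.2)
  obtain ⟨σ', N', lt', s, hV, hc, hs⟩ := hm.exists_single_thread
  obtain ⟨τ', hτ', rfl, hlt, hdel, -⟩ := hV.exists_computation
  obtain ⟨σ'', R'⟩ := exists_realizes hτ'
  have huniq : ∀ t, DelaysActions τ' t → t = s := by
    intro t ht
    obtain ⟨x, hx, y, hy, hpo, hyx, rfl⟩ := hdel t ht
    exact hs x hx y hy hpo hyx
  have hc := (cyclicOn_congr hlt).1 hc
  refine ⟨τ', ⟨hτ', R'.cyclic_iff.2 hc⟩, s, ?_, huniq⟩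
  by_contra hn
  -- Without any delay the execution order would extend program order and the trace would be
  -- acyclic. So some thread delays, and it must be `s`.
  refine not_cyclicOn_of_po R'.valid.order (fun x hx y hy hpo => ?_) hc
  have hne : x ≠ y := by rintro rfl; exact lt_irrefl _ hpo.2
  refine (R'.valid.order.total x hx y hy hne).resolve_right fun hyx => hn ?_
  obtain ⟨τ₁, τ₂, τ₃, he, hyτ⟩ := R'.delaysActions hx hy hpo hyx
  have hd : DelaysActions τ' x.thread := ⟨τ₁, τ₂, τ₃, x, he, rfl, y, hyτ, hpo.1.symm⟩
  exact huniq _ hd ▸ hd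

end

end StoreAtomic

/-! ### The theorem -/

theorem theorem1 {Dom Thread Reg Label : Type*} [Zero Dom] [Finite Thread] [Finite Reg]
    (P : StoreAtomic.Program Dom Thread Reg Label) :
    ¬ StoreAtomic.Robust P ↔
      ∃ τ : List (StoreAtomic.Action Dom Thread),
        StoreAtomic.Violating P τ ∧ ∃! t : Thread, StoreAtomic.DelaysActions τ t := by
  constructor
  · intro h
    obtain ⟨_, ⟨τ, hτ, rfl⟩, hn⟩ := Set.not_subset.1 h
    by_cases hc : (StoreAtomic.traceOf τ).Cyclic
    · exact StoreAtomic.Violating.exists_single_thread ⟨hτ, hc⟩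
    · exact absurd (StoreAtomic.exists_sc_of_not_cyclic hτ hc) hn
  · rintro ⟨τ, ⟨hτ, hc⟩, -⟩ h
    obtain ⟨τ', hτ', he⟩ := h ⟨τ, hτ, rfl⟩
    exact StoreAtomic.not_cyclic_of_sc hτ' (he ▸ hc)
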